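/- Let $S$ be a complex manifold and let $\mathcal V\to S$ be a variation of graded-polarized mixed Hodge structure: a $\mathbb Q$-local system of finite rank with a weight filtration $\mathcal W$ by $\mathbb Q$-local subsystems, a Hodge filtration $\mathcal F$ of $\mathcal V_{\mathbb C}\otimes\mathcal O_S$ by holomorphic subbundles with $\nabla\mathcal F^p\subseteq\Omega^1_S\otimes\mathcal F^{p-1}$ (where $\nabla$ is the Gauss–Manin connection), and flat rational bilinear forms on the $Gr^{\mathcal W}_k$ for which each $Gr^{\mathcal W}_k$ is a variation of pure polarized Hodge structure of weight $k$. On each fibre let $\mathcal V_s=\bigoplus_{p,q}I^{p,q}_s$ be Deligne's bigrading of $(\mathcal F_s,\mathcal W_s)$, that is, the unique one with $\mathcal F^p=\bigoplus_{r\ge p,s}I^{r,s}$, $\mathcal W_k=\bigoplus_{r+s\le k}I^{r,s}$ and $I^{p,q}\equiv\overline{I^{q,p}}$ modulo $\bigoplus_{r<p,s<q}I^{r,s}$. Put $\mathcal U^p=\bigoplus_q I^{p,q}$, and let $Y$ be the Deligne grading, the endomorphism that acts on $I^{p,q}$ as multiplication by $p+q$. Then the $\mathcal U^p$ are $C^\infty$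 subbundles, and $\nabla$ decomposes uniquely as $\nabla=\tau+\bar\partial+\partial+\theta$, where $$\bar\partial:\mathcal E^0(\mathcal U^p)\to\mathcal E^{0,1}(\mathcal U^p),\quad \partial:\mathcal E^0(\mathcal U^p)\to\mathcal E^{1,0}(\mathcal U^p),\quad \tau\in \mathrm{Hom}(\mathcal U^p,\mathcal U^{p+1})\otimes\mathcal E^{0,1},\quad \theta\in \mathrm{Hom}(\mathcal U^p,\mathcal U^{p-1})\otimes\mathcal E^{1,0}$$ for all $p$. For an endomorphism $\alpha$ write $\alpha^Y$ for its component of weight zero (eigenvalue $0$) relative to $\mathrm{ad}\,Y$, and let $\bar\theta$ be the complex conjugate of $\theta$, an endomorphism-valued $(0,1)$-form. Then: 1. $\tau=(\bar\theta)^Y$. 2. For each $p$, $\mathcal U^p$ is a holomorphic subbundle of $\mathcal V$ relative to the complex structure $\nabla^{0,1}$ if and only if $(\bar\theta)^Y$ vanishes on $\mathcal U^p$. 3. If $\mathcal U^p=0$ for all $p>b$, then $\mathcal U^b$ is a holomorphic subbundle of $\mathcal V$ relative to $\nabla^{0,1}$. -/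

import Mathlib

open scoped TensorProduct Manifold ContDiff Topology

noncomputable section

namespace MixedHodge

universe u v w

section LinearAlgebra

/-- The complexification `V_ℂ = ℂ ⊗ V` of a rational vector space. -/
abbrev Cx (V : Type v) [AddCommGroup V] [Module ℚ V] : Type v := ℂ ⊗[ℚ] V

/-- Complex conjugation `z ⊗ v ↦ z̄ ⊗ v` on `V_ℂ`. -/
def conj (V : Type v) [AddCommGroup V] [Module ℚ V] : Cx V →ₛₗ[starRingEnd ℂ] Cx V where
  toFun := LinearMap.rTensor V (Complex.conjAe.toLinearMap.restrictScalars ℚ)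
  map_add' := map_add _
  map_smul' := by
    intro c x
    induction x using TensorProduct.induction_on with
    | zero => simp
    | tmul z w => simp [TensorProduct.smul_tmul']
    | add x y hx hy => simp only [smul_add, map_add, hx, hy]

/-- The conjugate `ᾱ = conj ∘ α ∘ conj` of an endomorphism of `V_ℂ`. -/
def conjEnd {V : Type v} [AddCommGroup V] [Module ℚ V] (α : Module.End ℂ (Cx V)) :
    Module.End ℂ (Cx V) :=
  (conj V).comp (α.comp (conj V))

/-- The conjugate of a complex subspace of `V_ℂ`. -/
def conjSub {V : Type v} [AddCommGroup V] [Module ℚ V] (U : Submodule ℂ (Cx V)) :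
    Submodule ℂ (Cx V) :=
  U.map (conj V)

/-- A decreasing filtration `F` of `H_ℂ` is a pure Hodge structure of weight `k` on `H`:
it is finite, and `H_ℂ = F^p ⊕ conj F^q` whenever `p + q = k + 1`. -/
structure IsPureHodge {H : Type v} [AddCommGroup H] [Module ℚ H] (k : ℤ)
    (F : ℤ → Submodule ℂ (Cx H)) : Prop where
  antitone : Antitone F
  exists_top : ∃ a, F a = ⊤
  exists_bot : ∃ b, F b = ⊥
  isCompl : ∀ p q : ℤ, p + q = k + 1 → IsCompl (F p) (conjSub (F q))

/-- The rational bilinear form `Q` polarizes the pure Hodge structure `F` of weight `k`. -/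
structure IsPolarization {H : Type v} [AddCommGroup H] [Module ℚ H] (k : ℤ)
    (F : ℤ → Submodule ℂ (Cx H)) (Q : LinearMap.BilinForm ℚ H) : Prop where
  parity : ∀ x y, Q x y = (-1 : ℚ) ^ k * Q y x
  nondegenerate : Q.Nondegenerate
  /-- First Riemann bilinear relation. -/
  orthogonal : ∀ p : ℤ, ∀ x ∈ F p, ∀ y ∈ F (k - p + 1),
    LinearMap.BilinForm.baseChange ℂ Q x y = 0
  /-- Second Riemann bilinear relation: `i^(p-q) Q(x, x̄) > 0` on `H^{p,q} = F^p ∩ conj F^q`. -/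
  positive : ∀ p q : ℤ, p + q = k → ∀ x ∈ F p ⊓ conjSub (F q), x ≠ 0 →
    0 < (Complex.I ^ (p - q) * LinearMap.BilinForm.baseChange ℂ Q x (conj H x)).re ∧
      (Complex.I ^ (p - q) * LinearMap.BilinForm.baseChange ℂ Q x (conj H x)).im = 0

variable {V : Type v} [AddCommGroup V] [Module ℚ V]

/-- `Gr^W_k = W_k / W_{k-1}`, a rational vector space. -/
abbrev Gr (W : ℤ → Submodule ℚ V) (k : ℤ) : Type v :=
  W k ⧸ (W (k - 1)).submoduleOf (W k)

/-- The induced filtration `F^p Gr^W_k = (F^p ∩ W_k + W_{k-1}) / W_{k-1}`, as the image in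
`ℂ ⊗ Gr^W_k` of the subspace of `ℂ ⊗ W_k` that lies in `F^p`. -/
def grF (W : ℤ → Submodule ℚ V) (F : ℤ → Submodule ℂ (Cx V)) (k p : ℤ) :
    Submodule ℂ (Cx (Gr W k)) :=
  ((F p).comap ((W k).subtype.baseChange ℂ)).map
    (((W (k - 1)).submoduleOf (W k)).mkQ.baseChange ℂ)

/-- `(F, W)` is a mixed Hodge structure on `V`. -/
structure IsMHS (W : ℤ → Submodule ℚ V) (F : ℤ → Submodule ℂ (Cx V)) : Prop where
  monotone_W : Monotone W
  exists_W_bot : ∃ a, W a = ⊥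
  exists_W_top : ∃ b, W b = ⊤
  antitone_F : Antitone F
  exists_F_top : ∃ a, F a = ⊤
  exists_F_bot : ∃ b, F b = ⊥
  pure : ∀ k, IsPureHodge k (grF W F k)

/-- `I` is a bigrading of `(F, W)` with
`I^{p,q} = conj I^{q,p} mod ⨁_{r<p, s<q} I^{r,s}`. -/
structure IsDeligneBigrading (W : ℤ → Submodule ℚ V) (F : ℤ → Submodule ℂ (Cx V))
    (I : ℤ → ℤ → Submodule ℂ (Cx V)) : Prop where
  isInternal : DirectSum.IsInternal (fun pq : ℤ × ℤ => I pq.1 pq.2)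
  F_eq : ∀ p, F p = ⨆ (r : ℤ) (s : ℤ) (_ : p ≤ r), I r s
  W_eq : ∀ k, (W k).baseChange ℂ = ⨆ (r : ℤ) (s : ℤ) (_ : r + s ≤ k), I r s
  conj_mod : ∀ p q, I p q ⊔ (⨆ (r : ℤ) (s : ℤ) (_ : r < p ∧ s < q), I r s) =
    conjSub (I q p) ⊔ (⨆ (r : ℤ) (s : ℤ) (_ : r < p ∧ s < q), I r s)

/-- The Deligne bigrading `I^{p,q}` of `(F, W)`: the (unique) bigrading with
`I^{p,q} = conj I^{q,p} mod ⨁_{r<p, s<q} I^{r,s}`. -/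
def deligneI (W : ℤ → Submodule ℚ V) (F : ℤ → Submodule ℂ (Cx V)) :
    ℤ → ℤ → Submodule ℂ (Cx V) :=
  Classical.epsilon (IsDeligneBigrading W F)

open Classical in
/-- For a direct sum decomposition `⨁ I^{p,q}`, the semisimple endomorphism `Y` that acts on
`I^{p,q}` as multiplication by `p + q`. -/
def gradingOf (I : ℤ → ℤ → Submodule ℂ (Cx V)) : Module.End ℂ (Cx V) :=
  if h : DirectSum.IsInternal (fun pq : ℤ × ℤ => I pq.1 pq.2) then
    (DirectSum.toModule ℂ (ℤ × ℤ) (Cx V)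
        (fun pq => ((pq.1 + pq.2 : ℤ) : ℂ) • (I pq.1 pq.2).subtype)) ∘ₗ
      (LinearEquiv.ofBijective
        (DirectSum.coeLinearMap (fun pq : ℤ × ℤ => I pq.1 pq.2)) h).symm.toLinearMap
  else 0

/-- `ad Y = [Y, ·]` on endomorphisms. -/
def ad {M : Type v} [AddCommGroup M] [Module ℂ M] (Y : Module.End ℂ M) :
    Module.End ℂ (Module.End ℂ M) :=
  LinearMap.mulLeft ℂ Y - LinearMap.mulRight ℂ Y

open Classical in
/-- The component `α^Y` of weight zero of `α` relative to `ad Y`: the projection of `α` to the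
`0`-eigenspace of `ad Y` along the sum of the other eigenspaces (for semisimple `Y` these
two subspaces are complementary). -/
def adWeightZero {M : Type v} [AddCommGroup M] [Module ℂ M] (Y α : Module.End ℂ M) :
    Module.End ℂ M :=
  if h : IsCompl (Module.End.eigenspace (ad Y) (0 : ℂ))
      (⨆ (μ : ℂ) (_ : μ ≠ 0), Module.End.eigenspace (ad Y) μ) then
    Submodule.projection _ _ h α
  else 0

end LinearAlgebra

/-- A `ℚ`-local system of finite rank on `S`: its fibres, together with, around each point `s₀`,
a flat trivialization on an open set `dom s₀`, such that the transition maps between these are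
locally constant. (The value of `chart s₀ s` for `s ∉ dom s₀` is irrelevant.) -/
structure RationalLocalSystem (S : Type u) [TopologicalSpace S] where
  fiber : S → Type v
  [addCommGroup : ∀ s, AddCommGroup (fiber s)]
  [module : ∀ s, Module ℚ (fiber s)]
  rank : S → ℕ
  dom : S → Set S
  isOpen_dom : ∀ s₀, IsOpen (dom s₀)
  mem_dom : ∀ s₀, s₀ ∈ dom s₀
  chart : ∀ s₀ s, fiber s →ₗ[ℚ] (Fin (rank s₀) → ℚ)
  bijective_chart : ∀ s₀, ∀ s ∈ dom s₀, Function.Bijective (chart s₀ s)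
  locallyConstant : ∀ s₀ s₁, ∀ s ∈ dom s₀ ∩ dom s₁,
    ∃ A : (Fin (rank s₀) → ℚ) →ₗ[ℚ] (Fin (rank s₁) → ℚ),
      ∀ᶠ s' in 𝓝 s, chart s₁ s' = A ∘ₗ chart s₀ s'

attribute [instance] RationalLocalSystem.addCommGroup RationalLocalSystem.module

namespace RationalLocalSystem

variable {S : Type u} [TopologicalSpace S] (L : RationalLocalSystem.{u, v} S)

/-- Fibre at `s` of the complex vector bundle `E = 𝒱_ℂ ⊗ ℰ⁰_S`. -/
abbrev fiberC (s : S) : Type v := Cx (L.fiber s)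

/-- A (set-theoretic) section of the complex vector bundle. -/
abbrev Sec : Type max u v := ∀ s, L.fiberC s

/-- The complexified flat trivialization. -/
def chartC (s₀ s : S) : L.fiberC s →ₗ[ℂ] (Fin (L.rank s₀) → ℂ) :=
  (TensorProduct.piScalarRight ℚ ℂ ℂ (Fin (L.rank s₀))).toLinearMap ∘ₗ
    (L.chart s₀ s).baseChange ℂ

theorem bijective_chartC {s₀ s : S} (hs : s ∈ L.dom s₀) :
    Function.Bijective (L.chartC s₀ s) := by
  have h : (L.chartC s₀ s : L.fiberC s → _) =
      ((LinearEquiv.ofBijective _ (L.bijective_chart s₀ s hs)).baseChange ℚ ℂ _ _).trans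
        (TensorProduct.piScalarRight ℚ ℂ ℂ (Fin (L.rank s₀))) := by
    rfl
  rw [h]
  exact LinearEquiv.bijective _

/-- The complexified flat trivialization around `s`, at `s` itself. -/
def chartEquiv (s : S) : L.fiberC s ≃ₗ[ℂ] (Fin (L.rank s) → ℂ) :=
  LinearEquiv.ofBijective (L.chartC s s) (L.bijective_chartC (L.mem_dom s))

variable (E : Type w) [NormedAddCommGroup E] [NormedSpace ℂ E] [ChartedSpace E S]

/-- The section `σ` is smooth (`C^∞` over `ℝ`) at the points of the open set `N`. -/
def IsSmoothOn (σ : L.Sec) (N : Set S) : Prop :=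
  ∀ s ∈ N, ContMDiffAt 𝓘(ℝ, E) 𝓘(ℝ, Fin (L.rank s) → ℂ) ∞ (fun s' => L.chartC s s' (σ s')) s

variable {E}

/-- The Gauss–Manin connection: `∇_ξ σ` at `s` is the derivative of `σ` along the real tangent
vector `ξ ∈ T_s S = E`, taken in a flat trivialization. -/
def nabla (σ : L.Sec) (s : S) (ξ : E) : L.fiberC s :=
  (L.chartEquiv s).symm
    ((mfderiv 𝓘(ℝ, E) 𝓘(ℝ, Fin (L.rank s) → ℂ) (fun s' => L.chartC s s' (σ s')) s :
      E →L[ℝ] (Fin (L.rank s) → ℂ)) ξ)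

/-- The `(1,0)`-part of `∇`: covariant derivative along `ξ^{1,0} = (ξ - i Jξ)/2`. -/
def nabla10 (σ : L.Sec) (s : S) (ξ : E) : L.fiberC s :=
  (1 / 2 : ℂ) • (L.nabla σ s ξ - Complex.I • L.nabla σ s (Complex.I • ξ))

/-- The `(0,1)`-part of `∇`: covariant derivative along `ξ^{0,1} = (ξ + i Jξ)/2`. -/
def nabla01 (σ : L.Sec) (s : S) (ξ : E) : L.fiberC s :=
  (1 / 2 : ℂ) • (L.nabla σ s ξ + Complex.I • L.nabla σ s (Complex.I • ξ))

variable (E)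

/-- Holomorphic sections over the open set `N`, for the complex structure `∇^{0,1}`: smooth
sections killed by `∇^{0,1}`. -/
def IsHolomorphicOn (σ : L.Sec) (N : Set S) : Prop :=
  L.IsSmoothOn E σ N ∧ ∀ s ∈ N, ∀ ξ : E, L.nabla01 σ s ξ = 0

/-- The family of subspaces `U` is a `C^∞` subbundle: it has local smooth frames. -/
def IsSmoothSubbundle (U : ∀ s, Submodule ℂ (L.fiberC s)) : Prop :=
  ∀ s₀ : S, ∃ N : Set S, IsOpen N ∧ s₀ ∈ N ∧ ∃ (m : ℕ) (e : Fin m → L.Sec),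
    (∀ j, L.IsSmoothOn E (e j) N) ∧
    ∀ s ∈ N, LinearIndependent ℂ (fun j => e j s) ∧
      Submodule.span ℂ (Set.range fun j => e j s) = U s

/-- The family of subspaces `U` is a holomorphic subbundle for the complex structure `∇^{0,1}`:
it has local holomorphic frames. -/
def IsHolomorphicSubbundle (U : ∀ s, Submodule ℂ (L.fiberC s)) : Prop :=
  ∀ s₀ : S, ∃ N : Set S, IsOpen N ∧ s₀ ∈ N ∧ ∃ (m : ℕ) (e : Fin m → L.Sec),
    (∀ j, L.IsHolomorphicOn E (e j) N) ∧
    ∀ s ∈ N, LinearIndependent ℂ (fun j => e j s) ∧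
      Submodule.span ℂ (Set.range fun j => e j s) = U s

end RationalLocalSystem

/-- A variation of graded-polarized mixed Hodge structure over the complex manifold `S` modelled
on `E`. Holomorphy and horizontality of the filtrations induced on the `Gr^W_k` follow from
the conditions below and are therefore not listed separately. -/
structure VGPMHS (E : Type w) [NormedAddCommGroup E] [NormedSpace ℂ E]
    (S : Type u) [TopologicalSpace S] [ChartedSpace E S] extends
    RationalLocalSystem.{u, v} S where
  /-- The weight filtration. -/
  W : ∀ s, ℤ → Submodule ℚ (fiber s)
  /-- The Hodge filtration. -/
  F : ∀ s, ℤ → Submodule ℂ (Cx (fiber s))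
  /-- The graded polarizations. -/
  Q : ∀ s k, LinearMap.BilinForm ℚ (Gr (W s) k)
  /-- Each `W_k` is a local subsystem. -/
  flat_W : ∀ k s₀, ∀ s ∈ dom s₀, ∀ᶠ s' in 𝓝 s,
    (W s' k).map (chart s₀ s') = (W s k).map (chart s₀ s)
  /-- Each form `Q_k` takes locally constant values on flat local sections. -/
  flat_Q : ∀ k s₀, ∀ s ∈ dom s₀, ∀ᶠ s' in 𝓝 s, ∀ (x y : W s k) (x' y' : W s' k),
    chart s₀ s' x' = chart s₀ s x → chart s₀ s' y' = chart s₀ s y →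
      Q s' k (Submodule.Quotient.mk x') (Submodule.Quotient.mk y') =
        Q s k (Submodule.Quotient.mk x) (Submodule.Quotient.mk y)
  holomorphic_F : ∀ p, toRationalLocalSystem.IsHolomorphicSubbundle E (fun s => F s p)
  /-- Griffiths horizontality `∇ F^p ⊆ Ω¹ ⊗ F^{p-1}`. -/
  horizontal : ∀ (p : ℤ) (N : Set S), IsOpen N → ∀ σ : toRationalLocalSystem.Sec,
    toRationalLocalSystem.IsHolomorphicOn E σ N → (∀ s ∈ N, σ s ∈ F s p) →
      ∀ s ∈ N, ∀ ξ : E, toRationalLocalSystem.nabla σ s ξ ∈ F s (p - 1)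
  isMHS : ∀ s, IsMHS (W s) (F s)
  polarized : ∀ s k, IsPolarization k (grF (W s) (F s) k) (Q s k)

namespace VGPMHS

variable {E : Type w} [NormedAddCommGroup E] [NormedSpace ℂ E]
  {S : Type u} [TopologicalSpace S] [ChartedSpace E S] (𝒱 : VGPMHS.{u, v, w} E S)

/-- `𝓘^{p,q}_s = I^{p,q}_{(F_s, W_s)}`. -/
def I (s : S) (p q : ℤ) : Submodule ℂ (𝒱.fiberC s) :=
  deligneI (𝒱.W s) (𝒱.F s) p q

/-- `𝒰^p_s = ⨁_q I^{p,q}_{(F_s, W_s)}`. -/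
def U (p : ℤ) (s : S) : Submodule ℂ (𝒱.fiberC s) :=
  ⨆ q : ℤ, 𝒱.I s p q

/-- The Deligne grading. -/
def Y (s : S) : Module.End ℂ (𝒱.fiberC s) :=
  gradingOf (𝒱.I s)

/-- A decomposition `∇ = τ + ∂̄ + ∂ + θ` of the Gauss–Manin connection relative to `⨁ 𝒰^p`:
tensor fields `τ ∈ Hom(𝒰^p, 𝒰^{p+1}) ⊗ ℰ^{0,1}` and `θ ∈ Hom(𝒰^p, 𝒰^{p-1}) ⊗ ℰ^{1,0}` such that
the operators `∂̄ = ∇^{0,1} - τ` and `∂ = ∇^{1,0} - θ` map smooth local sections of `𝒰^p` to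
`𝒰^p`-valued forms. Forms of type `(1,0)` and `(0,1)` at `s` are `ℂ`-linear and conjugate-linear
functions on `T_s S = E`, evaluated on `ξ^{1,0}` and `ξ^{0,1}` respectively. -/
@[ext]
structure Decomposition where
  τ : ∀ s, E →ₛₗ[starRingEnd ℂ] Module.End ℂ (𝒱.fiberC s)
  θ : ∀ s, E →ₗ[ℂ] Module.End ℂ (𝒱.fiberC s)
  τ_mem : ∀ s ξ p, ∀ x ∈ 𝒱.U p s, τ s ξ x ∈ 𝒱.U (p + 1) s
  θ_mem : ∀ s ξ p, ∀ x ∈ 𝒱.U p s, θ s ξ x ∈ 𝒱.U (p - 1) s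
  dbar_mem : ∀ (p : ℤ) (N : Set S), IsOpen N → ∀ σ : 𝒱.Sec, 𝒱.IsSmoothOn E σ N →
    (∀ s ∈ N, σ s ∈ 𝒱.U p s) → ∀ s ∈ N, ∀ ξ : E, 𝒱.nabla01 σ s ξ - τ s ξ (σ s) ∈ 𝒱.U p s
  d_mem : ∀ (p : ℤ) (N : Set S), IsOpen N → ∀ σ : 𝒱.Sec, 𝒱.IsSmoothOn E σ N →
    (∀ s ∈ N, σ s ∈ 𝒱.U p s) → ∀ s ∈ N, ∀ ξ : E, 𝒱.nabla10 σ s ξ - θ s ξ (σ s) ∈ 𝒱.U p s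

end VGPMHS

end MixedHodge

end

/-! Everything rests on the formula `I^{p,q} = F^p ∩ W_{p+q} ∩ (conj F^q + ⨁_{r<p, s<q} I^{r,s})`
(`IsBigrading.eq_inf`), whose right side involves only pieces of smaller weight. Induction on the
weight then serves twice. It constructs the bigrading of a mixed Hodge structure
(`IsOpposed.exists_isBigrading`), and it shows that the bigrading of a variation moves smoothly
(`exists_movingFrame`): near a point the dimension of each piece can only drop, while the total in
each `W_k` is constant.

Let `h(s)` be a smooth frame that carries the bigrading at `s₀` to the one at `s`, and let `A` be
its derivative at `s₀`. Then `∇σ ≡ Aσ` modulo any sum of pieces in which `σ` takes its values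
(`LocalFrame.nabla_sub_mem`), so the question becomes linear algebra of the `(0,1)`-part `a` and the
`(1,0)`-part `b` of `A` (`IsConnectionPair`). Holomorphy of `F` makes `a` preserve `F`,
horizontality makes `b` lower it by at most one, flatness of `W` makes both preserve `W`. Flatness
of conjugation makes `a - conj b` and `b - conj a` preserve each `I^{p,q} + ⨁_{r<p, s<q} I^{r,s}`.

The increasing filtration `⨁_{r ≤ p} I^{r,s}` equals `∑_k conj F^{k-p} ∩ W_k`, so `conj a` preserves
it and `conj b` raises it by at most one. Intersecting with the bounds from `F` and `W` shows that
`a` maps `I^{p,q}` into `I^{p+1,q-1}` plus pieces with `r = p`, and that `b` maps it into pieces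
with `r = p` or `r = p - 1` (`a_mem`, `b_mem`). Hence `τ` is the part of `a` that raises `p`, `θ`
the part of `b` that lowers `p`, and the remainders preserve `𝒰^p`. Since `τ` has weight zero and
`conj θ - τ` strictly lowers the weight, `τ` is the weight-zero part of `conj θ`.

For a holomorphic section of `𝒰^p`, `τσ = -∂̄σ` lies in `𝒰^{p+1} ∩ 𝒰^p = 0`. Conversely, `𝒰^p` has a
frame that is constant modulo a fixed complement (`exists_frame`). The `∇^{0,1}`-derivative of such
a frame lies in that complement, and if `τ` vanishes it also lies in `𝒰^p`, so it is zero. The third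
claim follows because `τ` maps `𝒰^b` to `𝒰^{b+1} = 0`. -/

noncomputable section

namespace MixedHodge


/-! ### Bigradings as sums of pieces over index sets -/

section Bigrading

variable {X : Type*} [AddCommGroup X] [Module ℂ X]

/-- The sum of the `I^{r,s}` over the indices `(r,s) ∈ A`. -/
def sumOver (I : ℤ × ℤ → Submodule ℂ X) (A : Set (ℤ × ℤ)) : Submodule ℂ X := ⨆ i ∈ A, I i

variable {I : ℤ × ℤ → Submodule ℂ X} {A B : Set (ℤ × ℤ)}

theorem le_sumOver {i : ℤ × ℤ} (hi : i ∈ A) : I i ≤ sumOver I A :=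
  le_iSup₂_of_le i hi le_rfl

theorem sumOver_le {P : Submodule ℂ X} (h : ∀ i ∈ A, I i ≤ P) : sumOver I A ≤ P :=
  iSup₂_le h

theorem sumOver_mono (h : A ⊆ B) : sumOver I A ≤ sumOver I B :=
  sumOver_le fun _ hi => le_sumOver (h hi)

theorem sumOver_union : sumOver I (A ∪ B) = sumOver I A ⊔ sumOver I B := by
  refine le_antisymm (sumOver_le ?_)
    (sup_le (sumOver_mono Set.subset_union_left) (sumOver_mono Set.subset_union_right))
  rintro i (hi | hi)
  · exact le_sup_of_le_left (le_sumOver hi)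
  · exact le_sup_of_le_right (le_sumOver hi)

theorem sumOver_insert (i : ℤ × ℤ) : sumOver I (insert i A) = I i ⊔ sumOver I A := by
  rw [Set.insert_eq, sumOver_union]
  simp [sumOver]

theorem sumOver_singleton (i : ℤ × ℤ) : sumOver I {i} = I i := by
  simp [sumOver]

/-- Split `B` along `A`; independence removes `B \ A` and the modular law does the rest. From here
on, intersections of filtrations are intersections of index sets, decided by `omega`. -/
theorem sumOver_inter (h : iSupIndep I) (A B : Set (ℤ × ℤ)) :
    sumOver I A ⊓ sumOver I B = sumOver I (A ∩ B) := by
  refine le_antisymm ?_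
    (le_inf (sumOver_mono Set.inter_subset_left) (sumOver_mono Set.inter_subset_right))
  have hB : sumOver I B = sumOver I (A ∩ B) ⊔ sumOver I (B \ A) := by
    rw [← sumOver_union, Set.inter_comm, Set.inter_union_sdiff]
  have hd : Disjoint (sumOver I (B \ A)) (sumOver I A) :=
    h.disjoint_biSup_biSup Set.disjoint_sdiff_left
  rw [hB, inf_comm, sup_inf_assoc_of_le _ (sumOver_mono Set.inter_subset_left), hd.eq_bot,
    sup_bot_eq]

theorem sumOver_disjoint (h : iSupIndep I) (hAB : Disjoint A B) :
    Disjoint (sumOver I A) (sumOver I B) :=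
  h.disjoint_biSup_biSup hAB

theorem map_sumOver_le {c : X →ₛₗ[starRingEnd ℂ] X} {P : Submodule ℂ X}
    (h : ∀ i ∈ A, (I i).map c ≤ P) : (sumOver I A).map c ≤ P := by
  rw [sumOver, Submodule.map_iSup]
  refine iSup_le fun i => ?_
  rw [Submodule.map_iSup]
  exact iSup_le fun hi => h i hi

/-- The indices `(r,s)` with `r < p` and `s < q`. -/
def below (p q : ℤ) : Set (ℤ × ℤ) := {i | i.1 < p ∧ i.2 < q}

theorem mem_map_conj {c : X →ₛₗ[starRingEnd ℂ] X} (hc : ∀ x, c (c x) = x)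
    {P : Submodule ℂ X} {x : X} : x ∈ P.map c ↔ c x ∈ P := by
  constructor
  · rintro ⟨y, hy, rfl⟩
    rwa [hc]
  · exact fun h => ⟨c x, h, hc x⟩

/-- The conditions that define Deligne's bigrading `I` of `(F, W)`, relative to the conjugation
`c`, except that the sum of the `I^{p,q}` may be a proper subspace. -/
structure IsBigrading (c : X →ₛₗ[starRingEnd ℂ] X) (W F : ℤ → Submodule ℂ X)
    (I : ℤ × ℤ → Submodule ℂ X) : Prop where
  indep : iSupIndep I
  F_eq : ∀ p, F p = sumOver I {i | p ≤ i.1}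
  W_eq : ∀ k, W k = sumOver I {i | i.1 + i.2 ≤ k}
  conj_le : ∀ p q, (I (q, p)).map c ≤ sumOver I (insert (p, q) (below p q))

namespace IsBigrading

variable {c : X →ₛₗ[starRingEnd ℂ] X} {W F : ℤ → Submodule ℂ X}

theorem map_le (h : IsBigrading c W F I)
    (hAB : ∀ p q, (q, p) ∈ A → insert (p, q) (below p q) ⊆ B) :
    (sumOver I A).map c ≤ sumOver I B :=
  map_sumOver_le fun i hi => (h.conj_le i.2 i.1).trans (sumOver_mono (hAB i.2 i.1 hi))

theorem map_W_le (h : IsBigrading c W F I) (k : ℤ) : (W k).map c ≤ W k := by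
  rw [h.W_eq]
  refine h.map_le fun p q hpq => ?_
  rintro ⟨r, s⟩ hrs
  simp only [below, Set.mem_ofPred_eq, Set.mem_insert_iff, Prod.mk.injEq] at *
  omega

theorem map_insert_below_le (h : IsBigrading c W F I) (p q : ℤ) :
    (sumOver I (insert (q, p) (below q p))).map c ≤ sumOver I (insert (p, q) (below p q)) := by
  refine h.map_le fun p q hpq => ?_
  rintro ⟨r, s⟩ hrs
  simp only [below, Set.mem_ofPred_eq, Set.mem_insert_iff, Prod.mk.injEq] at *
  omega

theorem map_below_le (h : IsBigrading c W F I) (p q : ℤ) :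
    (sumOver I (below q p)).map c ≤ sumOver I (below p q) := by
  refine h.map_le fun p q hpq => ?_
  rintro ⟨r, s⟩ hrs
  simp only [below, Set.mem_ofPred_eq, Set.mem_insert_iff, Prod.mk.injEq] at *
  omega

/-- `conj_le` gives one inclusion; the other is `conj_le` for `(q, p)` carried back by the
involution `c`. -/
theorem conj_mod (h : IsBigrading c W F I) (hc : ∀ x, c (c x) = x) (p q : ℤ) :
    I (p, q) ⊔ sumOver I (below p q) = (I (q, p)).map c ⊔ sumOver I (below p q) := by
  refine le_antisymm (sup_le ?_ le_sup_right) (sup_le ?_ le_sup_right)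
  · intro x hx
    have hx' : c x ∈ sumOver I (insert (q, p) (below q p)) :=
      h.conj_le q p (Submodule.mem_map_of_mem hx)
    rw [sumOver_insert] at hx'
    obtain ⟨y, hy, z, hz, hyz⟩ := Submodule.mem_sup.1 hx'
    rw [← hc x, ← hyz, map_add]
    exact Submodule.add_mem_sup (Submodule.mem_map_of_mem hy)
      (h.map_below_le p q (Submodule.mem_map_of_mem hz))
  · rw [← sumOver_insert]
    exact h.conj_le p q

/-- `conj F^q ∩ W_k ⊆ I^{k-q,q} + ⨁_{r<k-q} I^{r,s}`. -/
theorem map_F_inf_W_le (h : IsBigrading c W F I) (hc : ∀ x, c (c x) = x) (p q : ℤ) :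
    (F q).map c ⊓ W (p + q) ≤ sumOver I (insert (p, q) {i | i.1 < p}) := by
  intro x hx
  have h1 : c x ∈ F q := (mem_map_conj hc).1 hx.1
  have h2 : c x ∈ W (p + q) := h.map_W_le _ (Submodule.mem_map_of_mem hx.2)
  have h3 : c x ∈ sumOver I ({i | q ≤ i.1} ∩ {i | i.1 + i.2 ≤ p + q}) := by
    rw [← sumOver_inter h.indep, ← h.F_eq, ← h.W_eq]
    exact ⟨h1, h2⟩
  have h4 : x ∈ (sumOver I ({i | q ≤ i.1} ∩ {i | i.1 + i.2 ≤ p + q})).map c :=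
    (mem_map_conj hc).2 h3
  -- `c x` has components with `r ≥ q` and `r + s ≤ p + q`, so `s ≤ p` with equality only at `(q,
  -- p)`. Conjugation swaps the indices up to strictly lower ones.
  refine h.map_le (fun a b hab => ?_) h4
  rintro ⟨r, s⟩ hrs
  simp only [below, Set.mem_ofPred_eq, Set.mem_insert_iff, Prod.mk.injEq, Set.mem_inter_iff] at *
  omega

theorem F_antitone (h : IsBigrading c W F I) : Antitone F := by
  intro p q hpq
  rw [h.F_eq, h.F_eq]
  refine sumOver_mono ?_
  rintro ⟨r, s⟩ hrs
  simp only [Set.mem_ofPred_eq] at *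
  omega

theorem le_map_F_sup (h : IsBigrading c W F I) (hc : ∀ x, c (c x) = x) (p q : ℤ) :
    I (p, q) ≤ (F q).map c ⊔ sumOver I (below p q) := by
  refine le_sup_left.trans ((h.conj_mod hc p q).le.trans (sup_le_sup_right ?_ _))
  refine Submodule.map_mono ?_
  rw [h.F_eq]
  exact le_sumOver (by simp)

/-- `⨁ I^{r,s} ⊆ F^p + conj F^q + ⨁_{r<p, s<q} I^{r,s}`. -/
theorem le_F_sup_map_F_sup (h : IsBigrading c W F I) (hc : ∀ x, c (c x) = x) (p q : ℤ) :
    sumOver I Set.univ ≤ F p ⊔ ((F q).map c ⊔ sumOver I (below p q)) := by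
  -- A piece with `s ≥ q` lies in `conj F^s ⊆ conj F^q` up to pieces with smaller second index, so
  -- the height `q + n` can be lowered step by step.
  have key : ∀ n : ℕ, sumOver I (below p (q + n)) ≤ (F q).map c ⊔ sumOver I (below p q) := by
    intro n
    induction n with
    | zero => simp
    | succ n ih =>
      refine sumOver_le ?_
      rintro ⟨r, s⟩ ⟨hr, hs⟩
      by_cases hsn : s < q + n
      · exact (le_sumOver (A := below p (q + n)) ⟨hr, hsn⟩).trans ih
      · refine (h.le_map_F_sup hc r s).trans (sup_le ?_ (le_trans (sumOver_mono ?_) ih))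
        · refine le_sup_of_le_left (Submodule.map_mono (h.F_antitone ?_))
          omega
        · rintro ⟨r', s'⟩ ⟨hr', hs'⟩
          simp only [below, Set.mem_ofPred_eq] at *
          push_cast at hs
          omega
  refine sumOver_le ?_
  rintro ⟨r, s⟩ -
  by_cases hr : p ≤ r
  · refine le_sup_of_le_left ?_
    rw [h.F_eq]
    exact le_sumOver (show p ≤ r from hr)
  · refine le_sup_of_le_right (le_trans (le_sumOver ?_) (key (s - q + 1).toNat))
    simp only [below, Set.mem_ofPred_eq]
    omega

theorem sumOver_below_le_W (h : IsBigrading c W F I) {p q k : ℤ} (hk : p + q ≤ k + 2) :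
    sumOver I (below p q) ≤ W k := by
  rw [h.W_eq]
  refine sumOver_mono ?_
  rintro ⟨r, s⟩ hrs
  simp only [below, Set.mem_ofPred_eq] at *
  omega

/-- `F^p ∩ W_k ∩ (conj F^q + ⨁_{r<p, s<q} I^{r,s}) = 0` for `k < p + q`. -/
theorem inf_eq_bot (h : IsBigrading c W F I) (hc : ∀ x, c (c x) = x) {p q k : ℤ}
    (hk : k + 1 = p + q) :
    F p ⊓ (W k ⊓ ((F q).map c ⊔ sumOver I (below p q))) = ⊥ := by
  have h1 : W k ⊓ ((F q).map c ⊔ sumOver I (below p q)) ≤ sumOver I {i | i.1 < p} := by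
    have hΛ : sumOver I (below p q) ≤ W k := h.sumOver_below_le_W (by omega)
    rw [inf_comm, sup_comm, sup_inf_assoc_of_le _ hΛ]
    refine sup_le (sumOver_mono fun i hi => hi.1) ?_
    -- The weight is `k = (p - 1) + q`, so the exceptional index `(p - 1, q)` also has first entry
    -- below `p`.
    have := h.map_F_inf_W_le hc (p - 1) q
    rw [show p - 1 + q = k by omega] at this
    refine this.trans (sumOver_mono ?_)
    rintro ⟨r, s⟩ hrs
    simp only [Set.mem_ofPred_eq, Set.mem_insert_iff, Prod.mk.injEq] at *
    omega
  rw [eq_bot_iff, h.F_eq]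
  refine (inf_le_inf_left _ h1).trans ?_
  rw [sumOver_inter h.indep]
  refine sumOver_le ?_
  rintro ⟨r, s⟩ ⟨h1, h2⟩
  simp only [Set.mem_ofPred_eq] at *
  omega

/-- `I^{p,q} = F^p ∩ W_{p+q} ∩ (conj F^q + ⨁_{r<p, s<q} I^{r,s})`. -/
theorem eq_inf (h : IsBigrading c W F I) (hc : ∀ x, c (c x) = x) (p q : ℤ) :
    I (p, q) = F p ⊓ (W (p + q) ⊓ ((F q).map c ⊔ sumOver I (below p q))) := by
  apply le_antisymm
  · refine le_inf ?_ (le_inf ?_ (h.le_map_F_sup hc p q))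
    · rw [h.F_eq]
      exact le_sumOver (by simp)
    · rw [h.W_eq]
      exact le_sumOver (by simp)
  -- Within `W_{p+q}`, the second factor has only components with `r < p`, apart from `(p, q)`;
  -- intersecting with `F^p` leaves `(p, q)` alone.
  · have h1 : W (p + q) ⊓ ((F q).map c ⊔ sumOver I (below p q)) ≤
        sumOver I (insert (p, q) {i | i.1 < p}) := by
      have hΛ : sumOver I (below p q) ≤ W (p + q) := h.sumOver_below_le_W (by omega)
      rw [inf_comm, sup_comm, sup_inf_assoc_of_le _ hΛ]
      exact sup_le (sumOver_mono fun i hi => Set.mem_insert_of_mem _ hi.1)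
        (h.map_F_inf_W_le hc p q)
    rw [h.F_eq]
    refine (inf_le_inf_left _ h1).trans ?_
    rw [sumOver_inter h.indep]
    refine sumOver_le ?_
    rintro ⟨r, s⟩ ⟨h1, h2⟩
    have : (r, s) = (p, q) := by
      simp only [Set.mem_ofPred_eq, Set.mem_insert_iff, Prod.mk.injEq] at *
      omega
    rw [this]

/-- After conjugation one side has `r ≥ q` and the other `r < q`. The disjointness is what lets the
sum in `eq_inf` vary smoothly. -/
theorem map_F_disjoint_below (h : IsBigrading c W F I) (hc : ∀ x, c (c x) = x) (p q : ℤ) :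
    Disjoint ((F q).map c) (sumOver I (below p q)) := by
  rw [Submodule.disjoint_def]
  intro x hx hx'
  have h1 : c x ∈ sumOver I (below q p) := h.map_below_le q p (Submodule.mem_map_of_mem hx')
  have h2 : c x ∈ sumOver I {i | q ≤ i.1} := by
    rw [← h.F_eq]
    exact (mem_map_conj hc).1 hx
  have h3 : c x = 0 := by
    refine Submodule.disjoint_def.1 (sumOver_disjoint h.indep ?_) _ h1 h2
    rw [Set.disjoint_left]
    rintro ⟨r, s⟩ h1 h2
    simp only [below, Set.mem_ofPred_eq] at *
    omega
  rw [← hc x, h3, map_zero]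

end IsBigrading

end Bigrading

/-! ### Existence of Deligne's bigrading, by induction on the weight -/

section Existence

/-- In a nontrivial relation, the term of largest index would lie in the sum of the earlier pieces.
-/
theorem iSupIndep_of_disjoint_lt {X ι κ : Type*} [AddCommGroup X] [Module ℂ X] [LinearOrder κ]
    (f : ι → κ) (hf : Function.Injective f) (I : ι → Submodule ℂ X)
    (h : ∀ i, Disjoint (I i) (⨆ (j) (_ : f j < f i), I j)) : iSupIndep I := by
  classical
  refine iSupIndep_of_dfinsupp_lsum_injective I ?_
  rw [← AddMonoidHom.coe_coe, injective_iff_map_eq_zero]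
  intro v hv
  by_contra hne
  have hs : v.support.Nonempty := by
    rw [Finset.nonempty_iff_ne_empty]
    exact fun h0 => hne (DFinsupp.support_eq_empty.1 h0)
  obtain ⟨i, hi, hmax⟩ := v.support.exists_max_image f hs
  have hsum : (v i : X) + ∑ j ∈ v.support.erase i, (v j : X) = 0 := by
    rw [Finset.add_sum_erase _ (fun j => (v j : X)) hi]
    have := hv
    simpa [DFinsupp.lsum_apply_apply, DFinsupp.sumAddHom_apply, DFinsupp.sum] using this
  have hmem : (v i : X) ∈ ⨆ (j) (_ : f j < f i), I j := by
    rw [eq_neg_of_add_eq_zero_left hsum]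
    refine Submodule.neg_mem _ (Submodule.sum_mem _ fun j hj => ?_)
    have hj' := Finset.mem_erase.1 hj
    have hlt : f j < f i := lt_of_le_of_ne (hmax j hj'.2) fun he => hj'.1 (hf he)
    exact le_iSup₂_of_le (f := fun j (_ : f j < f i) => I j) j hlt le_rfl (v j).2
  have h0 := Submodule.disjoint_def.1 (h i) _ (v i).2 hmem
  exact (DFinsupp.mem_support_iff.1 hi) (Subtype.ext h0)

variable {X : Type*} [AddCommGroup X] [Module ℂ X]

/-- The filtrations induced on `Gr^W_k` by `F` and its conjugate are `k`-opposed. -/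
structure IsOpposed (c : X →ₛₗ[starRingEnd ℂ] X) (W F : ℤ → Submodule ℂ X) : Prop where
  monotone_W : Monotone W
  antitone_F : Antitone F
  map_W_le : ∀ k, (W k).map c ≤ W k
  W_le : ∀ k p q, p + q = k + 1 →
    W k ≤ (F p ⊓ W k ⊔ W (k - 1)) ⊔ ((F q).map c ⊓ W k ⊔ W (k - 1))
  inf_le : ∀ k p q, p + q = k + 1 →
    (F p ⊓ W k ⊔ W (k - 1)) ⊓ ((F q).map c ⊓ W k ⊔ W (k - 1)) ≤ W (k - 1)

/-- The part of weight `p + q` of the bigrading of `W_{p+q}`, where `J` is the bigrading of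
`W_{p+q-1}`. -/
def bigradingStep (c : X →ₛₗ[starRingEnd ℂ] X) (W F : ℤ → Submodule ℂ X)
    (J : ℤ × ℤ → Submodule ℂ X) (i : ℤ × ℤ) : Submodule ℂ X :=
  F i.1 ⊓ (W (i.1 + i.2) ⊓ ((F i.2).map c ⊔ sumOver J (below i.1 i.2)))

/-- The bigrading of `W_k` made from the bigrading `J` of `W_{k-1}`. -/
def bigradingExtend (c : X →ₛₗ[starRingEnd ℂ] X) (W F : ℤ → Submodule ℂ X)
    (J : ℤ × ℤ → Submodule ℂ X) (k : ℤ) (i : ℤ × ℤ) : Submodule ℂ X :=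
  if i.1 + i.2 = k then bigradingStep c W F J i else J i

variable {c : X →ₛₗ[starRingEnd ℂ] X} {W F : ℤ → Submodule ℂ X} {J : ℤ × ℤ → Submodule ℂ X}

theorem bigradingExtend_of_eq {k : ℤ} {i : ℤ × ℤ} (hi : i.1 + i.2 = k) :
    bigradingExtend c W F J k i = bigradingStep c W F J i := if_pos hi

theorem bigradingExtend_of_ne {k : ℤ} {i : ℤ × ℤ} (hi : i.1 + i.2 ≠ k) :
    bigradingExtend c W F J k i = J i := if_neg hi

theorem sumOver_bigradingExtend {k : ℤ} {A : Set (ℤ × ℤ)} (hA : ∀ i ∈ A, i.1 + i.2 < k) :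
    sumOver (bigradingExtend c W F J k) A = sumOver J A := by
  refine le_antisymm (sumOver_le fun i hi => ?_) (sumOver_le fun i hi => ?_)
  · rw [bigradingExtend_of_ne (hA i hi).ne]
    exact le_sumOver hi
  · rw [← bigradingExtend_of_ne (c := c) (W := W) (F := F) (J := J) (hA i hi).ne]
    exact le_sumOver hi

namespace IsOpposed

/-- The truncated bigrading condition for `W_k`. -/
abbrev Truncated (c : X →ₛₗ[starRingEnd ℂ] X) (W F : ℤ → Submodule ℂ X) (k : ℤ)
    (J : ℤ × ℤ → Submodule ℂ X) : Prop :=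
  IsBigrading c (fun j => W (min j k)) (fun p => F p ⊓ W k) J

/-- The truncated weight filtration is constant from `k` on, so a piece of higher weight lies in the
sum of the pieces of weight at most `k`, from which it is independent. -/
theorem truncated_bot (hJ : Truncated c W F (k := k) J) {i : ℤ × ℤ} (hi : k < i.1 + i.2) :
    J i = ⊥ := by
  have h1 : J i ≤ sumOver J {j | j.1 + j.2 ≤ i.1 + i.2} := le_sumOver (by simp)
  have h2 : sumOver J {j | j.1 + j.2 ≤ i.1 + i.2} = sumOver J {j | j.1 + j.2 ≤ k} := by
    rw [← hJ.W_eq, ← hJ.W_eq, min_eq_right hi.le, min_self]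
  rw [h2] at h1
  have hd : Disjoint (sumOver J {i}) (sumOver J {j | j.1 + j.2 ≤ k}) := by
    refine sumOver_disjoint hJ.indep ?_
    rw [Set.disjoint_singleton_left]
    simpa using hi
  rw [sumOver_singleton] at hd
  exact hd.eq_bot_of_le h1

theorem truncated_le (hJ : Truncated c W F (k := k) J) (A : Set (ℤ × ℤ)) :
    sumOver J A ≤ W k := by
  have h := hJ.W_eq k
  rw [min_self] at h
  rw [h]
  refine sumOver_le fun i _ => ?_
  by_cases hi : i.1 + i.2 ≤ k
  · exact le_sumOver hi
  · rw [truncated_bot hJ (not_le.1 hi)]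
    exact bot_le

/-- If a vector of the new piece lies in `W_k`, so does its `conj F^q` summand, because the other
summand always does. Then `inf_eq_bot` for the old bigrading forces it to vanish. -/
theorem step_inf_W (hO : IsOpposed c W F) (hc : ∀ x, c (c x) = x)
    (hJ : Truncated c W F (k := k) J) {i : ℤ × ℤ} (hi : i.1 + i.2 = k + 1) :
    bigradingStep c W F J i ⊓ W k = ⊥ := by
  rw [← hJ.inf_eq_bot hc hi.symm]
  refine le_antisymm ?_ ?_
  · rintro v ⟨⟨hF, -, hv⟩, hW⟩
    refine ⟨⟨hF, hW⟩, by simpa using hW, ?_⟩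
    obtain ⟨z, hz, l, hl, rfl⟩ := Submodule.mem_sup.1 hv
    have hlW := truncated_le hJ _ hl
    have hzW : z ∈ W k := by simpa using Submodule.sub_mem _ hW hlW
    refine Submodule.add_mem_sup ((mem_map_conj hc).2 ⟨(mem_map_conj hc).1 hz, ?_⟩) hl
    exact hO.map_W_le _ (Submodule.mem_map_of_mem hzW)
  · rw [hJ.inf_eq_bot hc hi.symm]
    exact bot_le

/-- A class of type `(p, q)` in `Gr^W_{k+1}` has lifts `x ∈ F^p` and `z ∈ conj F^q` that differ by
an element of `W_k`. By `le_F_sup_map_F_sup` this difference is a sum of an element of `F^p`, one of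
`conj F^q` and lower pieces; subtracting the first from `x` yields a lift in the new piece. -/
theorem inf_le_step (hO : IsOpposed c W F) (hc : ∀ x, c (c x) = x)
    (hJ : Truncated c W F (k := k) J) {i : ℤ × ℤ} (hi : i.1 + i.2 = k + 1) :
    (F i.1 ⊓ W (k + 1) ⊔ W k) ⊓ ((F i.2).map c ⊓ W (k + 1) ⊔ W k) ≤
      bigradingStep c W F J i ⊔ W k := by
  rintro v ⟨h1, h2⟩
  obtain ⟨x, ⟨hxF, hxW⟩, w, hw, rfl⟩ := Submodule.mem_sup.1 h1
  obtain ⟨z, ⟨hzF, hzW⟩, w', hw', hz⟩ := Submodule.mem_sup.1 h2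
  have hd : x - z ∈ W k := by
    have : x - z = w' - w := by rw [sub_eq_sub_iff_add_eq_add, ← hz, add_comm]
    rw [this]
    exact Submodule.sub_mem _ hw' hw
  have hd' : x - z ∈ sumOver J Set.univ := by
    have h := hJ.W_eq k
    rw [min_self] at h
    rw [h] at hd
    exact sumOver_mono (Set.subset_univ _) hd
  obtain ⟨x', hx', y, hy, hxy⟩ := Submodule.mem_sup.1 (hJ.le_F_sup_map_F_sup hc i.1 i.2 hd')
  obtain ⟨z', hz', l, hl, rfl⟩ := Submodule.mem_sup.1 hy
  have hk : W k ≤ W (k + 1) := hO.monotone_W (by omega)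
  rw [show x + w = (x - x') + (x' + w) by abel]
  refine Submodule.add_mem_sup ⟨Submodule.sub_mem _ hxF hx'.1, ?_, ?_⟩
    (Submodule.add_mem _ hx'.2 hw)
  · rw [hi]
    exact Submodule.sub_mem _ hxW (hk hx'.2)
  · have : x - x' = (z + z') + l := by
      rw [sub_eq_iff_eq_add, sub_eq_iff_eq_add'.1 hxy.symm]
      abel
    rw [this]
    exact Submodule.add_mem_sup
      (Submodule.add_mem _ hzF (Submodule.map_mono inf_le_left hz')) hl

theorem step_le_conj (hJ : Truncated c W F (k := k) J) {i : ℤ × ℤ} (hi : i.1 + i.2 = k + 1)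
    (hk : W k ≤ W (k + 1)) :
    bigradingStep c W F J i ≤ (F i.2).map c ⊓ W (k + 1) ⊔ W k := by
  rintro v ⟨-, hW, hv⟩
  rw [hi] at hW
  obtain ⟨z, hz, l, hl, rfl⟩ := Submodule.mem_sup.1 hv
  have hlW := truncated_le hJ _ hl
  exact Submodule.add_mem_sup ⟨hz, by simpa using Submodule.sub_mem _ hW (hk hlW)⟩ hlW

/-- Descending induction from `F^b = 0`: in weight `k + 1`, `F^p` is `F^{p+1}` plus `F^p ∩ conj
F^{k+1-p}`, by opposedness and the modular law, and the second part is supplied by `inf_le_step`. -/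
theorem F_le_step (hO : IsOpposed c W F) (hc : ∀ x, c (c x) = x)
    (hJ : Truncated c W F (k := k) J) {b : ℤ} (hb : F b = ⊥) (p : ℤ) :
    F p ⊓ W (k + 1) ⊔ W k ≤
      sumOver (bigradingStep c W F J) {i | p ≤ i.1 ∧ i.1 + i.2 = k + 1} ⊔ W k := by
  have key : ∀ n : ℕ, ∀ p, b ≤ p + n → F p ⊓ W (k + 1) ⊔ W k ≤
      sumOver (bigradingStep c W F J) {i | p ≤ i.1 ∧ i.1 + i.2 = k + 1} ⊔ W k := by
    intro n
    induction n with
    | zero =>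
      intro p hp
      have : F p = ⊥ := by
        rw [eq_bot_iff, ← hb]
        exact hO.antitone_F (by simpa using hp)
      rw [this, bot_inf_eq, bot_sup_eq]
      exact le_sup_right
    | succ n ih =>
      intro p hp
      have hk : W k ≤ W (k + 1) := hO.monotone_W (by omega)
      have h1 := hO.W_le (k + 1) (p + 1) (k + 1 - p) (by omega)
      rw [add_sub_cancel_right] at h1
      have h2 : F (p + 1) ⊓ W (k + 1) ⊔ W k ≤ F p ⊓ W (k + 1) ⊔ W k :=
        sup_le_sup_right (inf_le_inf_right _ (hO.antitone_F (by omega))) _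
      have h3 : F p ⊓ W (k + 1) ⊔ W k ≤ (F (p + 1) ⊓ W (k + 1) ⊔ W k) ⊔
          ((F (k + 1 - p)).map c ⊓ W (k + 1) ⊔ W k) ⊓ (F p ⊓ W (k + 1) ⊔ W k) := by
        rw [← sup_inf_assoc_of_le _ h2]
        exact le_inf ((sup_le inf_le_right hk).trans h1) le_rfl
      refine h3.trans (sup_le ?_ ?_)
      · refine (ih (p + 1) (by push_cast at hp; omega)).trans (sup_le_sup_right (sumOver_mono ?_) _)
        rintro i ⟨h1, h2⟩
        exact ⟨by omega, h2⟩
      · rw [inf_comm]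
        have hp' : ((p, k + 1 - p) : ℤ × ℤ).1 + ((p, k + 1 - p) : ℤ × ℤ).2 = k + 1 := by simp
        refine (hO.inf_le_step hc hJ hp').trans (sup_le_sup_right (le_sumOver ?_) _)
        exact ⟨le_rfl, hp'⟩
  exact key (b - p).toNat p (by omega)

theorem truncated_extend (hO : IsOpposed c W F) (hc : ∀ x, c (c x) = x)
    (hJ : Truncated c W F (k := k) J) {a b : ℤ} (ha : F a = ⊤) (hb : F b = ⊥) :
    Truncated c W F (k + 1) (bigradingExtend c W F J (k + 1)) := by
  have hk : W k ≤ W (k + 1) := hO.monotone_W (by omega)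
  have hbot : ∀ i : ℤ × ℤ, k + 1 < i.1 + i.2 → bigradingExtend c W F J (k + 1) i = ⊥ :=
    fun i hi => by
      rw [bigradingExtend_of_ne hi.ne', truncated_bot hJ (by omega)]
  have hle : ∀ i : ℤ × ℤ, bigradingExtend c W F J (k + 1) i ≤ W (k + 1) := fun i => by
    by_cases hi : i.1 + i.2 = k + 1
    · rw [bigradingExtend_of_eq hi, ← hi]
      exact inf_le_right.trans inf_le_left
    · rw [bigradingExtend_of_ne hi]
      refine le_trans ?_ ((truncated_le hJ {i}).trans hk)
      rw [sumOver_singleton]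
  have hJle : ∀ A, sumOver J A ≤ sumOver (bigradingExtend c W F J (k + 1)) A := fun A =>
    sumOver_le fun i hi => by
      by_cases h : i.1 + i.2 = k + 1
      · rw [truncated_bot hJ (by omega)]
        exact bot_le
      · rw [← bigradingExtend_of_ne (c := c) (W := W) (F := F) (J := J) h]
        exact le_sumOver hi
  have hstep : ∀ p, sumOver (bigradingStep c W F J) {i | p ≤ i.1 ∧ i.1 + i.2 = k + 1} ≤
      sumOver (bigradingExtend c W F J (k + 1)) {i | p ≤ i.1} := fun p =>
    sumOver_le fun i hi => by
      rw [← bigradingExtend_of_eq hi.2]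
      exact le_sumOver hi.1
  have hWk : W k = sumOver J {i | i.1 + i.2 ≤ k} := by
    have h := hJ.W_eq k
    rwa [min_self] at h
  refine ⟨?_, ?_, ?_, ?_⟩
  -- Pieces are ordered by weight, then by `p`.
  · refine iSupIndep_of_disjoint_lt (fun i : ℤ × ℤ => toLex (i.1 + i.2, i.1)) ?_ _ ?_
    · rintro ⟨r, s⟩ ⟨r', s'⟩ h
      have := Prod.mk.inj (toLex.injective h)
      simp only [Prod.mk.injEq]
      simp only at this
      omega
    · rintro ⟨p, q⟩
      simp only [Prod.Lex.toLex_lt_toLex]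
      rcases lt_trichotomy (p + q) (k + 1) with h | h | h
      · rw [bigradingExtend_of_ne (by exact h.ne)]
        refine (hJ.indep (p, q)).mono_right (iSup₂_le fun j hj => ?_)
        rw [bigradingExtend_of_ne (by omega)]
        refine le_iSup₂_of_le j ?_ le_rfl
        rintro rfl
        simp at hj
      · rw [disjoint_iff_inf_le]
        -- An earlier piece of the same weight has second index at least `q + 1`, so it lies in
        -- `conj F^{q+1}` modulo `W_k`. Since `p + (q + 1) = (k + 1) + 1`, this is opposed to `F^p`
        -- on `Gr^W_{k+1}`.
        have h1 : (⨆ (j : ℤ × ℤ) (_ : j.1 + j.2 < p + q ∨ j.1 + j.2 = p + q ∧ j.1 < p),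
            bigradingExtend c W F J (k + 1) j) ≤ (F (q + 1)).map c ⊓ W (k + 1) ⊔ W k := by
          refine iSup₂_le fun j hj => ?_
          by_cases hjk : j.1 + j.2 = k + 1
          · rw [bigradingExtend_of_eq hjk]
            refine (step_le_conj hJ hjk hk).trans
              (sup_le_sup_right (inf_le_inf_right _ (Submodule.map_mono ?_)) _)
            exact hO.antitone_F (by omega)
          · rw [bigradingExtend_of_ne hjk]
            refine le_sup_of_le_right (le_trans ?_ (truncated_le hJ {j}))
            rw [sumOver_singleton]
        rw [bigradingExtend_of_eq (by exact h), ← hO.step_inf_W hc hJ (i := (p, q)) h]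
        refine le_inf inf_le_left
          ((inf_le_inf (show bigradingStep c W F J (p, q) ≤ F p ⊓ W (k + 1) ⊔ W k from ?_)
            h1).trans ?_)
        · refine le_sup_of_le_left (inf_le_inf_left _ ?_)
          rw [h]
          exact inf_le_left
        · have := hO.inf_le (k + 1) p (q + 1) (by omega)
          rwa [add_sub_cancel_right] at this
      · rw [hbot _ h]
        exact disjoint_bot_left
  · intro p
    refine le_antisymm ?_ (sumOver_le fun i hi => le_inf ?_ (hle i))
    · have h1 := hO.F_le_step hc hJ hb p
      have h2 : sumOver (bigradingStep c W F J) {i | p ≤ i.1 ∧ i.1 + i.2 = k + 1} ≤ F p :=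
        sumOver_le fun i hi => inf_le_left.trans (hO.antitone_F hi.1)
      have h3 : F p ⊓ W (k + 1) ≤
          (sumOver (bigradingStep c W F J) {i | p ≤ i.1 ∧ i.1 + i.2 = k + 1} ⊔ W k) ⊓ F p :=
        le_inf (le_sup_left.trans h1) inf_le_left
      rw [sup_inf_assoc_of_le _ h2] at h3
      refine h3.trans (sup_le (hstep p) ?_)
      rw [inf_comm, hJ.F_eq]
      exact hJle _
    · by_cases h : i.1 + i.2 = k + 1
      · rw [bigradingExtend_of_eq h]
        exact inf_le_left.trans (hO.antitone_F hi)
      · rw [bigradingExtend_of_ne h]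
        have : J i ≤ F p ⊓ W k := by
          rw [hJ.F_eq]
          exact le_sumOver hi
        exact this.trans inf_le_left
  · intro j
    by_cases hj : j ≤ k
    · rw [sumOver_bigradingExtend (A := {i | i.1 + i.2 ≤ j})
        (fun i (hi : i.1 + i.2 ≤ j) => by omega), ← hJ.W_eq,
        min_eq_left hj, min_eq_left (by omega)]
    · rw [min_eq_right (by omega)]
      refine le_antisymm ?_ (sumOver_le fun i _ => hle i)
      have h1 := hO.F_le_step hc hJ hb a
      rw [ha, top_inf_eq] at h1
      refine le_sup_left.trans (h1.trans (sup_le (sumOver_le fun i hi => ?_) ?_))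
      · rw [← bigradingExtend_of_eq hi.2]
        refine le_sumOver ?_
        have := hi.2
        simp only [Set.mem_ofPred_eq]
        omega
      · rw [hWk]
        refine (hJle _).trans (sumOver_mono ?_)
        rintro i hi
        simp only [Set.mem_ofPred_eq] at *
        omega
  · intro p q
    rcases lt_trichotomy (p + q) (k + 1) with h | h | h
    · rw [sumOver_bigradingExtend, bigradingExtend_of_ne (by simp only; omega)]
      · exact hJ.conj_le p q
      · rintro ⟨r, s⟩ hi
        simp only [below, Set.mem_ofPred_eq, Set.mem_insert_iff, Prod.mk.injEq] at *
        omega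
    · rw [sumOver_insert, bigradingExtend_of_eq (i := (p, q)) (by exact h),
        bigradingExtend_of_eq (i := (q, p)) (by simp only; omega), sumOver_bigradingExtend]
      -- With `v = c z' + l`, the conjugate is `z' + c l`, where `c l` is a lower term and `z'`
      -- satisfies all three conditions that define the piece `(p, q)`.
      · rintro _ ⟨v, ⟨hF, hW, hv⟩, rfl⟩
        obtain ⟨z, ⟨z', hz', rfl⟩, l, hl, rfl⟩ := Submodule.mem_sup.1 hv
        have hl' : c l ∈ sumOver J (below p q) :=
          hJ.map_below_le p q (Submodule.mem_map_of_mem hl)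
        rw [map_add, hc]
        refine Submodule.add_mem_sup ⟨hz', ?_, ?_⟩ hl'
        · have h1 := hO.map_W_le _ (Submodule.mem_map_of_mem hW)
          rw [map_add, hc, add_comm] at h1
          refine (Submodule.add_mem_iff_left _ ?_).1 h1
          simp only
          rw [h]
          exact hk (truncated_le hJ _ hl')
        · have : z' = c (c z' + l) - c l := by rw [map_add, hc]; abel
          rw [this, sub_eq_add_neg]
          exact Submodule.add_mem_sup (Submodule.mem_map_of_mem hF)
            (Submodule.neg_mem _ hl')
      · rintro ⟨r, s⟩ hi
        simp only [below, Set.mem_ofPred_eq] at *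
        omega
    · rw [hbot _ (by simp only; omega), Submodule.map_bot]
      exact bot_le

/-- Existence of Deligne's bigrading. -/
theorem exists_isBigrading (hO : IsOpposed c W F) (hc : ∀ x, c (c x) = x) {a b a' b' : ℤ}
    (ha : F a = ⊤) (hb : F b = ⊥) (ha' : W a' = ⊥) (hb' : W b' = ⊤) :
    ∃ I, IsBigrading c W F I ∧ ⨆ i, I i = ⊤ := by
  have key : ∀ n : ℕ, ∃ J, Truncated c W F (a' + n) J := by
    intro n
    induction n with
    | zero =>
      -- The induction starts at `W_{a'} = 0` with the zero bigrading.
      refine ⟨fun _ => ⊥, ?_⟩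
      have h0 : ∀ A, sumOver (fun _ => (⊥ : Submodule ℂ X)) A = ⊥ := fun A => by
        simp [sumOver]
      refine ⟨by simp [iSupIndep_def], fun p => ?_, fun k => ?_, fun p q => ?_⟩
      · simp [h0, ha']
      · rw [h0, eq_bot_iff, ← ha']
        exact hO.monotone_W (by simp)
      · simp
    | succ n ih =>
      obtain ⟨J, hJ⟩ := ih
      refine ⟨bigradingExtend c W F J (a' + n + 1), ?_⟩
      have := hO.truncated_extend hc hJ ha hb
      rwa [show a' + ((n + 1 : ℕ) : ℤ) = a' + n + 1 by push_cast; ring]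
  obtain ⟨J, hJ⟩ := key (b' - a').toNat
  have htop : ∀ k, b' ≤ k → W k = ⊤ := fun k hk => by
    rw [eq_top_iff, ← hb']
    exact hO.monotone_W hk
  have hN : W (a' + (b' - a').toNat) = ⊤ := htop _ (by omega)
  refine ⟨J, ⟨hJ.indep, fun p => ?_, fun k => ?_, hJ.conj_le⟩, ?_⟩
  · rw [← hJ.F_eq, hN, inf_top_eq]
  · rw [← hJ.W_eq]
    rcases le_total k (a' + (b' - a').toNat) with h | h
    · rw [min_eq_left h]
    · rw [min_eq_right h, hN, htop k (by omega)]
  · have h := hJ.W_eq (a' + (b' - a').toNat)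
    rw [min_self, hN] at h
    rw [eq_top_iff, h]
    exact sumOver_le fun i _ => le_iSup J i

end IsOpposed

end Existence

/-! ### From mixed Hodge structures to opposed filtrations -/

section MixedHodgeStructures

variable {V V' : Type*} [AddCommGroup V] [Module ℚ V] [AddCommGroup V'] [Module ℚ V']

theorem conj_tmul (z : ℂ) (v : V) : conj V (z ⊗ₜ[ℚ] v) = (starRingEnd ℂ z) ⊗ₜ[ℚ] v := rfl

theorem conj_conj (x : Cx V) : conj V (conj V x) = x := by
  induction x using TensorProduct.induction_on with
  | zero => simp
  | tmul z w => simp [conj_tmul]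
  | add x y hx hy => rw [map_add, map_add, hx, hy]

theorem conj_baseChange (f : V →ₗ[ℚ] V') (x : Cx V) :
    conj V' (f.baseChange ℂ x) = f.baseChange ℂ (conj V x) := by
  induction x using TensorProduct.induction_on with
  | zero => simp
  | tmul z w => simp [conj_tmul]
  | add x y hx hy => rw [map_add, map_add, hx, hy, map_add, map_add]

theorem baseChange_map_conj_le (P : Submodule ℚ V) :
    (P.baseChange ℂ).map (conj V) ≤ P.baseChange ℂ := by
  rw [Submodule.baseChange]
  rintro _ ⟨_, ⟨y, rfl⟩, rfl⟩
  exact ⟨conj _ y, (conj_baseChange _ _).symm⟩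

variable {W : ℤ → Submodule ℚ V} {F : ℤ → Submodule ℂ (Cx V)}

theorem subtype_baseChange_injective (P : Submodule ℚ V) :
    Function.Injective (P.subtype.baseChange ℂ) := by
  have := Module.Flat.lTensor_preserves_injective_linearMap (M := ℂ) P.subtype
    P.injective_subtype
  exact this

/-- Right exactness of `ℂ ⊗ -` identifies the kernel of the complexified quotient map, and flatness
embeds it in `V_ℂ`. -/
theorem mkQ_baseChange_eq_zero {P Q : Submodule ℚ V} (hPQ : P ≤ Q) (y : Cx Q) :
    (P.submoduleOf Q).mkQ.baseChange ℂ y = 0 ↔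
      Q.subtype.baseChange ℂ y ∈ P.baseChange ℂ := by
  have hex : Function.Exact ((P.submoduleOf Q).subtype.baseChange ℂ)
      ((P.submoduleOf Q).mkQ.baseChange ℂ) := by
    have := lTensor_exact ℂ (f := (P.submoduleOf Q).subtype) (g := (P.submoduleOf Q).mkQ)
      (LinearMap.exact_subtype_mkQ _) (Submodule.mkQ_surjective _)
    exact this
  have hmap : P.baseChange ℂ =
      ((P.submoduleOf Q).baseChange ℂ).map (Q.subtype.baseChange ℂ) := by
    have h1 : P = (P.submoduleOf Q).map Q.subtype := by
      rw [Submodule.submoduleOf, Submodule.map_comap_subtype, inf_eq_right.2 hPQ]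
    conv_lhs => rw [h1]
    rw [Submodule.baseChange, Submodule.baseChange]
    apply le_antisymm
    · rintro _ ⟨x, rfl⟩
      induction x using TensorProduct.induction_on with
      | zero => simp
      | tmul z w =>
        obtain ⟨_, w, hw, rfl⟩ := w
        exact ⟨_, ⟨z ⊗ₜ[ℚ] ⟨w, hw⟩, rfl⟩, by simp⟩
      | add x y hx hy => rw [map_add]; exact Submodule.add_mem _ hx hy
    · rintro _ ⟨_, ⟨x, rfl⟩, rfl⟩
      induction x using TensorProduct.induction_on with
      | zero => simp
      | tmul z w =>
        exact ⟨z ⊗ₜ[ℚ] ⟨_, Submodule.mem_map_of_mem w.2⟩, by simp⟩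
      | add x y hx hy => rw [map_add, map_add]; exact Submodule.add_mem _ hx hy
  rw [hmap]
  constructor
  · intro h
    obtain ⟨x, rfl⟩ := (hex y).1 h
    refine Submodule.mem_map_of_mem ?_
    rw [Submodule.baseChange]
    exact ⟨x, rfl⟩
  · rintro ⟨x, hx, hxy⟩
    rw [← subtype_baseChange_injective _ hxy]
    rw [Submodule.baseChange] at hx
    exact (hex x).2 hx

/-- Subspaces of `ℂ ⊗ Gr^W_k` correspond to subspaces of `ℂ ⊗ W_k` that contain `ℂ ⊗ W_{k-1}`; the
two halves of `IsCompl` become the two inclusions. -/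
theorem IsMHS.isOpposed (h : IsMHS W F) :
    IsOpposed (conj V) (fun k => (W k).baseChange ℂ) F := by
  have hle : ∀ k, W (k - 1) ≤ W k := fun k => h.monotone_W (by omega)
  have hmono : Monotone fun k => (W k).baseChange ℂ := fun a b hab =>
    Submodule.baseChange_mono ℂ (h.monotone_W hab)
  refine ⟨hmono, h.antitone_F, fun k => baseChange_map_conj_le _, ?_, ?_⟩
  · intro k p q hpq x hx
    have hrange := hx
    simp only [Submodule.baseChange] at hrange
    obtain ⟨y, rfl⟩ := hrange
    have hc := (h.pure k).isCompl p q hpq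
    have hy : ((W (k - 1)).submoduleOf (W k)).mkQ.baseChange ℂ y ∈
        grF W F k p ⊔ conjSub (grF W F k q) := by
      rw [hc.sup_eq_top]
      exact Submodule.mem_top
    obtain ⟨_, ⟨y₁, hy₁, rfl⟩, _, ⟨_, ⟨y₂, hy₂, rfl⟩, rfl⟩, hsum⟩ := Submodule.mem_sup.1 hy
    rw [conj_baseChange] at hsum
    have h0 : ((W (k - 1)).submoduleOf (W k)).mkQ.baseChange ℂ (y - y₁ - conj _ y₂) = 0 := by
      rw [map_sub, map_sub, ← hsum]
      abel
    have h1 := (mkQ_baseChange_eq_zero (hle k) _).1 h0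
    have hy' : y = y₁ + (conj _ y₂ + (y - y₁ - conj _ y₂)) := by abel
    have hmem : ∀ z : Cx (W k), (W k).subtype.baseChange ℂ z ∈ (W k).baseChange ℂ := fun z => by
      rw [Submodule.baseChange]
      exact ⟨z, rfl⟩
    rw [hy', map_add, map_add]
    refine Submodule.add_mem_sup (Submodule.mem_sup_left ⟨hy₁, hmem _⟩)
      (Submodule.add_mem_sup ⟨?_, hmem _⟩ h1)
    rw [← conj_baseChange]
    exact Submodule.mem_map_of_mem hy₂
  · rintro k p q hpq x ⟨h1, h2⟩
    obtain ⟨f, ⟨hfF, hfW⟩, w, hw, rfl⟩ := Submodule.mem_sup.1 h1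
    obtain ⟨g, ⟨hgF, hgW⟩, w', hw', hgx⟩ := Submodule.mem_sup.1 h2
    have hrange : ∀ z, z ∈ (W k).baseChange ℂ →
        ∃ y, (W k).subtype.baseChange ℂ y = z := fun z hz => by
      rw [Submodule.baseChange] at hz
      exact hz
    obtain ⟨y, rfl⟩ := hrange f hfW
    obtain ⟨y', hy'⟩ := hrange (conj V g) (baseChange_map_conj_le _ (Submodule.mem_map_of_mem hgW))
    have hg : (W k).subtype.baseChange ℂ (conj _ y') = g := by
      rw [← conj_baseChange, hy', conj_conj]
    have hdiff : ((W (k - 1)).submoduleOf (W k)).mkQ.baseChange ℂ (y - conj _ y') = 0 := by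
      rw [mkQ_baseChange_eq_zero (hle k), map_sub, hg]
      have : (W k).subtype.baseChange ℂ y - g = w' - w := by
        rw [sub_eq_sub_iff_add_eq_add, ← hgx, add_comm]
      rw [this]
      exact Submodule.sub_mem _ hw' hw
    rw [map_sub, sub_eq_zero] at hdiff
    have hc := (h.pure k).isCompl p q hpq
    have h0 : ((W (k - 1)).submoduleOf (W k)).mkQ.baseChange ℂ y = 0 := by
      refine Submodule.disjoint_def.1 hc.disjoint _ ⟨y, hfF, rfl⟩ ?_
      rw [hdiff, ← conj_baseChange]
      refine Submodule.mem_map_of_mem ⟨y', ?_, rfl⟩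
      rw [SetLike.mem_coe, Submodule.mem_comap, hy']
      exact (mem_map_conj conj_conj).1 hgF
    exact Submodule.add_mem _ ((mkQ_baseChange_eq_zero (hle k) _).1 h0) hw

theorem sumOver_eq_iSup {X : Type*} [AddCommGroup X] [Module ℂ X]
    (I : ℤ → ℤ → Submodule ℂ X) (P : ℤ → ℤ → Prop) :
    sumOver (fun i => I i.1 i.2) {i | P i.1 i.2} = ⨆ (r : ℤ) (s : ℤ) (_ : P r s), I r s := by
  apply le_antisymm
  · exact sumOver_le fun i hi => le_iSup₂_of_le i.1 i.2 (le_iSup_of_le hi le_rfl)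
  · exact iSup₂_le fun r s => iSup_le fun h =>
      le_sumOver (I := fun i : ℤ × ℤ => I i.1 i.2) (i := (r, s)) h

theorem IsDeligneBigrading.isBigrading {I : ℤ → ℤ → Submodule ℂ (Cx V)}
    (h : IsDeligneBigrading W F I) :
    IsBigrading (conj V) (fun k => (W k).baseChange ℂ) F (fun i => I i.1 i.2) := by
  refine ⟨h.isInternal.submodule_iSupIndep, fun p => ?_, fun k => ?_, fun p q => ?_⟩
  · rw [sumOver_eq_iSup I fun r _ => p ≤ r, ← h.F_eq]
  · rw [sumOver_eq_iSup I fun r s => r + s ≤ k, ← h.W_eq]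
  · rw [sumOver_insert, below, sumOver_eq_iSup I fun r s => r < p ∧ s < q, h.conj_mod]
    exact le_sup_left

theorem IsMHS.exists_isDeligneBigrading (h : IsMHS W F) :
    ∃ I, IsDeligneBigrading W F I := by
  obtain ⟨a, ha⟩ := h.exists_F_top
  obtain ⟨b, hb⟩ := h.exists_F_bot
  obtain ⟨a', ha'⟩ := h.exists_W_bot
  obtain ⟨b', hb'⟩ := h.exists_W_top
  obtain ⟨I, hI, htop⟩ := h.isOpposed.exists_isBigrading conj_conj ha hb
    (a' := a') (b' := b') (by simp [ha']) (by simp [hb'])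
  refine ⟨fun p q => I (p, q), ?_, fun p => ?_, fun k => ?_, fun p q => ?_⟩
  · exact DirectSum.isInternal_submodule_of_iSupIndep_of_iSup_eq_top hI.indep htop
  · rw [hI.F_eq, ← sumOver_eq_iSup (fun p q => I (p, q)) fun r _ => p ≤ r]
  · rw [hI.W_eq k, ← sumOver_eq_iSup (fun p q => I (p, q)) fun r s => r + s ≤ k]
  · rw [← sumOver_eq_iSup (fun p q => I (p, q)) fun r s => r < p ∧ s < q]
    exact hI.conj_mod conj_conj p q

/-- `deligneI` is a choice by `Classical.epsilon`, so existence of one bigrading is what gives it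
content. -/
theorem VGPMHS.isDeligneBigrading {E : Type*} [NormedAddCommGroup E] [NormedSpace ℂ E]
    {S : Type*} [TopologicalSpace S] [ChartedSpace E S] (𝒱 : VGPMHS E S) (s : S) :
    IsDeligneBigrading (𝒱.W s) (𝒱.F s) (𝒱.I s) :=
  Classical.epsilon_spec (𝒱.isMHS s).exists_isDeligneBigrading

end MixedHodgeStructures

/-! ### Smoothly varying subspaces -/

section SmoothFamilies

variable (E : Type*) [NormedAddCommGroup E] [NormedSpace ℂ E]
  {S : Type*} [TopologicalSpace S] [ChartedSpace E S]

/-- `f` is smooth at all points near `s₀`. -/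
def SmoothNear {G : Type*} [NormedAddCommGroup G] [NormedSpace ℝ G] (f : S → G) (s₀ : S) : Prop :=
  ∀ᶠ s in 𝓝 s₀, ContMDiffAt 𝓘(ℝ, E) 𝓘(ℝ, G) ∞ f s

variable {E}

namespace SmoothNear

variable {G H K : Type*} [NormedAddCommGroup G] [NormedSpace ℝ G] [NormedAddCommGroup H]
  [NormedSpace ℝ H] [NormedAddCommGroup K] [NormedSpace ℝ K] {f : S → G} {g : S → H} {s₀ : S}

theorem const (y : G) : SmoothNear E (fun _ : S => y) s₀ :=
  Filter.Eventually.of_forall fun _ => contMDiffAt_const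

theorem comp {Φ : G → H} (hΦ : ContDiff ℝ ∞ Φ) (hf : SmoothNear E f s₀) :
    SmoothNear E (fun s => Φ (f s)) s₀ := by
  filter_upwards [hf] with s hs
  exact hΦ.comp_contMDiffAt hs

theorem comp₂ {Φ : G × H → K} (hΦ : ContDiff ℝ ∞ Φ) (hf : SmoothNear E f s₀)
    (hg : SmoothNear E g s₀) : SmoothNear E (fun s => Φ (f s, g s)) s₀ := by
  filter_upwards [hf, hg] with s hs hs'
  exact hΦ.comp_contMDiffAt (hs.prodMk_space hs')

theorem add {g : S → G} (hf : SmoothNear E f s₀) (hg : SmoothNear E g s₀) :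
    SmoothNear E (fun s => f s + g s) s₀ := hf.comp₂ contDiff_add hg

theorem sub {g : S → G} (hf : SmoothNear E f s₀) (hg : SmoothNear E g s₀) :
    SmoothNear E (fun s => f s - g s) s₀ := hf.comp₂ (contDiff_fst.sub contDiff_snd) hg

theorem sum {ι : Type*} (t : Finset ι) {f : ι → S → G} (hf : ∀ i ∈ t, SmoothNear E (f i) s₀) :
    SmoothNear E (fun s => ∑ i ∈ t, f i s) s₀ := by
  classical
  induction t using Finset.induction_on with
  | empty => simpa using const 0
  | insert i t hi ih =>
    simp only [Finset.sum_insert hi]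
    exact (hf i (Finset.mem_insert_self i t)).add
      (ih fun j hj => hf j (Finset.mem_insert_of_mem hj))

theorem continuousAt (hf : SmoothNear E f s₀) : ContinuousAt f s₀ :=
  hf.self_of_nhds.continuousAt

variable {X Y Z : Type*} [NormedAddCommGroup X] [NormedSpace ℂ X] [NormedAddCommGroup Y]
  [NormedSpace ℂ Y] [NormedAddCommGroup Z] [NormedSpace ℂ Z]

theorem clm_apply {g : S → X →L[ℂ] Y} {f : S → X} (hg : SmoothNear E g s₀)
    (hf : SmoothNear E f s₀) : SmoothNear E (fun s => g s (f s)) s₀ := by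
  have h : ContDiff ℂ ∞ fun p : (X →L[ℂ] Y) × X => p.1 p.2 :=
    isBoundedBilinearMap_apply.contDiff
  exact hg.comp₂ (h.restrict_scalars ℝ) hf

theorem clm_mul {g f : S → X →L[ℂ] X} (hg : SmoothNear E g s₀)
    (hf : SmoothNear E f s₀) : SmoothNear E (fun s => g s * f s) s₀ := by
  have h : ContDiff ℂ ∞ fun p : (X →L[ℂ] X) × (X →L[ℂ] X) => p.1.comp p.2 :=
    isBoundedBilinearMap_comp.contDiff
  exact hg.comp₂ (h.restrict_scalars ℝ) hf

theorem inverse [CompleteSpace X] {g : S → X →L[ℂ] X} (hg : SmoothNear E g s₀)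
    (h : ∀ᶠ s in 𝓝 s₀, IsUnit (g s)) : SmoothNear E (fun s => Ring.inverse (g s)) s₀ := by
  filter_upwards [hg, h] with s hs ⟨u, hu⟩
  have h1 : ContDiffAt ℂ ∞ Ring.inverse (g s) := by
    rw [← hu]
    exact contDiffAt_ringInverse ℂ u
  exact (h1.restrict_scalars ℝ).comp_contMDiffAt hs

theorem eventually_isUnit [CompleteSpace X] {g : S → X →L[ℂ] X} (hg : SmoothNear E g s₀)
    (h : IsUnit (g s₀)) : ∀ᶠ s in 𝓝 s₀, IsUnit (g s) :=
  hg.continuousAt.eventually (Units.isOpen.mem_nhds h)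

end SmoothNear

variable {X : Type*} [NormedAddCommGroup X] [NormedSpace ℂ X]

variable (E) in
/-- The subspaces `A s` are the images of `A s₀` under automorphisms that depend smoothly on `s`
near `s₀`. -/
def IsSmoothFamily (A : S → Submodule ℂ X) (s₀ : S) : Prop :=
  ∃ h : S → X →L[ℂ] X, SmoothNear E h s₀ ∧ h s₀ = 1 ∧
    ∀ᶠ s in 𝓝 s₀, A s = (A s₀).map (h s).toLinearMap

variable (E) in
/-- The subspaces `A s` are mapped into `A s₀` by automorphisms that depend smoothly on `s`
near `s₀`. -/
def IsUpperFamily (A : S → Submodule ℂ X) (s₀ : S) : Prop :=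
  ∃ h : S → X →L[ℂ] X, SmoothNear E h s₀ ∧ h s₀ = 1 ∧
    ∀ᶠ s in 𝓝 s₀, ∀ x ∈ A s, h s x ∈ A s₀

variable {A B : S → Submodule ℂ X} {s₀ : S}

theorem isSmoothFamily_const (P : Submodule ℂ X) : IsSmoothFamily E (fun _ : S => P) s₀ := by
  refine ⟨fun _ => 1, SmoothNear.const 1, rfl, Filter.Eventually.of_forall fun _ => ?_⟩
  ext x
  simp

theorem IsSmoothFamily.congr (hA : IsSmoothFamily E A s₀) (h : ∀ᶠ s in 𝓝 s₀, B s = A s) :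
    IsSmoothFamily E B s₀ := by
  obtain ⟨g, hg, hg1, hgA⟩ := hA
  refine ⟨g, hg, hg1, ?_⟩
  filter_upwards [hgA, h] with s h1 h2
  rw [h2, h1, h.self_of_nhds]

theorem IsUpperFamily.congr (hA : IsUpperFamily E A s₀) (h : ∀ᶠ s in 𝓝 s₀, B s = A s) :
    IsUpperFamily E B s₀ := by
  obtain ⟨g, hg, hg1, hgA⟩ := hA
  refine ⟨g, hg, hg1, ?_⟩
  filter_upwards [hgA, h] with s h1 h2
  rwa [h2, h.self_of_nhds]

theorem inverse_apply_apply {h : X →L[ℂ] X} (hh : IsUnit h) (x : X) :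
    Ring.inverse h (h x) = x := by
  have := congrArg (fun f : X →L[ℂ] X => f x) (Ring.inverse_mul_cancel h hh)
  exact this

theorem apply_inverse_apply {h : X →L[ℂ] X} (hh : IsUnit h) (x : X) :
    h (Ring.inverse h x) = x := by
  have := congrArg (fun f : X →L[ℂ] X => f x) (Ring.mul_inverse_cancel h hh)
  exact this

variable [FiniteDimensional ℂ X]

/-- There is a linear map that is the identity on one of two disjoint subspaces and vanishes on
the other. -/
theorem exists_clm_of_disjoint {P Q : Submodule ℂ X} (h : Disjoint P Q) :
    ∃ π : X →L[ℂ] X, (∀ x, π x ∈ P) ∧ (∀ x ∈ P, π x = x) ∧ ∀ x ∈ Q, π x = 0 := by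
  obtain ⟨C, hQC, hC⟩ := h.symm.exists_isCompl
  replace hC := hC.symm
  refine ⟨LinearMap.toContinuousLinearMap (Submodule.projection _ _ hC), fun x => ?_,
    fun x hx => ?_, fun x hx => ?_⟩
  · exact Submodule.projection_apply_mem hC x
  · exact Submodule.projection_apply_of_mem_left hC hx
  · exact (Submodule.projection_apply_eq_zero_iff hC).2 (hQC hx)

theorem IsSmoothFamily.isUpperFamily (hA : IsSmoothFamily E A s₀) : IsUpperFamily E A s₀ := by
  have := FiniteDimensional.complete ℂ X
  obtain ⟨h, hs, h1, hA⟩ := hA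
  have hu := hs.eventually_isUnit (by rw [h1]; exact isUnit_one)
  refine ⟨_, hs.inverse hu, by simp [h1], ?_⟩
  filter_upwards [hA, hu] with s hs hu
  rw [hs]
  rintro _ ⟨x, hx, rfl⟩
  simp only [ContinuousLinearMap.coe_coe]
  rwa [inverse_apply_apply hu]

theorem IsUpperFamily.finrank_le (hA : IsUpperFamily E A s₀) :
    ∀ᶠ s in 𝓝 s₀, Module.finrank ℂ (A s) ≤ Module.finrank ℂ (A s₀) := by
  have := FiniteDimensional.complete ℂ X
  obtain ⟨h, hs, h1, hA⟩ := hA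
  have hu := hs.eventually_isUnit (by rw [h1]; exact isUnit_one)
  filter_upwards [hA, hu] with s hs hu
  have hinj : Function.Injective (h s).toLinearMap :=
    Function.LeftInverse.injective (g := ⇑(Ring.inverse (h s))) (inverse_apply_apply hu)
  rw [(Submodule.equivMapOfInjective _ hinj (A s)).finrank_eq]
  refine Submodule.finrank_mono ?_
  rintro _ ⟨x, hx, rfl⟩
  exact hs x hx

/-- An injective map into `A s₀` from a space of the same dimension is onto, so the inverse
automorphisms carry `A s₀` to `A s`. -/
theorem IsUpperFamily.isSmoothFamily (hA : IsUpperFamily E A s₀)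
    (hf : ∀ᶠ s in 𝓝 s₀, Module.finrank ℂ (A s) = Module.finrank ℂ (A s₀)) :
    IsSmoothFamily E A s₀ := by
  have := FiniteDimensional.complete ℂ X
  obtain ⟨h, hs, h1, hA⟩ := hA
  have hu := hs.eventually_isUnit (by rw [h1]; exact isUnit_one)
  refine ⟨_, hs.inverse hu, by simp [h1], ?_⟩
  filter_upwards [hA, hu, hf] with s hs hu hf
  have hinj : Function.Injective (h s).toLinearMap :=
    Function.LeftInverse.injective (g := ⇑(Ring.inverse (h s))) (inverse_apply_apply hu)
  have hmap : (A s).map (h s).toLinearMap = A s₀ := by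
    refine Submodule.eq_of_le_of_finrank_eq ?_ ?_
    · rintro _ ⟨x, hx, rfl⟩
      exact hs x hx
    · rw [← (Submodule.equivMapOfInjective _ hinj (A s)).finrank_eq, hf]
  rw [← hmap, ← Submodule.map_comp]
  ext x
  simp [inverse_apply_apply hu]

/-- Intersections may jump in dimension, so only the one-sided condition survives. Let `π` project
to `A s₀ ∩ B s₀`, and let `ρ` be the identity on `A s₀` and agree with `π` on `B s₀`. Then `(1 - ρ)
h + (ρ - π) g + π` is `1` at `s₀`, and on `A s ∩ B s` its first two terms vanish. -/
theorem IsUpperFamily.inf (hA : IsUpperFamily E A s₀) (hB : IsUpperFamily E B s₀) :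
    IsUpperFamily E (fun s => A s ⊓ B s) s₀ := by
  obtain ⟨h, hs, h1, hA⟩ := hA
  obtain ⟨g, gs, g1, hB⟩ := hB
  obtain ⟨C, hC⟩ := exists_isCompl (A s₀ ⊓ B s₀)
  obtain ⟨π, hπ, hπ1, hπ0⟩ := exists_clm_of_disjoint hC.disjoint
  have hd : Disjoint (A s₀) (B s₀ ⊓ C) := by
    rw [disjoint_iff, ← inf_assoc]
    exact hC.inf_eq_bot
  obtain ⟨ρ, -, hρ1, hρ0⟩ := exists_clm_of_disjoint hd
  have hBdec : B s₀ = (A s₀ ⊓ B s₀) ⊔ (B s₀ ⊓ C) := by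
    rw [inf_comm (B s₀) C, ← sup_inf_assoc_of_le _ (inf_le_right : A s₀ ⊓ B s₀ ≤ B s₀),
      hC.sup_eq_top, top_inf_eq]
  have hBπ : ∀ x ∈ B s₀, ρ x = π x := by
    intro x hx
    rw [hBdec] at hx
    obtain ⟨y, hy, z, hz, rfl⟩ := Submodule.mem_sup.1 hx
    rw [map_add, map_add, hπ1 y hy, hπ0 z hz.2, hρ1 y hy.1, hρ0 z hz]
  refine ⟨fun s => (1 - ρ) * h s + (ρ - π) * g s + π,
    (((SmoothNear.const _).clm_mul hs).add ((SmoothNear.const _).clm_mul gs)).add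
      (SmoothNear.const _), by simp [h1, g1], ?_⟩
  filter_upwards [hA, hB] with s hA hB
  rintro x ⟨hxA, hxB⟩
  have e1 : ρ (h s x) = h s x := hρ1 _ (hA x hxA)
  have e2 : ρ (g s x) = π (g s x) := hBπ _ (hB x hxB)
  have e3 : ((1 - ρ) * h s + (ρ - π) * g s + π) x = π x := by
    simp [e1, e2]
  rw [e3]
  exact hπ x

/-- With `π i` the identity on `A s₀ i` and zero on the other members, `1 + ∑ (h i - 1) π i` agrees
with `h i` on `A s₀ i`. -/
theorem exists_smooth_joint {ι : Type*} (t : Finset ι) {A : S → ι → Submodule ℂ X}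
    (hA : ∀ i ∈ t, IsSmoothFamily E (fun s => A s i) s₀) (hind : iSupIndep (A s₀)) :
    ∃ h : S → X →L[ℂ] X, SmoothNear E h s₀ ∧ h s₀ = 1 ∧
      ∀ᶠ s in 𝓝 s₀, ∀ i ∈ t, A s i = (A s₀ i).map (h s).toLinearMap := by
  classical
  have hproj : ∀ i, ∃ π : X →L[ℂ] X, (∀ x ∈ A s₀ i, π x = x) ∧
      ∀ j, j ≠ i → ∀ x ∈ A s₀ j, π x = 0 := by
    intro i
    obtain ⟨π, -, h1, h0⟩ := exists_clm_of_disjoint (hind i)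
    exact ⟨π, h1, fun j hj x hx =>
      h0 x (le_iSup₂_of_le (f := fun j (_ : j ≠ i) => A s₀ j) j hj le_rfl hx)⟩
  choose π hπ1 hπ0 using hproj
  choose! h hs h1 hh using hA
  refine ⟨fun s => 1 + ∑ i ∈ t, (h i s - 1) * π i, ?_, ?_, ?_⟩
  · exact (SmoothNear.const _).add (SmoothNear.sum t fun i hi =>
      ((hs i hi).sub (SmoothNear.const _)).clm_mul (SmoothNear.const _))
  · simp only
    rw [Finset.sum_eq_zero, add_zero]
    intro i hi
    rw [h1 i hi, sub_self, zero_mul]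
  · rw [← Filter.eventually_all_finset] at hh
    filter_upwards [hh] with s hh i hi
    rw [hh i hi]
    ext y
    simp only [Submodule.mem_map]
    refine exists_congr fun x => and_congr_right fun hx => ?_
    have : (1 + ∑ i ∈ t, (h i s - 1) * π i) x = h i s x := by
      rw [add_apply, sum_apply,
        Finset.sum_eq_single_of_mem i hi]
      · simp [hπ1 i x hx]
      · intro j _ hji
        simp [hπ0 j i hji.symm x hx]
    simp only [ContinuousLinearMap.coe_coe]
    rw [this]

theorem IsSmoothFamily.sup (hA : IsSmoothFamily E A s₀) (hB : IsSmoothFamily E B s₀)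
    (hd : Disjoint (A s₀) (B s₀)) : IsSmoothFamily E (fun s => A s ⊔ B s) s₀ := by
  obtain ⟨h, hs, h1, hA⟩ := hA
  obtain ⟨g, gs, g1, hB⟩ := hB
  obtain ⟨π, -, hπ1, hπ0⟩ := exists_clm_of_disjoint hd
  refine ⟨fun s => h s * π + g s * (1 - π), (hs.clm_mul (SmoothNear.const _)).add
    (gs.clm_mul (SmoothNear.const _)), by simp [h1, g1], ?_⟩
  filter_upwards [hA, hB] with s hA hB
  rw [Submodule.map_sup, hA, hB]
  congr 1
  · ext y
    simp only [Submodule.mem_map]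
    refine exists_congr fun x => and_congr_right fun hx => ?_
    simp [hπ1 x hx]
  · ext y
    simp only [Submodule.mem_map]
    refine exists_congr fun x => and_congr_right fun hx => ?_
    simp [hπ0 x hx]

theorem IsSmoothFamily.finset_sup {ι : Type*} (t : Finset ι) {A : S → ι → Submodule ℂ X}
    (hA : ∀ i ∈ t, IsSmoothFamily E (fun s => A s i) s₀) (hind : iSupIndep (A s₀)) :
    IsSmoothFamily E (fun s => ⨆ i ∈ t, A s i) s₀ := by
  obtain ⟨h, hs, h1, hA⟩ := exists_smooth_joint t hA hind
  refine ⟨h, hs, h1, ?_⟩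
  filter_upwards [hA] with s hA
  simp only [Submodule.map_iSup]
  exact iSup_congr fun i => iSup_congr fun hi => hA i hi

/-- Conjugation of endomorphisms, as a real-linear map. -/
def conjCLM (c : X →ₛₗ[starRingEnd ℂ] X) : (X →L[ℂ] X) →ₗ[ℝ] (X →L[ℂ] X) where
  toFun φ := LinearMap.toContinuousLinearMap (c.comp (φ.toLinearMap.comp c))
  map_add' φ ψ := by ext; simp
  map_smul' r φ := by
    ext x
    have : ∀ y, c (r • y) = r • c y := fun y => by
      rw [← Complex.coe_smul, map_smulₛₗ, Complex.conj_ofReal, Complex.coe_smul]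
    simp [this]

theorem conjCLM_apply (c : X →ₛₗ[starRingEnd ℂ] X) (φ : X →L[ℂ] X) (x : X) :
    conjCLM c φ x = c (φ (c x)) := rfl

theorem IsSmoothFamily.conj {c : X →ₛₗ[starRingEnd ℂ] X} (hc : ∀ x, c (c x) = x)
    (hA : IsSmoothFamily E A s₀) : IsSmoothFamily E (fun s => (A s).map c) s₀ := by
  obtain ⟨h, hs, h1, hA⟩ := hA
  have : FiniteDimensional ℝ (X →L[ℂ] X) := FiniteDimensional.complexToReal _
  refine ⟨fun s => conjCLM c (h s), hs.comp
    (Φ := conjCLM c) (LinearMap.toContinuousLinearMap (conjCLM c)).contDiff, ?_, ?_⟩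
  · ext x
    simp [h1, conjCLM_apply, hc]
  · filter_upwards [hA] with s hA
    rw [hA]
    ext y
    simp [conjCLM_apply, hc]

/-- For functionals `φ j` dual to the frame at `s₀`, the map `1 + ∑ φ j ⊗ (e j s - e j s₀)` carries
the frame at `s₀` to the one at `s`. -/
theorem isSmoothFamily_of_frame {m : ℕ} (e : Fin m → S → X) (he : ∀ j, SmoothNear E (e j) s₀)
    (hli : LinearIndependent ℂ fun j => e j s₀)
    (hA : ∀ᶠ s in 𝓝 s₀, Submodule.span ℂ (Set.range fun j => e j s) = A s) :
    IsSmoothFamily E A s₀ := by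
  obtain ⟨f, hf⟩ := LinearMap.exists_extend hli.repr
  let φ : Fin m → X →L[ℂ] ℂ := fun j =>
    LinearMap.toContinuousLinearMap ((Finsupp.lapply j).comp f)
  have hφ : ∀ i j, φ j (e i s₀) = if i = j then 1 else 0 := by
    intro i j
    have h1 : f (e i s₀) = hli.repr ⟨e i s₀, Submodule.subset_span ⟨i, rfl⟩⟩ :=
      LinearMap.congr_fun hf ⟨e i s₀, _⟩
    have h2 : f (e i s₀) = Finsupp.single i 1 := by
      rw [h1]
      exact hli.repr_eq_single i _ rfl
    simp [φ, h2, Finsupp.single_apply]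
  have hh : ∀ s i, (1 + ∑ j, (φ j).smulRight (e j s - e j s₀)) (e i s₀) = e i s := by
    intro s i
    rw [add_apply, sum_apply,
      Finset.sum_eq_single_of_mem i (Finset.mem_univ i)]
    · simp [hφ]
    · intro j _ hji
      simp [hφ, hji.symm]
  refine ⟨fun s => 1 + ∑ j, (φ j).smulRight (e j s - e j s₀), ?_, ?_, ?_⟩
  · refine (SmoothNear.const _).add (SmoothNear.sum _ fun j _ => ?_)
    exact ((he j).sub (SmoothNear.const _)).comp
      (Φ := fun x => ContinuousLinearMap.smulRightL ℂ X X (φ j) x)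
      ((ContinuousLinearMap.contDiff (𝕜 := ℂ) _).restrict_scalars ℝ)
  · simp
  · filter_upwards [hA] with s hs
    rw [← hs, ← hA.self_of_nhds, Submodule.map_span, ← Set.range_comp]
    congr 2
    ext i
    exact (hh s i).symm

end SmoothFamilies

/-! ### Smooth variation of the bigrading -/

section MovingFrame

variable {X : Type*} [AddCommGroup X] [Module ℂ X]

theorem finrank_sumOver [FiniteDimensional ℂ X] {I : ℤ × ℤ → Submodule ℂ X} (h : iSupIndep I)
    (t : Finset (ℤ × ℤ)) :
    Module.finrank ℂ (sumOver I t) = ∑ i ∈ t, Module.finrank ℂ (I i) := by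
  classical
  induction t using Finset.induction_on with
  | empty =>
    have : sumOver I ∅ = ⊥ := by simp [sumOver]
    rw [Finset.coe_empty, this, finrank_bot, Finset.sum_empty]
  | insert i t hi ih =>
    have hd : Disjoint (I i) (sumOver I t) := by
      rw [← sumOver_singleton (I := I) i]
      exact sumOver_disjoint h (by simpa using hi)
    have := Submodule.finrank_sup_add_finrank_inf_eq (I i) (sumOver I t)
    rw [hd.eq_bot, finrank_bot, add_zero] at this
    rw [Finset.coe_insert, sumOver_insert, Finset.sum_insert hi, this, ih]

/-- If `r ≥ b` the piece lies in `F^b = 0`; if `s ≥ b` its mirror piece vanishes, so it lies in the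
sum of the lower ones; otherwise an index outside the square has `r + s < a`. The square depends
only on `a` and `b`, so it serves a whole neighbourhood. -/
theorem IsBigrading.eq_bot {c : X →ₛₗ[starRingEnd ℂ] X} {W F : ℤ → Submodule ℂ X}
    {I : ℤ × ℤ → Submodule ℂ X} (h : IsBigrading c W F I) (hc : ∀ x, c (c x) = x) {a b : ℤ}
    (ha : W a = ⊥) (hb : F b = ⊥) {i : ℤ × ℤ}
    (hi : i ∉ Finset.Icc ((a - b, a - b) : ℤ × ℤ) (b, b)) : I i = ⊥ := by
  have h1 : ∀ i : ℤ × ℤ, b ≤ i.1 → I i = ⊥ := fun i hi => by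
    rw [eq_bot_iff, ← hb, h.F_eq]
    exact le_sumOver hi
  by_cases hi1 : b ≤ i.1
  · exact h1 i hi1
  by_cases hi2 : b ≤ i.2
  · have h2 := h.le_map_F_sup hc i.1 i.2
    have h3 := h.conj_mod hc i.1 i.2
    rw [h1 (i.2, i.1) hi2, Submodule.map_bot, bot_sup_eq] at h3
    have h4 : I i ≤ sumOver I (below i.1 i.2) := by
      rw [← h3]
      exact le_sup_left
    have h5 : Disjoint (sumOver I {i}) (sumOver I (below i.1 i.2)) :=
      sumOver_disjoint h.indep (by simp [below])
    rw [sumOver_singleton] at h5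
    exact h5.eq_bot_of_le h4
  · rw [eq_bot_iff, ← ha, h.W_eq]
    refine le_sumOver ?_
    simp only [Finset.mem_Icc, Prod.le_def, Set.mem_ofPred_eq] at *
    omega

theorem sumOver_congr_of_bot {I : ℤ × ℤ → Submodule ℂ X} {t : Finset (ℤ × ℤ)}
    (h : ∀ i ∉ t, I i = ⊥) (A : Set (ℤ × ℤ)) [DecidablePred (· ∈ A)] :
    sumOver I A = sumOver I (t.filter (· ∈ A) : Finset (ℤ × ℤ)) := by
  refine le_antisymm (sumOver_le fun i hi => ?_) (sumOver_mono fun i hi => ?_)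
  · by_cases hit : i ∈ t
    · exact le_sumOver (by simpa using ⟨hit, hi⟩)
    · rw [h i hit]
      exact bot_le
  · simp only [Finset.coe_filter, Set.mem_ofPred_eq] at hi
    exact hi.2

end MovingFrame

section MovingFrame

variable {E : Type*} [NormedAddCommGroup E] [NormedSpace ℂ E]
  {S : Type*} [TopologicalSpace S] [ChartedSpace E S]
  {X : Type*} [NormedAddCommGroup X] [NormedSpace ℂ X] [FiniteDimensional ℂ X]

/-- The Deligne bigradings of a variation of mixed Hodge structure near `s₀` are the images of
the one at `s₀` under automorphisms that depend smoothly on the point. -/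
theorem exists_movingFrame {c : X →ₛₗ[starRingEnd ℂ] X} (hc : ∀ x, c (c x) = x)
    {W : ℤ → Submodule ℂ X} {F : S → ℤ → Submodule ℂ X} {I : S → ℤ × ℤ → Submodule ℂ X} {s₀ : S}
    (hI : ∀ᶠ s in 𝓝 s₀, IsBigrading c W (F s) (I s))
    (hF : ∀ p, IsSmoothFamily E (fun s => F s p) s₀) {a b : ℤ} (ha : W a = ⊥)
    (hb : F s₀ b = ⊥) :
    ∃ h : S → X →L[ℂ] X, SmoothNear E h s₀ ∧ h s₀ = 1 ∧
      ∀ᶠ s in 𝓝 s₀, ∀ i, I s i = (I s₀ i).map (h s).toLinearMap := by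
  classical
  have hI₀ := hI.self_of_nhds
  have hb' : ∀ᶠ s in 𝓝 s₀, F s b = ⊥ := by
    obtain ⟨h, -, -, hh⟩ := hF b
    filter_upwards [hh] with s hs
    rw [hs, hb, Submodule.map_bot]
  set t := Finset.Icc ((a - b, a - b) : ℤ × ℤ) (b, b) with ht
  have hbot : ∀ᶠ s in 𝓝 s₀, ∀ i ∉ t, I s i = ⊥ := by
    filter_upwards [hI, hb'] with s hs hbs i hi
    exact hs.eq_bot hc ha hbs hi
  have hbot₀ := hbot.self_of_nhds
  have hsmooth_of_notMem : ∀ i ∉ t, IsSmoothFamily E (fun s => I s i) s₀ := fun i hi =>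
    (isSmoothFamily_const ⊥).congr (by filter_upwards [hbot] with s hs using hs i hi)
  -- The indices in `below p q` have weight at most `p + q - 2`, so the induction hypothesis covers
  -- the sum in `eq_inf`, which then presents `I^{p,q}` as an intersection of smooth families.
  have key : ∀ n : ℕ, ∀ i : ℤ × ℤ, i.1 + i.2 ≤ a + n → IsSmoothFamily E (fun s => I s i) s₀ := by
    intro n
    induction n with
    | zero =>
      intro i hi
      refine (isSmoothFamily_const ⊥).congr ?_
      filter_upwards [hI] with s hs
      rw [eq_bot_iff, ← ha, hs.W_eq]
      exact le_sumOver (by simpa using hi)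
    | succ n ih =>
      have hk : a + ((n + 1 : ℕ) : ℤ) = a + n + 1 := by push_cast; ring
      have hupper : ∀ i : ℤ × ℤ, i.1 + i.2 ≤ a + (n + 1 : ℕ) →
          IsUpperFamily E (fun s => I s i) s₀ := by
        rintro ⟨p, q⟩ hi
        have hΛ : IsSmoothFamily E (fun s => sumOver (I s) (below p q)) s₀ := by
          refine IsSmoothFamily.congr (A := fun s => ⨆ i ∈ t.filter (· ∈ below p q), I s i)
            (IsSmoothFamily.finset_sup _ (fun i hi' => ih i ?_) hI₀.indep) ?_
          · have := (Finset.mem_filter.1 hi').2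
            simp only [below, Set.mem_ofPred_eq] at *
            omega
          · filter_upwards [hbot] with s hs
            rw [sumOver_congr_of_bot hs]
            simp [sumOver]
        have hD := ((hF q).conj hc).sup hΛ (hI₀.map_F_disjoint_below hc p q)
        refine IsUpperFamily.congr ((hF p).isUpperFamily.inf
          ((isSmoothFamily_const (W (p + q))).isUpperFamily.inf hD.isUpperFamily)) ?_
        filter_upwards [hI] with s hs
        exact hs.eq_inf hc p q
      intro i hi
      by_cases hit : i ∈ t
      · refine (hupper i hi).isSmoothFamily ?_
        have hle : ∀ᶠ s in 𝓝 s₀, ∀ j ∈ t.filter (· ∈ {j : ℤ × ℤ | j.1 + j.2 ≤ a + (n + 1 : ℕ)}),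
            Module.finrank ℂ (I s j) ≤ Module.finrank ℂ (I s₀ j) := by
          rw [Filter.eventually_all_finset]
          intro j hj
          exact (hupper j (Finset.mem_filter.1 hj).2).finrank_le
        filter_upwards [hle, hI, hbot] with s hle hIs hbots
        -- Both sums are the same constant `W`, while each summand can only drop: hence none does.
        have hsum : Module.finrank ℂ (sumOver (I s) {j | j.1 + j.2 ≤ a + (n + 1 : ℕ)}) =
            Module.finrank ℂ (sumOver (I s₀) {j | j.1 + j.2 ≤ a + (n + 1 : ℕ)}) := by
          rw [← hIs.W_eq, ← hI₀.W_eq]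
        rw [sumOver_congr_of_bot hbots, sumOver_congr_of_bot hbot₀,
          finrank_sumOver hIs.indep, finrank_sumOver hI₀.indep] at hsum
        exact (Finset.sum_eq_sum_iff_of_le hle).1 hsum i (Finset.mem_filter.2 ⟨hit, hi⟩)
      · exact hsmooth_of_notMem i hit
  obtain ⟨h, hs, h1, hh⟩ := exists_smooth_joint t (A := I)
    (fun i _ => key (i.1 + i.2 - a).toNat i (by omega)) hI₀.indep
  refine ⟨h, hs, h1, ?_⟩
  filter_upwards [hh, hbot] with s hh hbots i
  by_cases hi : i ∈ t
  · exact hh i hi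
  · rw [hbots i hi, hbot₀ i hi, Submodule.map_bot]

end MovingFrame

/-! ### Derivatives of vector-valued functions -/

section Derivatives

variable {E : Type*} [NormedAddCommGroup E] [NormedSpace ℂ E]
  {S : Type*} [TopologicalSpace S] [ChartedSpace E S]
  {G H : Type*} [NormedAddCommGroup G] [NormedSpace ℝ G] [NormedAddCommGroup H] [NormedSpace ℝ H]

/-- The derivative of a vector-valued function on `S`. -/
def tderiv (f : S → G) (s : S) : E →L[ℝ] G := mfderiv 𝓘(ℝ, E) 𝓘(ℝ, G) f s

variable {f : S → G} {s : S}

theorem writtenInExtChartAt_vectorSpace (f : S → G) (s : S) :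
    writtenInExtChartAt 𝓘(ℝ, E) 𝓘(ℝ, G) s f = f ∘ (extChartAt 𝓘(ℝ, E) s).symm := by
  simp [writtenInExtChartAt, chartAt_self_eq]

theorem hasFDerivAt_tderiv (hf : ContMDiffAt 𝓘(ℝ, E) 𝓘(ℝ, G) ∞ f s) :
    HasFDerivAt (f ∘ (extChartAt 𝓘(ℝ, E) s).symm) (tderiv f s) (extChartAt 𝓘(ℝ, E) s s) := by
  have h := (hf.mdifferentiableAt (by simp)).hasMFDerivAt.2
  rw [writtenInExtChartAt_vectorSpace, ModelWithCorners.Boundaryless.range_eq_univ] at h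
  exact hasFDerivWithinAt_univ.1 h

theorem tderiv_eq (hf : ContinuousAt f s) {f' : E →L[ℝ] G}
    (h : HasFDerivAt (f ∘ (extChartAt 𝓘(ℝ, E) s).symm) f' (extChartAt 𝓘(ℝ, E) s s)) :
    tderiv f s = f' := by
  have : HasMFDerivAt 𝓘(ℝ, E) 𝓘(ℝ, G) f s f' := by
    refine ⟨hf, ?_⟩
    rw [writtenInExtChartAt_vectorSpace, ModelWithCorners.Boundaryless.range_eq_univ]
    exact hasFDerivWithinAt_univ.2 h
  exact this.mfderiv

theorem tderiv_congr {g : S → G} (h : f =ᶠ[𝓝 s] g) :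
    (tderiv f s : E →L[ℝ] G) = tderiv g s :=
  h.mfderiv_eq

theorem tderiv_const (y : G) : (tderiv (fun _ => y) s : E →L[ℝ] G) = 0 :=
  mfderiv_const

theorem tderiv_comp (L : G →L[ℝ] H) (hf : ContMDiffAt 𝓘(ℝ, E) 𝓘(ℝ, G) ∞ f s) (ξ : E) :
    tderiv (fun s => L (f s)) s ξ = L (tderiv f s ξ) := by
  have h := L.hasFDerivAt.comp _ (hasFDerivAt_tderiv hf)
  have hc : ContinuousAt (fun s => L (f s)) s := L.continuous.continuousAt.comp hf.continuousAt
  rw [tderiv_eq hc h]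
  rfl

theorem tderiv_clm_apply {X Y : Type*} [NormedAddCommGroup X] [NormedSpace ℂ X]
    [NormedAddCommGroup Y] [NormedSpace ℂ Y] {g : S → X →L[ℂ] Y} {f : S → X}
    (hg : ContMDiffAt 𝓘(ℝ, E) 𝓘(ℝ, X →L[ℂ] Y) ∞ g s) (hf : ContMDiffAt 𝓘(ℝ, E) 𝓘(ℝ, X) ∞ f s)
    (ξ : E) :
    tderiv (fun s => g s (f s)) s ξ = tderiv g s ξ (f s) + g s (tderiv f s ξ) := by
  have hB : IsBoundedBilinearMap ℂ fun p : (X →L[ℂ] Y) × X => p.1 p.2 :=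
    isBoundedBilinearMap_apply
  have h1 := (hasFDerivAt_tderiv hg).prodMk (hasFDerivAt_tderiv hf)
  have h2 := ((hB.hasFDerivAt (g s, f s)).restrictScalars ℝ)
  have h3 : (g ((extChartAt 𝓘(ℝ, E) s).symm (extChartAt 𝓘(ℝ, E) s s)),
      f ((extChartAt 𝓘(ℝ, E) s).symm (extChartAt 𝓘(ℝ, E) s s))) = (g s, f s) := by
    simp
  rw [← h3] at h2
  have h4 := HasFDerivAt.comp (extChartAt 𝓘(ℝ, E) s s)
    (f := fun y => (g ((extChartAt 𝓘(ℝ, E) s).symm y), f ((extChartAt 𝓘(ℝ, E) s).symm y))) h2 h1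
  have hc : ContinuousAt (fun s => g s (f s)) s :=
    hB.continuous.continuousAt.comp (hg.continuousAt.prodMk hf.continuousAt)
  rw [tderiv_eq hc h4]
  simp [add_comm]

theorem tderiv_mem {X : Type*} [NormedAddCommGroup X] [NormedSpace ℂ X] [FiniteDimensional ℂ X]
    {f : S → X} (hf : ContMDiffAt 𝓘(ℝ, E) 𝓘(ℝ, X) ∞ f s) {P : Submodule ℂ X}
    (hP : ∀ᶠ s' in 𝓝 s, f s' ∈ P) (ξ : E) : tderiv f s ξ ∈ P := by
  obtain ⟨Q, hQ⟩ := exists_isCompl P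
  obtain ⟨π, hπQ, hπ1, hπ0⟩ := exists_clm_of_disjoint hQ.disjoint
  have h1 := tderiv_comp ((1 - π).restrictScalars ℝ) hf ξ
  have h2 : (fun s => (1 - π).restrictScalars ℝ (f s)) =ᶠ[𝓝 s] fun _ => 0 := by
    filter_upwards [hP] with s' hs'
    simp [hπ1 _ hs']
  rw [tderiv_congr h2, tderiv_const] at h1
  have h3 : tderiv f s ξ = π (tderiv f s ξ) := by
    rw [← sub_eq_zero]
    exact h1.symm
  rw [h3]
  exact hπQ _

end Derivatives

/-! ### Flat coordinates and the Gauss–Manin connection -/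

section Coordinates

theorem map_sumOver {X Y : Type*} [AddCommGroup X] [Module ℂ X] [AddCommGroup Y] [Module ℂ Y]
    (e : X →ₗ[ℂ] Y) (I : ℤ × ℤ → Submodule ℂ X) (A : Set (ℤ × ℤ)) :
    (sumOver I A).map e = sumOver (fun i => (I i).map e) A := by
  simp only [sumOver, Submodule.map_iSup]

theorem IsBigrading.map {X Y : Type*} [AddCommGroup X] [Module ℂ X] [AddCommGroup Y] [Module ℂ Y]
    {c : X →ₛₗ[starRingEnd ℂ] X} {c' : Y →ₛₗ[starRingEnd ℂ] Y} {W F : ℤ → Submodule ℂ X}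
    {I : ℤ × ℤ → Submodule ℂ X} (h : IsBigrading c W F I) (e : X ≃ₗ[ℂ] Y)
    (he : ∀ x, e (c x) = c' (e x)) :
    IsBigrading c' (fun k => (W k).map e.toLinearMap) (fun p => (F p).map e.toLinearMap)
      (fun i => (I i).map e.toLinearMap) := by
  refine ⟨h.indep.map_orderIso (Submodule.orderIsoMapComap e), fun p => ?_, fun k => ?_,
    fun p q => ?_⟩
  · simp only [← map_sumOver, h.F_eq p]
  · simp only [← map_sumOver, h.W_eq k]
  · rw [← map_sumOver]
    rintro _ ⟨_, ⟨x, hx, rfl⟩, rfl⟩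
    refine ⟨c x, h.conj_le p q (Submodule.mem_map_of_mem hx), ?_⟩
    exact he x

/-- Complex conjugation on `ℂⁿ`. -/
def starConj (n : ℕ) : (Fin n → ℂ) →ₛₗ[starRingEnd ℂ] (Fin n → ℂ) where
  toFun x i := starRingEnd ℂ (x i)
  map_add' x y := by ext; simp
  map_smul' z x := by ext; simp

theorem starConj_starConj (n : ℕ) (x : Fin n → ℂ) : starConj n (starConj n x) = x := by
  ext; simp [starConj]

/-- Complex conjugation on `ℂⁿ` as a continuous real-linear map. -/
def starConjCLM (n : ℕ) : (Fin n → ℂ) →L[ℝ] (Fin n → ℂ) :=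
  ContinuousLinearMap.pi fun i => Complex.conjCLE.toContinuousLinearMap.comp
    (ContinuousLinearMap.proj i)

theorem starConjCLM_apply (n : ℕ) (x : Fin n → ℂ) : starConjCLM n x = starConj n x := rfl

theorem map_baseChange {V V' : Type*} [AddCommGroup V] [Module ℚ V] [AddCommGroup V']
    [Module ℚ V'] (f : V →ₗ[ℚ] V') (P : Submodule ℚ V) :
    (P.baseChange ℂ).map (f.baseChange ℂ) = (P.map f).baseChange ℂ := by
  rw [Submodule.baseChange_eq_span, Submodule.baseChange_eq_span, Submodule.map_span]
  congr 1
  ext x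
  simp

namespace RationalLocalSystem

variable {S : Type*} [TopologicalSpace S] (L : RationalLocalSystem S) {s₀ s : S}

theorem chartC_tmul (s₀ s : S) (z : ℂ) (v : L.fiber s) :
    L.chartC s₀ s (z ⊗ₜ[ℚ] v) = fun i => L.chart s₀ s v i • z := by
  ext i
  simp [chartC]

theorem chartC_conj (s₀ s : S) (x : L.fiberC s) :
    L.chartC s₀ s (conj _ x) = starConj _ (L.chartC s₀ s x) := by
  induction x using TensorProduct.induction_on with
  | zero => simp
  | tmul z w =>
    rw [conj_tmul, chartC_tmul, chartC_tmul]
    ext i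
    simp [starConj, Rat.smul_def]
  | add x y hx hy => simp only [map_add, hx, hy]

/-- The flat trivialization at a point of its domain. -/
def coordEquiv (hs : s ∈ L.dom s₀) : L.fiberC s ≃ₗ[ℂ] (Fin (L.rank s₀) → ℂ) :=
  LinearEquiv.ofBijective (L.chartC s₀ s) (L.bijective_chartC hs)

theorem coordEquiv_toLinearMap (hs : s ∈ L.dom s₀) :
    (L.coordEquiv hs).toLinearMap = L.chartC s₀ s := rfl

open Classical in
/-- The section with given coordinates in a flat trivialization. -/
def secOf (s₀ : S) (f : S → Fin (L.rank s₀) → ℂ) : L.Sec := fun s =>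
  if hs : s ∈ L.dom s₀ then (L.coordEquiv hs).symm (f s) else 0

theorem chartC_secOf (f : S → Fin (L.rank s₀) → ℂ) (hs : s ∈ L.dom s₀) :
    L.chartC s₀ s (L.secOf s₀ f s) = f s := by
  rw [secOf, dif_pos hs]
  exact (L.coordEquiv hs).apply_symm_apply (f s)

theorem chartC_mem_map (hs : s ∈ L.dom s₀) {P : Submodule ℂ (L.fiberC s)} {x : L.fiberC s} :
    L.chartC s₀ s x ∈ P.map (L.chartC s₀ s) ↔ x ∈ P :=
  ⟨fun ⟨_, hy, hyx⟩ => (L.bijective_chartC hs).1 hyx ▸ hy, Submodule.mem_map_of_mem⟩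

theorem exists_transition {s₁ : S} (h₀ : s ∈ L.dom s₀) (h₁ : s ∈ L.dom s₁) :
    ∃ A : (Fin (L.rank s₀) → ℂ) →L[ℂ] (Fin (L.rank s₁) → ℂ),
      ∀ᶠ s' in 𝓝 s, ∀ x, L.chartC s₁ s' x = A (L.chartC s₀ s' x) := by
  obtain ⟨A, hA⟩ := L.locallyConstant s₀ s₁ s ⟨h₀, h₁⟩
  refine ⟨LinearMap.toContinuousLinearMap
    ((TensorProduct.piScalarRight ℚ ℂ ℂ (Fin (L.rank s₁))).toLinearMap ∘ₗ A.baseChange ℂ ∘ₗ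
      (TensorProduct.piScalarRight ℚ ℂ ℂ (Fin (L.rank s₀))).symm.toLinearMap), ?_⟩
  filter_upwards [hA] with s' hs' x
  rw [chartC, hs', LinearMap.baseChange_comp]
  simp [chartC, -TensorProduct.piScalarRight_apply]

variable {E : Type*} [NormedAddCommGroup E] [NormedSpace ℂ E] [ChartedSpace E S]

theorem contMDiffAt_chartC {s₁ : S} (h₀ : s ∈ L.dom s₀) (h₁ : s ∈ L.dom s₁) {σ : L.Sec}
    (h : ContMDiffAt 𝓘(ℝ, E) 𝓘(ℝ, Fin (L.rank s₀) → ℂ) ∞ (fun s' => L.chartC s₀ s' (σ s')) s) :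
    ContMDiffAt 𝓘(ℝ, E) 𝓘(ℝ, Fin (L.rank s₁) → ℂ) ∞ (fun s' => L.chartC s₁ s' (σ s')) s := by
  obtain ⟨A, hA⟩ := L.exists_transition h₀ h₁
  have h2 := (A.restrictScalars ℝ).contDiff.comp_contMDiffAt (n := ∞) h
  refine h2.congr_of_eventuallyEq ?_
  filter_upwards [hA] with s' hs'
  exact hs' _

/-- `nabla` differentiates in the trivialization centred at `s`; transition maps are locally
constant, so any other flat trivialization gives the same result. -/
theorem chartC_nabla (h₀ : s ∈ L.dom s₀) {σ : L.Sec}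
    (h : ContMDiffAt 𝓘(ℝ, E) 𝓘(ℝ, Fin (L.rank s) → ℂ) ∞ (fun s' => L.chartC s s' (σ s')) s)
    (ξ : E) :
    L.chartC s₀ s (L.nabla σ s ξ) = tderiv (fun s' => L.chartC s₀ s' (σ s')) s ξ := by
  obtain ⟨A, hA⟩ := L.exists_transition (L.mem_dom s) h₀
  have h1 : (fun s' => L.chartC s₀ s' (σ s')) =ᶠ[𝓝 s]
      fun s' => A.restrictScalars ℝ (L.chartC s s' (σ s')) := by
    filter_upwards [hA] with s' hs'
    exact hs' _
  have h2 : L.chartC s s (L.nabla σ s ξ) = tderiv (fun s' => L.chartC s s' (σ s')) s ξ :=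
    (L.chartEquiv s).apply_symm_apply _
  rw [tderiv_congr h1, tderiv_comp _ h, hA.self_of_nhds, h2]
  rfl

theorem nabla_mem (h₀ : s ∈ L.dom s₀) {σ : L.Sec}
    (h : ContMDiffAt 𝓘(ℝ, E) 𝓘(ℝ, Fin (L.rank s) → ℂ) ∞ (fun s' => L.chartC s s' (σ s')) s)
    (ξ : E) {P : Submodule ℂ (L.fiberC s)}
    (hP : tderiv (fun s' => L.chartC s₀ s' (σ s')) s ξ ∈ P.map (L.chartC s₀ s)) :
    L.nabla σ s ξ ∈ P := by
  rwa [← L.chartC_mem_map h₀, L.chartC_nabla h₀ h]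

theorem nabla_conj {σ : L.Sec}
    (h : ContMDiffAt 𝓘(ℝ, E) 𝓘(ℝ, Fin (L.rank s) → ℂ) ∞ (fun s' => L.chartC s s' (σ s')) s)
    (ξ : E) :
    ContMDiffAt 𝓘(ℝ, E) 𝓘(ℝ, Fin (L.rank s) → ℂ) ∞
      (fun s' => L.chartC s s' (conj _ (σ s'))) s ∧
    L.nabla (fun s' => conj _ (σ s')) s ξ = conj _ (L.nabla σ s ξ) := by
  have h1 : (fun s' => L.chartC s s' (conj _ (σ s'))) =
      fun s' => starConjCLM _ (L.chartC s s' (σ s')) := by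
    ext1 s'
    rw [chartC_conj, starConjCLM_apply]
  have h2 : ContMDiffAt 𝓘(ℝ, E) 𝓘(ℝ, Fin (L.rank s) → ℂ) ∞
      (fun s' => L.chartC s s' (conj _ (σ s'))) s := by
    rw [h1]
    exact (starConjCLM _).contDiff.comp_contMDiffAt (n := ∞) h
  refine ⟨h2, (L.bijective_chartC (L.mem_dom s)).1 ?_⟩
  rw [L.chartC_nabla (L.mem_dom s) h2, chartC_conj, L.chartC_nabla (L.mem_dom s) h, h1,
    tderiv_comp _ h, starConjCLM_apply]

end RationalLocalSystem

end Coordinates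

/-! ### Local frames adapted to the bigrading, and their connection form -/

namespace VGPMHS

variable {E : Type*} [NormedAddCommGroup E] [NormedSpace ℂ E]
  {S : Type*} [TopologicalSpace S] [ChartedSpace E S] (𝒱 : VGPMHS E S)

/-- The Deligne bigrading of the fibre at `s`, indexed by pairs. -/
def bigr (s : S) (i : ℤ × ℤ) : Submodule ℂ (𝒱.fiberC s) := 𝒱.I s i.1 i.2

theorem U_eq (p : ℤ) (s : S) : 𝒱.U p s = sumOver (𝒱.bigr s) {i | i.1 = p} := by
  refine le_antisymm (iSup_le fun q => ?_) (sumOver_le fun i hi => ?_)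
  · exact le_sumOver (I := 𝒱.bigr s) (i := (p, q)) rfl
  · have hi' : i.1 = p := hi
    subst hi'
    exact le_iSup (fun q => 𝒱.I s i.1 q) i.2

theorem isBigrading (s : S) :
    IsBigrading (conj _) (fun k => (𝒱.W s k).baseChange ℂ) (𝒱.F s) (𝒱.bigr s) :=
  (𝒱.isDeligneBigrading s).isBigrading

theorem eventually_W (s₀ : S) : ∀ᶠ s in 𝓝 s₀, ∀ k,
    ((𝒱.W s k).baseChange ℂ).map (𝒱.chartC s₀ s) =
      ((𝒱.W s₀ k).baseChange ℂ).map (𝒱.chartC s₀ s₀) := by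
  have hmap : ∀ s k, ((𝒱.W s k).baseChange ℂ).map (𝒱.chartC s₀ s) =
      (((𝒱.W s k).map (𝒱.chart s₀ s)).baseChange ℂ).map
        (TensorProduct.piScalarRight ℚ ℂ ℂ (Fin (𝒱.rank s₀))).toLinearMap := fun s k => by
    rw [RationalLocalSystem.chartC, Submodule.map_comp, map_baseChange]
  -- Flatness gives one neighbourhood per `k`. Only `a ≤ k ≤ b` matter: outside this range the
  -- filtration is `⊥` or `⊤` near `s₀`.
  have key : ∀ᶠ s in 𝓝 s₀, ∀ k,
      (𝒱.W s k).map (𝒱.chart s₀ s) = (𝒱.W s₀ k).map (𝒱.chart s₀ s₀) := by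
    obtain ⟨a, ha⟩ := (𝒱.isMHS s₀).exists_W_bot
    obtain ⟨b, hb⟩ := (𝒱.isMHS s₀).exists_W_top
    have hflat := fun k => 𝒱.flat_W k s₀ s₀ (𝒱.mem_dom s₀)
    have hfin := (Filter.eventually_all_finset (Finset.Icc a b)).2 fun k _ => hflat k
    have htop : (𝒱.W s₀ b).map (𝒱.chart s₀ s₀) = ⊤ := by
      rw [hb, Submodule.map_top, LinearMap.range_eq_top]
      exact (𝒱.bijective_chart s₀ s₀ (𝒱.mem_dom s₀)).2
    filter_upwards [hfin, hflat a, hflat b] with s hs hsa hsb k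
    rcases lt_or_ge k a with hka | hka
    · have h1 : ∀ s', (𝒱.W s' a).map (𝒱.chart s₀ s') = ⊥ →
          (𝒱.W s' k).map (𝒱.chart s₀ s') = ⊥ := fun s' h => by
        rw [eq_bot_iff, ← h]
        exact Submodule.map_mono ((𝒱.isMHS s').monotone_W hka.le)
      rw [ha, Submodule.map_bot] at hsa
      rw [h1 s hsa, h1 s₀ (by rw [ha, Submodule.map_bot])]
    rcases lt_or_ge b k with hkb | hkb
    · have h1 : ∀ s', (𝒱.W s' b).map (𝒱.chart s₀ s') = ⊤ →
          (𝒱.W s' k).map (𝒱.chart s₀ s') = ⊤ := fun s' h => by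
        rw [eq_top_iff, ← h]
        exact Submodule.map_mono ((𝒱.isMHS s').monotone_W hkb.le)
      rw [h1 s (hsb.trans htop), h1 s₀ htop]
    · exact hs k (Finset.mem_Icc.2 ⟨hka, hkb⟩)
  filter_upwards [key] with s hs k
  rw [hmap, hmap, hs]

theorem isSmoothFamily_F (s₀ : S) (p : ℤ) :
    IsSmoothFamily E (fun s => (𝒱.F s p).map (𝒱.chartC s₀ s)) s₀ := by
  obtain ⟨N, hN, hs₀, m, e, he, hspan⟩ := 𝒱.holomorphic_F p s₀
  refine isSmoothFamily_of_frame (fun j s => 𝒱.chartC s₀ s (e j s)) (fun j => ?_) ?_ ?_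
  · filter_upwards [hN.mem_nhds hs₀, (𝒱.isOpen_dom s₀).mem_nhds (𝒱.mem_dom s₀)] with s hs hd
    exact 𝒱.contMDiffAt_chartC (𝒱.mem_dom s) hd ((he j).1 s hs)
  · exact (hspan s₀ hs₀).1.map' _
      (LinearMap.ker_eq_bot.2 (𝒱.bijective_chartC (𝒱.mem_dom s₀)).1)
  · filter_upwards [hN.mem_nhds hs₀] with s hs
    have h1 : Submodule.span ℂ (Set.range fun j => e j s) = 𝒱.F s p := (hspan s hs).2
    rw [← h1, Submodule.map_span, ← Set.range_comp]
    rfl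

/-- A smooth local trivialization near `s₀` that respects the Deligne bigradings, expressed in
the flat trivialization around `s₀`. -/
structure LocalFrame (s₀ : S) where
  nhd : Set S
  isOpen_nhd : IsOpen nhd
  mem_nhd : s₀ ∈ nhd
  nhd_subset : nhd ⊆ 𝒱.dom s₀
  toFun : S → (Fin (𝒱.rank s₀) → ℂ) →L[ℂ] (Fin (𝒱.rank s₀) → ℂ)
  smooth : SmoothNear E toFun s₀
  contMDiffAt : ∀ s ∈ nhd, ContMDiffAt 𝓘(ℝ, E)
    𝓘(ℝ, (Fin (𝒱.rank s₀) → ℂ) →L[ℂ] (Fin (𝒱.rank s₀) → ℂ)) ∞ toFun s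
  map_self : toFun s₀ = 1
  isUnit : ∀ s ∈ nhd, IsUnit (toFun s)
  map_eq : ∀ s ∈ nhd, ∀ Z, (sumOver (𝒱.bigr s) Z).map (𝒱.chartC s₀ s) =
    ((sumOver (𝒱.bigr s₀) Z).map (𝒱.chartC s₀ s₀)).map (toFun s).toLinearMap
  map_W : ∀ s ∈ nhd, ∀ k, ((𝒱.W s k).baseChange ℂ).map (𝒱.chartC s₀ s) =
    ((𝒱.W s₀ k).baseChange ℂ).map (𝒱.chartC s₀ s₀)

theorem nonempty_localFrame (s₀ : S) : Nonempty (𝒱.LocalFrame s₀) := by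
  obtain ⟨a, ha⟩ := (𝒱.isMHS s₀).exists_W_bot
  obtain ⟨b, hb⟩ := (𝒱.isMHS s₀).exists_F_bot
  have hdom := (𝒱.isOpen_dom s₀).mem_nhds (𝒱.mem_dom s₀)
  obtain ⟨h, hs, h1, hh⟩ := exists_movingFrame (E := E) (c := starConj (𝒱.rank s₀))
    (starConj_starConj _)
    (W := fun k => ((𝒱.W s₀ k).baseChange ℂ).map (𝒱.chartC s₀ s₀))
    (F := fun s p => (𝒱.F s p).map (𝒱.chartC s₀ s))
    (I := fun s i => (𝒱.bigr s i).map (𝒱.chartC s₀ s)) (s₀ := s₀)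
    (by
      filter_upwards [𝒱.eventually_W s₀, hdom] with s hs hd
      have := (𝒱.isBigrading s).map (𝒱.coordEquiv hd) (fun x => 𝒱.chartC_conj s₀ s x)
      simp only [RationalLocalSystem.coordEquiv_toLinearMap, hs] at this
      exact this)
    (𝒱.isSmoothFamily_F s₀) (a := a) (b := b) (by simp [ha]) (by simp [hb])
  have hu := hs.eventually_isUnit (by rw [h1]; exact isUnit_one)
  obtain ⟨N, hN, hNo, hNs⟩ := eventually_nhds_iff.1
    (((hs.and hu).and hh).and ((𝒱.eventually_W s₀).and hdom))
  refine ⟨⟨N, hNo, hNs, fun s hs => (hN s hs).2.2, h, hs, fun s hs => (hN s hs).1.1.1, h1,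
    fun s hs => (hN s hs).1.1.2, fun s hs Z => ?_, fun s hs => (hN s hs).2.1⟩⟩
  rw [map_sumOver, map_sumOver, map_sumOver]
  exact congrArg (fun I => sumOver I Z) (funext (hN s hs).1.2)

variable {𝒱} {s₀ : S}

namespace LocalFrame

variable (φ : 𝒱.LocalFrame s₀)

theorem isSmoothOn_secOf {f : S → Fin (𝒱.rank s₀) → ℂ} {N : Set S} (hN : IsOpen N)
    (hNd : N ⊆ 𝒱.dom s₀)
    (hf : ∀ s ∈ N, ContMDiffAt 𝓘(ℝ, E) 𝓘(ℝ, Fin (𝒱.rank s₀) → ℂ) ∞ f s) :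
    𝒱.IsSmoothOn E (𝒱.secOf s₀ f) N := by
  intro s hs
  refine 𝒱.contMDiffAt_chartC (hNd hs) (𝒱.mem_dom s) ((hf s hs).congr_of_eventuallyEq ?_)
  filter_upwards [hN.mem_nhds hs] with s' hs'
  exact 𝒱.chartC_secOf f (hNd hs')

theorem exists_section (v : 𝒱.fiberC s₀) : ∃ σ : 𝒱.Sec, 𝒱.IsSmoothOn E σ φ.nhd ∧ σ s₀ = v ∧
    ∀ Z, v ∈ sumOver (𝒱.bigr s₀) Z → ∀ s ∈ φ.nhd, σ s ∈ sumOver (𝒱.bigr s) Z := by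
  refine ⟨𝒱.secOf s₀ fun s => φ.toFun s (𝒱.chartC s₀ s₀ v),
    isSmoothOn_secOf φ.isOpen_nhd φ.nhd_subset fun s hs => ?_, ?_, fun Z hv s hs => ?_⟩
  · have hB : ContDiff ℂ ∞ fun A : (Fin (𝒱.rank s₀) → ℂ) →L[ℂ] (Fin (𝒱.rank s₀) → ℂ) =>
        A (𝒱.chartC s₀ s₀ v) :=
      (ContinuousLinearMap.apply ℂ (Fin (𝒱.rank s₀) → ℂ) (𝒱.chartC s₀ s₀ v)).contDiff
    exact (hB.restrict_scalars ℝ).comp_contMDiffAt (φ.contMDiffAt s hs)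
  · refine (𝒱.bijective_chartC (𝒱.mem_dom s₀)).1 ?_
    rw [𝒱.chartC_secOf _ (𝒱.mem_dom s₀), φ.map_self]
    rfl
  · rw [← 𝒱.chartC_mem_map (φ.nhd_subset hs), 𝒱.chartC_secOf _ (φ.nhd_subset hs), φ.map_eq s hs]
    exact Submodule.mem_map_of_mem (Submodule.mem_map_of_mem hv)

/-- The connection form at `s₀` of the Gauss–Manin connection relative to a local frame. -/
def connection : E →ₗ[ℝ] Module.End ℂ (𝒱.fiberC s₀) where
  toFun ξ := (𝒱.chartEquiv s₀).symm.toLinearMap ∘ₗ (tderiv φ.toFun s₀ ξ).toLinearMap ∘ₗ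
    (𝒱.chartEquiv s₀).toLinearMap
  map_add' ξ η := by
    refine LinearMap.ext fun x => ?_
    simp
  map_smul' r ξ := by
    refine LinearMap.ext fun x => ?_
    rw [map_smul]
    change (𝒱.chartEquiv s₀).symm (r • tderiv φ.toFun s₀ ξ (𝒱.chartEquiv s₀ x)) =
      r • (𝒱.chartEquiv s₀).symm (tderiv φ.toFun s₀ ξ (𝒱.chartEquiv s₀ x))
    rw [← Complex.coe_smul, map_smul]
    rfl

theorem chartC_connection (ξ : E) (x : 𝒱.fiberC s₀) :
    𝒱.chartC s₀ s₀ (φ.connection ξ x) = tderiv φ.toFun s₀ ξ (𝒱.chartC s₀ s₀ x) :=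
  (𝒱.chartEquiv s₀).apply_symm_apply _

/-- In coordinates `σ = h f`, where `f` takes values in a fixed subspace, that of the fibre at `s₀`.
Since `h s₀ = 1`, the product rule gives `∇σ = h' σ + f'`, and `f'` stays in that subspace. -/
theorem nabla_sub_mem {σ : 𝒱.Sec}
    (h : ContMDiffAt 𝓘(ℝ, E) 𝓘(ℝ, Fin (𝒱.rank s₀) → ℂ) ∞ (fun s' => 𝒱.chartC s₀ s' (σ s')) s₀)
    {Z : Set (ℤ × ℤ)} (hσ : ∀ᶠ s in 𝓝 s₀, σ s ∈ sumOver (𝒱.bigr s) Z) (ξ : E) :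
    𝒱.nabla σ s₀ ξ - φ.connection ξ (σ s₀) ∈ sumOver (𝒱.bigr s₀) Z := by
  rw [← 𝒱.chartC_mem_map (𝒱.mem_dom s₀), map_sub, 𝒱.chartC_nabla (𝒱.mem_dom s₀) h,
    φ.chartC_connection]
  have hnhd := φ.isOpen_nhd.mem_nhds φ.mem_nhd
  have hinv := (φ.smooth.inverse (by filter_upwards [hnhd] with s hs using φ.isUnit s hs))
  set f : S → Fin (𝒱.rank s₀) → ℂ :=
    fun s => Ring.inverse (φ.toFun s) (𝒱.chartC s₀ s (σ s)) with hfdef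
  have hf : ContMDiffAt 𝓘(ℝ, E) 𝓘(ℝ, Fin (𝒱.rank s₀) → ℂ) ∞ f s₀ := by
    have hB : ContDiff ℂ ∞ fun p : ((Fin (𝒱.rank s₀) → ℂ) →L[ℂ] (Fin (𝒱.rank s₀) → ℂ)) ×
        (Fin (𝒱.rank s₀) → ℂ) => p.1 p.2 := isBoundedBilinearMap_apply.contDiff
    exact (hB.restrict_scalars ℝ).comp_contMDiffAt (hinv.self_of_nhds.prodMk_space h)
  have heq : (fun s' => 𝒱.chartC s₀ s' (σ s')) =ᶠ[𝓝 s₀] fun s => φ.toFun s (f s) := by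
    filter_upwards [hnhd] with s hs
    exact (apply_inverse_apply (φ.isUnit s hs) _).symm
  have hfs : f s₀ = 𝒱.chartC s₀ s₀ (σ s₀) := by
    simp [hfdef, φ.map_self]
  rw [tderiv_congr heq, tderiv_clm_apply φ.smooth.self_of_nhds hf, φ.map_self, hfs,
    add_sub_cancel_left]
  refine tderiv_mem hf ?_ ξ
  filter_upwards [hσ, hnhd] with s hs hsN
  have h1 := Submodule.mem_map_of_mem (f := 𝒱.chartC s₀ s) hs
  rw [φ.map_eq s hsN] at h1
  obtain ⟨y, hy, hyx⟩ := h1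
  rw [hfdef]
  simp only
  rw [← hyx]
  simp only [ContinuousLinearMap.coe_coe]
  rwa [inverse_apply_apply (φ.isUnit s hsN)]

end LocalFrame

end VGPMHS

/-! ### Block components and the eigenspaces of `ad Y` -/

section Components

variable {X : Type*} [AddCommGroup X] [Module ℂ X] {I : ℤ × ℤ → Submodule ℂ X}

theorem mem_sumOver_univ (h : DirectSum.IsInternal I) (x : X) : x ∈ sumOver I Set.univ := by
  have : sumOver I Set.univ = ⊤ := by
    rw [← h.submodule_iSup_eq_top]
    simp [sumOver]
  rw [this]
  exact Submodule.mem_top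

theorem isCompl_sumOver (h : DirectSum.IsInternal I) (Z : Set (ℤ × ℤ)) :
    IsCompl (sumOver I Z) (sumOver I Zᶜ) := by
  refine ⟨sumOver_disjoint h.submodule_iSupIndep disjoint_compl_right, ?_⟩
  rw [codisjoint_iff, ← sumOver_union, Set.union_compl_self, ← h.submodule_iSup_eq_top]
  simp [sumOver]

/-- The projection to the sum of the `I^{r,s}` with `(r,s) ∈ Z`. -/
def component (h : DirectSum.IsInternal I) (Z : Set (ℤ × ℤ)) : Module.End ℂ X :=
  Submodule.projection _ _ (isCompl_sumOver h Z)

theorem component_of_mem (h : DirectSum.IsInternal I) {Z : Set (ℤ × ℤ)} {x : X}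
    (hx : x ∈ sumOver I Z) : component h Z x = x :=
  Submodule.projection_apply_of_mem_left _ hx

theorem component_of_mem_compl (h : DirectSum.IsInternal I) {Z : Set (ℤ × ℤ)} {x : X}
    (hx : x ∈ sumOver I Zᶜ) : component h Z x = 0 :=
  (Submodule.projection_apply_eq_zero_iff _).2 hx

theorem component_mem_and_sub_mem (h : DirectSum.IsInternal I) (Z : Set (ℤ × ℤ))
    {Y : Set (ℤ × ℤ)} {x : X} (hx : x ∈ sumOver I Y) :
    component h Z x ∈ sumOver I (Y ∩ Z) ∧ x - component h Z x ∈ sumOver I (Y \ Z) := by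
  rw [← Set.inter_union_sdiff Y Z, sumOver_union] at hx
  obtain ⟨u, hu, v, hv, rfl⟩ := Submodule.mem_sup.1 hx
  have h1 : component h Z (u + v) = u := by
    rw [map_add, component_of_mem h (sumOver_mono Set.inter_subset_right hu),
      component_of_mem_compl h (sumOver_mono (fun i hi => hi.2) hv), add_zero]
  rw [h1]
  exact ⟨hu, by rwa [add_sub_cancel_left]⟩

theorem linearMap_ext_of_isInternal (h : DirectSum.IsInternal I) {f g : Module.End ℂ X}
    (hfg : ∀ i, ∀ x ∈ I i, f x = g x) : f = g := by
  have h1 : (⊤ : Submodule ℂ X) ≤ LinearMap.eqLocus f g := by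
    rw [← h.submodule_iSup_eq_top]
    exact iSup_le fun i x hx => hfg i x hx
  exact LinearMap.ext fun x => h1 Submodule.mem_top

open Classical in
/-- The endomorphism that agrees with `f i` on `I i`. -/
def glue (h : DirectSum.IsInternal I) (f : ℤ × ℤ → Module.End ℂ X) : Module.End ℂ X :=
  (DirectSum.toModule ℂ (ℤ × ℤ) X fun i => f i ∘ₗ (I i).subtype) ∘ₗ
    (LinearEquiv.ofBijective (DirectSum.coeLinearMap I) h).symm.toLinearMap

theorem glue_apply (h : DirectSum.IsInternal I) (f : ℤ × ℤ → Module.End ℂ X) {i : ℤ × ℤ} {x : X}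
    (hx : x ∈ I i) : glue h f x = f i x := by
  classical
  have h1 : (LinearEquiv.ofBijective (DirectSum.coeLinearMap I) h).symm x =
      DirectSum.lof ℂ (ℤ × ℤ) (fun i => I i) i ⟨x, hx⟩ := by
    refine (LinearEquiv.symm_apply_eq _).2 ?_
    exact (DirectSum.coeLinearMap_lof I i ⟨x, hx⟩).symm
  rw [glue, LinearMap.comp_apply, LinearEquiv.coe_coe, h1, DirectSum.toModule_lof]
  rfl

theorem map_mem_of_forall {A : Set (ℤ × ℤ)} {P : Submodule ℂ X} {f : Module.End ℂ X}
    (h : ∀ i ∈ A, ∀ x ∈ I i, f x ∈ P) {x : X} (hx : x ∈ sumOver I A) : f x ∈ P := by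
  have : sumOver I A ≤ P.comap f := sumOver_le fun i hi x hx => h i hi x hx
  exact this hx

/-- The endomorphism that acts on `I^{p,q}` as multiplication by `p + q`. -/
def weightEnd (h : DirectSum.IsInternal I) : Module.End ℂ X :=
  glue h fun i => ((i.1 + i.2 : ℤ) : ℂ) • LinearMap.id

theorem weightEnd_apply (h : DirectSum.IsInternal I) {k : ℤ} {x : X}
    (hx : x ∈ sumOver I {i | i.1 + i.2 = k}) : weightEnd h x = (k : ℂ) • x := by
  have : sumOver I {i | i.1 + i.2 = k} ≤
      LinearMap.eqLocus (weightEnd h) ((k : ℂ) • LinearMap.id) := by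
    refine sumOver_le fun i hi x hx => ?_
    have hi' : i.1 + i.2 = k := hi
    rw [LinearMap.mem_eqLocus, weightEnd, glue_apply h _ hx, hi']
  exact this hx

theorem mem_eigenspace_ad {Y f : Module.End ℂ X} {μ : ℂ} :
    f ∈ Module.End.eigenspace (ad Y) μ ↔ Y * f - f * Y = μ • f := by
  rw [Module.End.mem_eigenspace_iff, ad]
  rfl

theorem mem_eigenspace_ad_weightEnd (h : DirectSum.IsInternal I) {f : Module.End ℂ X} {d : ℤ}
    (hf : ∀ i, ∀ x ∈ I i, f x ∈ sumOver I {j | j.1 + j.2 = i.1 + i.2 + d}) :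
    f ∈ Module.End.eigenspace (ad (weightEnd h)) (d : ℂ) := by
  rw [mem_eigenspace_ad]
  refine linearMap_ext_of_isInternal h fun i x hx => ?_
  have h1 := weightEnd_apply h (hf i x hx)
  have h2 := weightEnd_apply h (le_sumOver (I := I) (A := {j | j.1 + j.2 = i.1 + i.2}) rfl hx)
  rw [LinearMap.sub_apply, Module.End.mul_apply, Module.End.mul_apply, h1, h2, map_smul,
    ← sub_smul, LinearMap.smul_apply]
  push_cast
  ring_nf

theorem eq_sum_component (h : DirectSum.IsInternal I) {t : Finset (ℤ × ℤ)}
    (ht : ∀ i ∉ t, I i = ⊥) : ∑ i ∈ t, component h {i} = 1 := by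
  refine linearMap_ext_of_isInternal h fun i x hx => ?_
  rw [LinearMap.sum_apply, Module.End.one_apply]
  by_cases hi : i ∈ t
  · rw [Finset.sum_eq_single_of_mem i hi]
    · exact component_of_mem h (le_sumOver (Set.mem_singleton i) hx)
    · intro j _ hj
      exact component_of_mem_compl h (le_sumOver (A := {j}ᶜ) (fun he => hj he.symm) hx)
  · rw [ht i hi, Submodule.mem_bot] at hx
    simp [hx]

variable [FiniteDimensional ℂ X]

/-- The block of `f` from `I i` to `I j` is an eigenvector of `ad Y` whose eigenvalue is the
difference of weights; only finitely many blocks exist, and those of weight zero vanish here. -/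
theorem mem_iSup_eigenspace_ad (h : DirectSum.IsInternal I) {f : Module.End ℂ X}
    (hf : ∀ i, ∀ x ∈ I i, f x ∈ sumOver I {j | j.1 + j.2 ≠ i.1 + i.2}) :
    f ∈ ⨆ (μ : ℂ) (_ : μ ≠ 0), Module.End.eigenspace (ad (weightEnd h)) μ := by
  have hfin := WellFoundedGT.finite_ne_bot_of_iSupIndep h.submodule_iSupIndep
  set t := hfin.toFinset with ht
  have htb : ∀ i ∉ t, I i = ⊥ := fun i hi => by
    by_contra hne
    exact hi (hfin.mem_toFinset.2 hne)
  have hsum : f = ∑ i ∈ t, ∑ j ∈ t, component h {j} * f * component h {i} := by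
    simp only [← Finset.mul_sum, ← Finset.sum_mul, eq_sum_component h htb, one_mul, mul_one]
  rw [hsum]
  refine Submodule.sum_mem _ fun i _ => Submodule.sum_mem _ fun j _ => ?_
  by_cases hij : j.1 + j.2 = i.1 + i.2
  · have : component h {j} * f * component h {i} = 0 := by
      refine linearMap_ext_of_isInternal h fun k x hx => ?_
      simp only [Module.End.mul_apply, LinearMap.zero_apply]
      by_cases hki : k = i
      · subst hki
        rw [component_of_mem h (le_sumOver (Set.mem_singleton k) hx)]
        refine component_of_mem_compl h (sumOver_mono ?_ (hf k x hx))
        rintro l hl hlj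
        rw [Set.mem_singleton_iff.1 hlj] at hl
        exact hl hij
      · rw [component_of_mem_compl h (le_sumOver (A := {i}ᶜ) hki hx), map_zero, map_zero]
    rw [this]
    exact Submodule.zero_mem _
  · have hmem : component h {j} * f * component h {i} ∈
        Module.End.eigenspace (ad (weightEnd h)) ((j.1 + j.2 - (i.1 + i.2) : ℤ) : ℂ) := by
      refine mem_eigenspace_ad_weightEnd h fun k x hx => ?_
      simp only [Module.End.mul_apply]
      by_cases hki : k = i
      · subst hki
        refine sumOver_mono ?_ (component_mem_and_sub_mem h {j} (mem_sumOver_univ h (f _))).1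
        rintro l ⟨-, hl⟩
        rw [Set.mem_singleton_iff.1 hl]
        simp
      · rw [component_of_mem_compl h (le_sumOver (A := {i}ᶜ) hki hx), map_zero, map_zero]
        exact Submodule.zero_mem _
    exact le_iSup₂_of_le (f := fun (μ : ℂ) (_ : μ ≠ 0) =>
      Module.End.eigenspace (ad (weightEnd h)) μ) _
      (by exact_mod_cast sub_ne_zero.2 hij) le_rfl hmem

theorem adWeightZero_eq (h : DirectSum.IsInternal I) {f g : Module.End ℂ X}
    (hg : ∀ i, ∀ x ∈ I i, g x ∈ sumOver I {j | j.1 + j.2 = i.1 + i.2})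
    (hfg : ∀ i, ∀ x ∈ I i, f x - g x ∈ sumOver I {j | j.1 + j.2 ≠ i.1 + i.2}) :
    adWeightZero (weightEnd h) f = g := by
  have key : ∀ f g : Module.End ℂ X,
      (∀ i, ∀ x ∈ I i, g x ∈ sumOver I {j | j.1 + j.2 = i.1 + i.2}) →
      (∀ i, ∀ x ∈ I i, f x - g x ∈ sumOver I {j | j.1 + j.2 ≠ i.1 + i.2}) →
      g ∈ Module.End.eigenspace (ad (weightEnd h)) (0 : ℂ) ∧
      f - g ∈ ⨆ (μ : ℂ) (_ : μ ≠ 0), Module.End.eigenspace (ad (weightEnd h)) μ := by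
    intro f g hg hfg
    refine ⟨?_, mem_iSup_eigenspace_ad h hfg⟩
    have := mem_eigenspace_ad_weightEnd h (f := g) (d := 0) (by simpa using hg)
    simpa using this
  -- The complementarity that `adWeightZero` tests for; without it the value would be the default
  -- `0`.
  have hcompl : IsCompl (Module.End.eigenspace (ad (weightEnd h)) (0 : ℂ))
      (⨆ (μ : ℂ) (_ : μ ≠ 0), Module.End.eigenspace (ad (weightEnd h)) μ) := by
    refine ⟨Module.End.eigenspaces_iSupIndep (ad (weightEnd h)) 0, ?_⟩
    rw [codisjoint_iff, eq_top_iff]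
    rintro f -
    have := key f (glue h fun i => component h {j | j.1 + j.2 = i.1 + i.2} * f)
      (fun i x hx => by
        rw [glue_apply h _ hx]
        exact sumOver_mono Set.inter_subset_right
          (component_mem_and_sub_mem h _ (mem_sumOver_univ h (f x))).1)
      (fun i x hx => by
        rw [glue_apply h _ hx]
        exact sumOver_mono (fun j hj => hj.2)
          (component_mem_and_sub_mem h _ (mem_sumOver_univ h (f x))).2)
    rw [← add_sub_cancel (glue h fun i => component h {j | j.1 + j.2 = i.1 + i.2} * f) f]
    exact Submodule.add_mem_sup this.1 this.2
  obtain ⟨h1, h2⟩ := key f g hg hfg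
  rw [adWeightZero, dif_pos hcompl]
  conv_lhs => rw [← add_sub_cancel g f]
  rw [map_add, Submodule.projection_apply_of_mem_left _ h1,
    (Submodule.projection_apply_eq_zero_iff _).2 h2, add_zero]

end Components

section GradingOf

variable {V : Type*} [AddCommGroup V] [Module ℚ V]

theorem gradingOf_eq_weightEnd {I : ℤ → ℤ → Submodule ℂ (Cx V)}
    (h : DirectSum.IsInternal fun i : ℤ × ℤ => I i.1 i.2) : gradingOf I = weightEnd h := by
  rw [gradingOf, dif_pos h, weightEnd, glue]
  congr 2

end GradingOf

/-! ### Linear algebra of the connection form -/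

section ConnectionPair

variable {X : Type*} [AddCommGroup X] [Module ℂ X]

/-- The conjugate of an endomorphism. -/
def conjOf (c : X →ₛₗ[starRingEnd ℂ] X) (f : Module.End ℂ X) : Module.End ℂ X :=
  c.comp (f.comp c)

/-- The linear-algebraic properties of the `(0,1)`-part `a` and the `(1,0)`-part `b` of a
connection form with respect to a bigrading. -/
structure IsConnectionPair (c : X →ₛₗ[starRingEnd ℂ] X) (W F : ℤ → Submodule ℂ X)
    (I : ℤ × ℤ → Submodule ℂ X) (a b : Module.End ℂ X) : Prop where
  a_sub : ∀ p q, ∀ x ∈ sumOver I (insert (p, q) (below p q)),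
    a x - conjOf c b x ∈ sumOver I (insert (p, q) (below p q))
  b_sub : ∀ p q, ∀ x ∈ sumOver I (insert (p, q) (below p q)),
    b x - conjOf c a x ∈ sumOver I (insert (p, q) (below p q))
  a_F : ∀ p, ∀ x ∈ F p, a x ∈ F p
  b_F : ∀ p, ∀ x ∈ F p, b x ∈ F (p - 1)
  a_W : ∀ k, ∀ x ∈ W k, a x ∈ W k
  b_W : ∀ k, ∀ x ∈ W k, b x ∈ W k

variable {c : X →ₛₗ[starRingEnd ℂ] X} {W F : ℤ → Submodule ℂ X} {I : ℤ × ℤ → Submodule ℂ X}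
  {a b : Module.End ℂ X}

theorem conjOf_apply (f : Module.End ℂ X) (x : X) : conjOf c f x = c (f (c x)) := rfl

/-- Together with `map_F_inf_W_le'` this describes `⨁_{r ≤ p} I^{r,s}` through `conj F` and `W`
alone, so conjugates of maps that respect `F` and `W` can be tested on it. Induction on the weight:
by `eq_inf`, `I^{r,s}` lies in `conj F^s ∩ W_{r+s}` up to pieces of lower weight. -/
theorem IsBigrading.sumOver_le_iSup (h : IsBigrading c W F I) (hc : ∀ x, c (c x) = x) {k₀ : ℤ}
    (hk₀ : W k₀ = ⊥) (p : ℤ) :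
    sumOver I {i | i.1 ≤ p} ≤ ⨆ k, (F (k - p)).map c ⊓ W k := by
  have hmono : ∀ p q, p ≤ q →
      (⨆ k, (F (k - p)).map c ⊓ W k) ≤ ⨆ k, (F (k - q)).map c ⊓ W k := fun p q hpq =>
    iSup_mono fun k => inf_le_inf_right _ (Submodule.map_mono (h.F_antitone (by omega)))
  have key : ∀ n : ℕ, ∀ r s, r + s ≤ k₀ + n → I (r, s) ≤ ⨆ k, (F (k - r)).map c ⊓ W k := by
    intro n
    induction n with
    | zero =>
      intro r s hrs
      have h1 : I (r, s) ≤ W k₀ := by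
        rw [h.W_eq]
        exact le_sumOver (by simpa using hrs)
      rw [hk₀] at h1
      exact h1.trans bot_le
    | succ n ih =>
      intro r s hrs
      have hΛ : sumOver I (below r s) ≤ W (r + s) := h.sumOver_below_le_W (by omega)
      have h1 : I (r, s) ≤ W (r + s) ⊓ ((F s).map c ⊔ sumOver I (below r s)) := by
        rw [h.eq_inf hc]
        exact inf_le_right
      rw [inf_comm, sup_comm, sup_inf_assoc_of_le _ hΛ] at h1
      refine h1.trans (sup_le (sumOver_le ?_) ?_)
      · rintro ⟨r', s'⟩ ⟨hr, hs⟩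
        exact (ih r' s' (by push_cast at hrs; simp only at hr hs; omega)).trans
          (hmono _ _ (by simp only at hr; omega))
      · refine le_iSup_of_le (r + s) (inf_le_inf_right _ ?_)
        rw [add_sub_cancel_left]
  refine sumOver_le ?_
  rintro ⟨r, s⟩ hr
  exact (key (r + s - k₀).toNat r s (by omega)).trans (hmono _ _ hr)

theorem IsBigrading.map_F_inf_W_le' (h : IsBigrading c W F I) (hc : ∀ x, c (c x) = x) {p k q : ℤ}
    (hq : k - p ≤ q) : (F q).map c ⊓ W k ≤ sumOver I {i | i.1 ≤ p} := by
  have h1 := h.map_F_inf_W_le hc p (k - p)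
  rw [add_sub_cancel] at h1
  refine (inf_le_inf_right _ (Submodule.map_mono (h.F_antitone hq))).trans
    (h1.trans (sumOver_mono ?_))
  rintro ⟨r, s⟩ hrs
  simp only [Set.mem_insert_iff, Prod.mk.injEq, Set.mem_ofPred_eq] at *
  omega

theorem IsBigrading.conjOf_mem (h : IsBigrading c W F I) (hc : ∀ x, c (c x) = x)
    {f : Module.End ℂ X} {d : ℤ} (hF : ∀ p, ∀ x ∈ F p, f x ∈ F (p - d))
    (hW : ∀ k, ∀ x ∈ W k, f x ∈ W k) {q k : ℤ}
    {x : X} (hx : x ∈ (F q).map c ⊓ W k) : conjOf c f x ∈ (F (q - d)).map c ⊓ W k := by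
  refine ⟨(mem_map_conj hc).2 ?_, ?_⟩
  · rw [conjOf_apply, hc]
    exact hF _ _ ((mem_map_conj hc).1 hx.1)
  · exact h.map_W_le _ (Submodule.mem_map_of_mem (hW _ _
      (h.map_W_le _ (Submodule.mem_map_of_mem hx.2))))

/-- If `f` maps `I^{p,q}` to `I^{p+d,q-d}` up to lower weight, then `conj f` maps `I^{p,q}` to
`I^{p-d,q+d}` up to lower weight. -/
theorem IsBigrading.conjOf_mem_insert (h : IsBigrading c W F I)
    {f : Module.End ℂ X} {d : ℤ} (hf : ∀ p q, ∀ x ∈ I (p, q),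
    f x ∈ sumOver I (insert (p + d, q - d) {i | i.1 + i.2 < p + q})) {p q : ℤ} {x : X}
    (hx : x ∈ I (p, q)) :
    conjOf c f x ∈ sumOver I (insert (p - d, q + d) {i | i.1 + i.2 < p + q}) := by
  have h1 : c x ∈ sumOver I (insert (q, p) (below q p)) :=
    h.conj_le q p (Submodule.mem_map_of_mem hx)
  have h2 : f (c x) ∈ sumOver I (insert (q + d, p - d) {i | i.1 + i.2 < p + q}) := by
    refine map_mem_of_forall (fun i hi y hy => ?_) h1
    refine sumOver_mono ?_ (hf i.1 i.2 y hy)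
    rintro ⟨r, s⟩ hrs
    obtain ⟨i1, i2⟩ := i
    simp only [below, Set.mem_insert_iff, Prod.mk.injEq, Set.mem_ofPred_eq] at *
    omega
  refine h.map_le (A := insert (q + d, p - d) {i | i.1 + i.2 < p + q}) (fun r s hrs => ?_)
    (Submodule.mem_map_of_mem h2)
  rintro ⟨r', s'⟩ hrs'
  simp only [below, Set.mem_insert_iff, Prod.mk.injEq, Set.mem_ofPred_eq] at *
  omega

namespace IsConnectionPair

theorem sub_mem_of_forall {f : Module.End ℂ X} (hf : ∀ p q,
    ∀ x ∈ sumOver I (insert (p, q) (below p q)), f x ∈ sumOver I (insert (p, q) (below p q)))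
    {p : ℤ} {x : X} (hx : x ∈ sumOver I {i | i.1 ≤ p}) : f x ∈ sumOver I {i | i.1 ≤ p} := by
  refine map_mem_of_forall (fun i hi x hx => ?_) hx
  refine sumOver_mono ?_ (hf i.1 i.2 x (le_sumOver (Set.mem_insert _ _) hx))
  rintro ⟨r, s⟩ hrs
  simp only [below, Set.mem_insert_iff, Prod.ext_iff, Set.mem_ofPred_eq] at *
  omega

/-- If `f` shifts `F` by `d` then `conj f` shifts the filtration `⨁_{r ≤ p} I^{r,s}` by `d`. -/
theorem conjOf_mem_of_mem (h : IsBigrading c W F I) (hc : ∀ x, c (c x) = x) {k₀ : ℤ}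
    (hk₀ : W k₀ = ⊥) {f : Module.End ℂ X} {d : ℤ}
    (hF : ∀ p, ∀ x ∈ F p, f x ∈ F (p - d)) (hW : ∀ k, ∀ x ∈ W k, f x ∈ W k) {p : ℤ} {x : X}
    (hx : x ∈ sumOver I {i | i.1 ≤ p}) : conjOf c f x ∈ sumOver I {i | i.1 ≤ p + d} := by
  have h1 : (⨆ k, (F (k - p)).map c ⊓ W k) ≤
      (sumOver I {i | i.1 ≤ p + d}).comap (conjOf c f) := by
    refine iSup_le fun k x hx => ?_
    have := h.conjOf_mem hc hF hW hx
    exact h.map_F_inf_W_le' hc (by omega) this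
  exact h1 (h.sumOver_le_iSup hc hk₀ p hx)

/-- Write `b = (b - conj a) + conj a`. The first term respects conjugation-stable sums, and `conj a`
preserves the filtration because `a` preserves `F`. -/
theorem b_mem_of_mem (hp : IsConnectionPair c W F I a b) (h : IsBigrading c W F I)
    (hc : ∀ x, c (c x) = x) {k₀ : ℤ} (hk₀ : W k₀ = ⊥) {p : ℤ} {x : X}
    (hx : x ∈ sumOver I {i | i.1 ≤ p}) :
    b x ∈ sumOver I {i | i.1 ≤ p} := by
  have h1 := sub_mem_of_forall (f := b - conjOf c a) hp.b_sub hx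
  have h2 := conjOf_mem_of_mem h hc hk₀ (f := a) (d := 0) (by simpa using hp.a_F) hp.a_W hx
  rw [add_zero] at h2
  simpa using Submodule.add_mem _ h1 h2

theorem b_mem (hp : IsConnectionPair c W F I a b) (h : IsBigrading c W F I)
    (hc : ∀ x, c (c x) = x) {k₀ : ℤ} (hk₀ : W k₀ = ⊥) {p q : ℤ} {x : X} (hx : x ∈ I (p, q)) :
    b x ∈ sumOver I {i | p - 1 ≤ i.1 ∧ i.1 ≤ p ∧ i.1 + i.2 ≤ p + q} := by
  have h1 := hp.b_mem_of_mem h hc hk₀ (le_sumOver (A := {i | i.1 ≤ p}) (i := (p, q)) (by simp) hx)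
  have h2 : x ∈ F p := by
    rw [h.F_eq]
    exact le_sumOver (A := {i | p ≤ i.1}) (i := (p, q)) (by simp) hx
  have h3 : x ∈ W (p + q) := by
    rw [h.W_eq]
    exact le_sumOver (A := {i | i.1 + i.2 ≤ p + q}) (i := (p, q)) (by simp) hx
  have h4 := hp.b_F p x h2
  have h5 := hp.b_W _ x h3
  rw [h.F_eq] at h4
  rw [h.W_eq] at h5
  have h6 : b x ∈ sumOver I {i | p - 1 ≤ i.1} ⊓ (sumOver I {i | i.1 ≤ p} ⊓
    sumOver I {i | i.1 + i.2 ≤ p + q}) := ⟨h4, h1, h5⟩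
  rw [sumOver_inter h.indep, sumOver_inter h.indep] at h6
  exact h6

theorem a_mem (hp : IsConnectionPair c W F I a b) (h : IsBigrading c W F I)
    (hc : ∀ x, c (c x) = x) {k₀ : ℤ} (hk₀ : W k₀ = ⊥) {p q : ℤ} {x : X} (hx : x ∈ I (p, q)) :
    a x ∈ sumOver I (insert (p + 1, q - 1) {i | i.1 = p ∧ i.1 + i.2 ≤ p + q}) := by
  have h2 : x ∈ F p := by
    rw [h.F_eq]
    exact le_sumOver (A := {i | p ≤ i.1}) (i := (p, q)) (by simp) hx
  have h3 : x ∈ W (p + q) := by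
    rw [h.W_eq]
    exact le_sumOver (A := {i | i.1 + i.2 ≤ p + q}) (i := (p, q)) (by simp) hx
  have h4 := hp.a_F p x h2
  have h5 := hp.a_W _ x h3
  rw [h.F_eq] at h4
  rw [h.W_eq] at h5
  have h1 : a x ∈ sumOver I (insert (p + 1, q - 1) {i | i.1 ≤ p}) := by
    have e1 : a x - conjOf c b x ∈ sumOver I (insert (p + 1, q - 1) {i | i.1 ≤ p}) := by
      refine sumOver_mono ?_ (sub_mem_of_forall (f := a - conjOf c b) hp.a_sub
        (le_sumOver (A := {i | i.1 ≤ p}) (i := (p, q)) (by simp) hx))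
      exact Set.subset_insert _ _
    -- Split `x` into lower pieces, with `r ≤ p - 1`, and an element of `conj F^q ∩ W_{p+q}`. The
    -- map `conj b` sends the first to `r ≤ p` and the second to `conj F^{q-1} ∩ W_{p+q}`, where `(p
    -- + 1, q - 1)` is the only index with `r > p`.
    have e2 : conjOf c b x ∈ sumOver I (insert (p + 1, q - 1) {i | i.1 ≤ p}) := by
      have hΛ : sumOver I (below p q) ≤ W (p + q) := h.sumOver_below_le_W (by omega)
      have e3 : x ∈ W (p + q) ⊓ ((F q).map c ⊔ sumOver I (below p q)) := by
        rw [h.eq_inf hc] at hx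
        exact hx.2
      rw [inf_comm, sup_comm, sup_inf_assoc_of_le _ hΛ] at e3
      obtain ⟨l, hl, z, hz, rfl⟩ := Submodule.mem_sup.1 e3
      rw [map_add]
      refine Submodule.add_mem _ ?_ ?_
      · have hl' : l ∈ sumOver I {i | i.1 ≤ p - 1} := sumOver_mono (fun i hi => by
          have := hi.1
          simp only [Set.mem_ofPred_eq]
          omega) hl
        have := conjOf_mem_of_mem h hc hk₀ hp.b_F hp.b_W hl'
        rw [sub_add_cancel] at this
        exact sumOver_mono (Set.subset_insert _ _) this
      · have h6 := h.conjOf_mem hc hp.b_F hp.b_W hz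
        have h7 := h.map_F_inf_W_le hc (p + 1) (q - 1)
        rw [add_add_sub_cancel] at h7
        refine sumOver_mono ?_ (h7 h6)
        rintro ⟨r, s⟩ hrs
        simp only [Set.mem_insert_iff, Prod.mk.injEq, Set.mem_ofPred_eq] at *
        omega
    simpa using Submodule.add_mem _ e1 e2
  have h6 : a x ∈ sumOver I {i | p ≤ i.1} ⊓ (sumOver I (insert (p + 1, q - 1) {i | i.1 ≤ p}) ⊓
    sumOver I {i | i.1 + i.2 ≤ p + q}) := ⟨h4, h1, h5⟩
  rw [sumOver_inter h.indep, sumOver_inter h.indep] at h6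
  refine sumOver_mono ?_ h6
  rintro ⟨r, s⟩ hrs
  simp only [Set.mem_insert_iff, Prod.mk.injEq, Set.mem_ofPred_eq, Set.mem_inter_iff] at *
  omega

end IsConnectionPair

/-- The part of `f` that maps `⨁_q I^{p,q}` to `⨁_q I^{p+d,q}` for all `p`. -/
def shift (hI : DirectSum.IsInternal I) (d : ℤ) (f : Module.End ℂ X) : Module.End ℂ X :=
  glue hI fun i => component hI {j | j.1 = i.1 + d} * f

theorem shift_apply (hI : DirectSum.IsInternal I) (d : ℤ) (f : Module.End ℂ X) {i : ℤ × ℤ} {x : X}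
    (hx : x ∈ I i) : shift hI d f x = component hI {j | j.1 = i.1 + d} (f x) :=
  glue_apply hI _ hx

theorem shift_add (hI : DirectSum.IsInternal I) (d : ℤ) (f g : Module.End ℂ X) :
    shift hI d (f + g) = shift hI d f + shift hI d g :=
  linearMap_ext_of_isInternal hI fun i x hx => by
    simp only [LinearMap.add_apply, shift_apply hI d _ hx, map_add]

theorem shift_smul (hI : DirectSum.IsInternal I) (d : ℤ) (z : ℂ) (f : Module.End ℂ X) :
    shift hI d (z • f) = z • shift hI d f :=
  linearMap_ext_of_isInternal hI fun i x hx => by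
    simp only [LinearMap.smul_apply, shift_apply hI d _ hx, map_smul]

theorem shift_mem (hI : DirectSum.IsInternal I) (d : ℤ) (f : Module.End ℂ X) {p : ℤ} {x : X}
    (hx : x ∈ sumOver I {i | i.1 = p}) : shift hI d f x ∈ sumOver I {i | i.1 = p + d} := by
  refine map_mem_of_forall (fun i hi x hx => ?_) hx
  have hi' : i.1 = p := hi
  rw [shift_apply hI d f hx, hi']
  exact sumOver_mono Set.inter_subset_right
    (component_mem_and_sub_mem hI _ (mem_sumOver_univ hI (f x))).1

namespace IsConnectionPair

theorem shift_one_mem (hp : IsConnectionPair c W F I a b) (h : IsBigrading c W F I)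
    (hc : ∀ x, c (c x) = x) {k₀ : ℤ} (hk₀ : W k₀ = ⊥) (hI : DirectSum.IsInternal I) {p q : ℤ}
    {x : X} (hx : x ∈ I (p, q)) : shift hI 1 a x ∈ sumOver I {(p + 1, q - 1)} ∧
      a x - shift hI 1 a x ∈ sumOver I {i | i.1 = p ∧ i.1 + i.2 ≤ p + q} := by
  rw [shift_apply hI 1 a hx]
  obtain ⟨h1, h2⟩ := component_mem_and_sub_mem hI {j | j.1 = p + 1} (hp.a_mem h hc hk₀ hx)
  refine ⟨sumOver_mono ?_ h1, sumOver_mono ?_ h2⟩ <;>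
  · rintro ⟨r, s⟩ hrs
    simp only [Set.mem_insert_iff, Prod.mk.injEq, Set.mem_ofPred_eq, Set.mem_inter_iff,
      Set.mem_sdiff, Set.mem_singleton_iff] at *
    omega

theorem shift_neg_one_mem (hp : IsConnectionPair c W F I a b) (h : IsBigrading c W F I)
    (hc : ∀ x, c (c x) = x) {k₀ : ℤ} (hk₀ : W k₀ = ⊥) (hI : DirectSum.IsInternal I) {p q : ℤ}
    {x : X} (hx : x ∈ I (p, q)) :
    shift hI (-1) b x ∈ sumOver I {i | i.1 = p - 1 ∧ i.1 + i.2 ≤ p + q} ∧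
      b x - shift hI (-1) b x ∈ sumOver I {i | i.1 = p ∧ i.1 + i.2 ≤ p + q} := by
  rw [shift_apply hI (-1) b hx]
  obtain ⟨h1, h2⟩ := component_mem_and_sub_mem hI {j | j.1 = p + -1} (hp.b_mem h hc hk₀ hx)
  refine ⟨sumOver_mono ?_ h1, sumOver_mono ?_ h2⟩ <;>
  · rintro ⟨r, s⟩ hrs
    simp only [Set.mem_ofPred_eq, Set.mem_inter_iff, Set.mem_sdiff] at *
    omega

theorem sub_shift_one_mem (hp : IsConnectionPair c W F I a b) (h : IsBigrading c W F I)
    (hc : ∀ x, c (c x) = x) {k₀ : ℤ} (hk₀ : W k₀ = ⊥) (hI : DirectSum.IsInternal I) {p : ℤ}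
    {x : X} (hx : x ∈ sumOver I {i | i.1 = p}) :
    a x - shift hI 1 a x ∈ sumOver I {i | i.1 = p} := by
  refine map_mem_of_forall (f := a - shift hI 1 a) (fun i hi x hx => ?_) hx
  have hi' : i.1 = p := hi
  refine sumOver_mono (fun j hj => ?_) (hp.shift_one_mem h hc hk₀ hI (p := i.1) (q := i.2) hx).2
  exact hj.1.trans hi'

theorem sub_shift_neg_one_mem (hp : IsConnectionPair c W F I a b) (h : IsBigrading c W F I)
    (hc : ∀ x, c (c x) = x) {k₀ : ℤ} (hk₀ : W k₀ = ⊥) (hI : DirectSum.IsInternal I) {p : ℤ}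
    {x : X} (hx : x ∈ sumOver I {i | i.1 = p}) :
    b x - shift hI (-1) b x ∈ sumOver I {i | i.1 = p} := by
  refine map_mem_of_forall (f := b - shift hI (-1) b) (fun i hi x hx => ?_) hx
  have hi' : i.1 = p := hi
  refine sumOver_mono (fun j hj => ?_)
    (hp.shift_neg_one_mem h hc hk₀ hI (p := i.1) (q := i.2) hx).2
  exact hj.1.trans hi'

/-- Modulo lower weight the difference has type `(p + 1, q - 1)`, because `θ` has type `(p - 1, q +
1)` and conjugation reverses the shift. It also has type `(p, q)`, being the difference of terms
that preserve the type: the remainders of `a` and `conj b`, and `a - conj b`. Hence only lower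
weight is left. -/
theorem conjOf_shift_sub_shift_mem (hp : IsConnectionPair c W F I a b) (h : IsBigrading c W F I)
    (hc : ∀ x, c (c x) = x) {k₀ : ℤ} (hk₀ : W k₀ = ⊥) (hI : DirectSum.IsInternal I) {p q : ℤ}
    {x : X} (hx : x ∈ I (p, q)) :
    conjOf c (shift hI (-1) b) x - shift hI 1 a x ∈ sumOver I {i | i.1 + i.2 < p + q} := by
  obtain ⟨h1, h2⟩ := hp.shift_one_mem h hc hk₀ hI hx
  have h3 : conjOf c (shift hI (-1) b) x ∈
      sumOver I (insert (p - -1, q + -1) {i | i.1 + i.2 < p + q}) := by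
    refine h.conjOf_mem_insert (fun p q x hx => ?_) hx
    refine sumOver_mono ?_ (hp.shift_neg_one_mem h hc hk₀ hI hx).1
    rintro ⟨r, s⟩ hrs
    simp only [Set.mem_ofPred_eq, Set.mem_insert_iff, Prod.mk.injEq] at *
    omega
  have h4 : conjOf c (b - shift hI (-1) b) x ∈
      sumOver I (insert (p - 0, q + 0) {i | i.1 + i.2 < p + q}) := by
    refine h.conjOf_mem_insert (fun p q x hx => ?_) hx
    refine sumOver_mono ?_ (hp.shift_neg_one_mem h hc hk₀ hI hx).2
    rintro ⟨r, s⟩ hrs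
    simp only [Set.mem_ofPred_eq, Set.mem_insert_iff, Prod.mk.injEq] at *
    omega
  have h5 := hp.a_sub p q x (le_sumOver (Set.mem_insert _ _) hx)
  have h6 : conjOf c (shift hI (-1) b) x - shift hI 1 a x ∈
      sumOver I (insert (p + 1, q - 1) {i | i.1 + i.2 < p + q}) := by
    refine Submodule.sub_mem _ (sumOver_mono ?_ h3) (sumOver_mono ?_ h1) <;>
    · rintro ⟨r, s⟩ hrs
      simp only [Set.mem_ofPred_eq, Set.mem_insert_iff, Prod.mk.injEq, Set.mem_singleton_iff] at *
      omega
  have h7 : conjOf c (shift hI (-1) b) x - shift hI 1 a x ∈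
      sumOver I (insert (p, q) {i | i.1 + i.2 < p + q}) := by
    have e : conjOf c (shift hI (-1) b) x - shift hI 1 a x =
        (a x - shift hI 1 a x) - (a x - conjOf c b x) - conjOf c (b - shift hI (-1) b) x := by
      simp only [conjOf_apply, LinearMap.sub_apply, map_sub]
      abel
    rw [e]
    refine Submodule.sub_mem _ (Submodule.sub_mem _ (sumOver_mono ?_ h2) (sumOver_mono ?_ h5))
      (sumOver_mono ?_ h4) <;>
    · rintro ⟨r, s⟩ hrs
      simp only [below, Set.mem_ofPred_eq, Set.mem_insert_iff, Prod.mk.injEq] at *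
      omega
  have h8 := Submodule.mem_inf.2 ⟨h6, h7⟩
  rw [sumOver_inter h.indep] at h8
  refine sumOver_mono ?_ h8
  rintro ⟨r, s⟩ hrs
  simp only [Set.mem_ofPred_eq, Set.mem_insert_iff, Prod.mk.injEq, Set.mem_inter_iff] at *
  omega

theorem adWeightZero_conjOf [FiniteDimensional ℂ X] (hp : IsConnectionPair c W F I a b)
    (h : IsBigrading c W F I) (hc : ∀ x, c (c x) = x) {k₀ : ℤ} (hk₀ : W k₀ = ⊥)
    (hI : DirectSum.IsInternal I) :
    adWeightZero (weightEnd hI) (conjOf c (shift hI (-1) b)) = shift hI 1 a := by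
  refine adWeightZero_eq hI (fun i x hx => ?_) (fun i x hx => ?_)
  · refine sumOver_mono ?_ (hp.shift_one_mem h hc hk₀ hI (p := i.1) (q := i.2) hx).1
    rintro _ rfl
    simp
  · refine sumOver_mono (fun j hj => ?_)
      (hp.conjOf_shift_sub_shift_mem h hc hk₀ hI (p := i.1) (q := i.2) hx)
    exact ne_of_lt hj

end IsConnectionPair

end ConnectionPair

/-! ### The connection form of a variation is a connection pair -/

namespace VGPMHS

variable {E : Type*} [NormedAddCommGroup E] [NormedSpace ℂ E]
  {S : Type*} [TopologicalSpace S] [ChartedSpace E S] {𝒱 : VGPMHS E S} {s₀ : S}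

namespace LocalFrame

variable (φ : 𝒱.LocalFrame s₀)

/-- Conjugation commutes with `∇` and exchanges the sums attached to `(p, q)` and `(q, p)`.
Comparing `∇` of a section through `conj v` with `∇` of its conjugate, modulo these sums, leaves `A
v - conj A v`. -/
theorem connection_sub_conjOf_mem (ξ : E) {p q : ℤ} {v : 𝒱.fiberC s₀}
    (hv : v ∈ sumOver (𝒱.bigr s₀) (insert (p, q) (below p q))) :
    φ.connection ξ v - conjOf (conj _) (φ.connection ξ) v ∈
      sumOver (𝒱.bigr s₀) (insert (p, q) (below p q)) := by
  have hv' : conj _ v ∈ sumOver (𝒱.bigr s₀) (insert (q, p) (below q p)) :=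
    (𝒱.isBigrading s₀).map_insert_below_le q p (Submodule.mem_map_of_mem hv)
  obtain ⟨σ, hσ, hσv, hσZ⟩ := φ.exists_section (conj _ v)
  have hnhd := φ.isOpen_nhd.mem_nhds φ.mem_nhd
  have h1 := φ.nabla_sub_mem (hσ s₀ φ.mem_nhd) (Z := insert (q, p) (below q p))
    (by filter_upwards [hnhd] with s hs using hσZ _ hv' s hs) ξ
  obtain ⟨hc, hc'⟩ := 𝒱.nabla_conj (hσ s₀ φ.mem_nhd) ξ
  have h2 := φ.nabla_sub_mem hc (Z := insert (p, q) (below p q)) (by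
    filter_upwards [hnhd] with s hs
    exact (𝒱.isBigrading s).map_insert_below_le p q (Submodule.mem_map_of_mem (hσZ _ hv' s hs))) ξ
  have h3 := (𝒱.isBigrading s₀).map_insert_below_le p q (Submodule.mem_map_of_mem h1)
  rw [hc', hσv, conj_conj] at h2
  rw [hσv, map_sub] at h3
  have h4 := Submodule.sub_mem _ h3 h2
  rw [sub_sub_sub_cancel_left] at h4
  exact h4

theorem connection_mem_W (ξ : E) {k : ℤ} {v : 𝒱.fiberC s₀} (hv : v ∈ (𝒱.W s₀ k).baseChange ℂ) :
    φ.connection ξ v ∈ (𝒱.W s₀ k).baseChange ℂ := by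
  have hW : ∀ s, (𝒱.W s k).baseChange ℂ = sumOver (𝒱.bigr s) {i | i.1 + i.2 ≤ k} := fun s =>
    (𝒱.isBigrading s).W_eq k
  obtain ⟨σ, hσ, hσv, hσZ⟩ := φ.exists_section v
  have hnhd := φ.isOpen_nhd.mem_nhds φ.mem_nhd
  rw [hW] at hv
  have h1 := φ.nabla_sub_mem (hσ s₀ φ.mem_nhd) (Z := {i | i.1 + i.2 ≤ k})
    (by filter_upwards [hnhd] with s hs using hσZ _ hv s hs) ξ
  have h2 : 𝒱.nabla σ s₀ ξ ∈ (𝒱.W s₀ k).baseChange ℂ := by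
    refine 𝒱.nabla_mem (𝒱.mem_dom s₀) (hσ s₀ φ.mem_nhd) ξ (tderiv_mem (hσ s₀ φ.mem_nhd) ?_ ξ)
    filter_upwards [hnhd] with s hs
    rw [← φ.map_W s hs k]
    refine Submodule.mem_map_of_mem ?_
    rw [hW]
    exact hσZ _ hv s hs
  rw [hσv] at h1
  rw [hW] at h2 ⊢
  have h3 := Submodule.sub_mem _ h2 h1
  rwa [sub_sub_cancel] at h3

theorem connection_smul (z : ℂ) (ξ : E) : φ.connection (z • ξ) =
    (z.re : ℂ) • φ.connection ξ + (z.im : ℂ) • φ.connection (Complex.I • ξ) := by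
  have e : z • ξ = z.re • ξ + z.im • Complex.I • ξ := by
    conv_lhs => rw [← Complex.re_add_im z]
    rw [add_smul, mul_smul, Complex.coe_smul, Complex.coe_smul]
  rw [e, map_add, LinearMap.map_smul, LinearMap.map_smul]
  rfl

theorem connection_I_smul_smul (z : ℂ) (ξ : E) : φ.connection (Complex.I • z • ξ) =
    (z.re : ℂ) • φ.connection (Complex.I • ξ) - (z.im : ℂ) • φ.connection ξ := by
  rw [smul_smul, connection_smul]
  simp
  module

/-- The `(0,1)`-part of the connection form. -/
def part01 : E →ₛₗ[starRingEnd ℂ] Module.End ℂ (𝒱.fiberC s₀) where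
  toFun ξ := (1 / 2 : ℂ) • (φ.connection ξ + Complex.I • φ.connection (Complex.I • ξ))
  map_add' ξ η := by
    simp only [map_add, smul_add]
    abel
  map_smul' z ξ := by
    have e3 : starRingEnd ℂ z = z.re - z.im * Complex.I := by
      apply Complex.ext <;> simp
    rw [connection_I_smul_smul, connection_smul, e3]
    generalize φ.connection ξ = A
    generalize φ.connection (Complex.I • ξ) = B
    match_scalars
    · ring
    · linear_combination (1 / 2 * (z.im : ℂ)) * Complex.I_sq

/-- The `(1,0)`-part of the connection form. -/
def part10 : E →ₗ[ℂ] Module.End ℂ (𝒱.fiberC s₀) where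
  toFun ξ := (1 / 2 : ℂ) • (φ.connection ξ - Complex.I • φ.connection (Complex.I • ξ))
  map_add' ξ η := by
    simp only [map_add, smul_add]
    module
  map_smul' z ξ := by
    have e3 : z = z.re + z.im * Complex.I := (Complex.re_add_im z).symm
    rw [connection_I_smul_smul, connection_smul, RingHom.id_apply]
    generalize φ.connection ξ = A
    generalize φ.connection (Complex.I • ξ) = B
    conv_rhs => rw [e3]
    match_scalars
    · ring
    · linear_combination (1 / 2 * (z.im : ℂ)) * Complex.I_sq

theorem part01_apply (ξ : E) (v : 𝒱.fiberC s₀) : φ.part01 ξ v =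
    (1 / 2 : ℂ) • (φ.connection ξ v + Complex.I • φ.connection (Complex.I • ξ) v) := rfl

theorem part10_apply (ξ : E) (v : 𝒱.fiberC s₀) : φ.part10 ξ v =
    (1 / 2 : ℂ) • (φ.connection ξ v - Complex.I • φ.connection (Complex.I • ξ) v) := rfl

theorem nabla01_sub_mem {σ : 𝒱.Sec}
    (h : ContMDiffAt 𝓘(ℝ, E) 𝓘(ℝ, Fin (𝒱.rank s₀) → ℂ) ∞ (fun s' => 𝒱.chartC s₀ s' (σ s')) s₀)
    {Z : Set (ℤ × ℤ)} (hσ : ∀ᶠ s in 𝓝 s₀, σ s ∈ sumOver (𝒱.bigr s) Z) (ξ : E) :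
    𝒱.nabla01 σ s₀ ξ - φ.part01 ξ (σ s₀) ∈ sumOver (𝒱.bigr s₀) Z := by
  have h1 := φ.nabla_sub_mem h hσ ξ
  have h2 := φ.nabla_sub_mem h hσ (Complex.I • ξ)
  have h3 := Submodule.smul_mem _ (1 / 2 : ℂ)
    (Submodule.add_mem _ h1 (Submodule.smul_mem _ Complex.I h2))
  convert h3 using 1
  rw [part01_apply, RationalLocalSystem.nabla01]
  module

theorem nabla10_sub_mem {σ : 𝒱.Sec}
    (h : ContMDiffAt 𝓘(ℝ, E) 𝓘(ℝ, Fin (𝒱.rank s₀) → ℂ) ∞ (fun s' => 𝒱.chartC s₀ s' (σ s')) s₀)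
    {Z : Set (ℤ × ℤ)} (hσ : ∀ᶠ s in 𝓝 s₀, σ s ∈ sumOver (𝒱.bigr s) Z) (ξ : E) :
    𝒱.nabla10 σ s₀ ξ - φ.part10 ξ (σ s₀) ∈ sumOver (𝒱.bigr s₀) Z := by
  have h1 := φ.nabla_sub_mem h hσ ξ
  have h2 := φ.nabla_sub_mem h hσ (Complex.I • ξ)
  have h3 := Submodule.smul_mem _ (1 / 2 : ℂ)
    (Submodule.sub_mem _ h1 (Submodule.smul_mem _ Complex.I h2))
  convert h3 using 1
  rw [part10_apply, RationalLocalSystem.nabla10]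
  module

/-- It suffices to test a holomorphic frame `e` of `F^p`, which is itself a sum of pieces: `∇^{0,1}
e = 0` gives the first claim and horizontality the second, each modulo `F^p`. -/
theorem mem_F_and_mem_F (ξ : E) {p : ℤ} {x : 𝒱.fiberC s₀} (hx : x ∈ 𝒱.F s₀ p) :
    φ.part01 ξ x ∈ 𝒱.F s₀ p ∧ φ.part10 ξ x ∈ 𝒱.F s₀ (p - 1) := by
  obtain ⟨N, hN, hs₀, m, e, he, hspan⟩ := 𝒱.holomorphic_F p s₀
  have hF : ∀ s ∈ N, Submodule.span ℂ (Set.range fun j => e j s) = 𝒱.F s p :=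
    fun s hs => (hspan s hs).2
  have heF : ∀ j, ∀ s ∈ N, e j s ∈ 𝒱.F s p := fun j s hs => by
    rw [← hF s hs]
    exact Submodule.subset_span ⟨j, rfl⟩
  have key : Submodule.span ℂ (Set.range fun j => e j s₀) ≤
      (𝒱.F s₀ p).comap (φ.part01 ξ) ⊓ (𝒱.F s₀ (p - 1)).comap (φ.part10 ξ) := by
    rw [Submodule.span_le]
    rintro _ ⟨j, rfl⟩
    have hev : ∀ᶠ s in 𝓝 s₀, e j s ∈ sumOver (𝒱.bigr s) {i | p ≤ i.1} := by
      filter_upwards [hN.mem_nhds hs₀] with s hs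
      rw [← (𝒱.isBigrading s).F_eq]
      exact heF j s hs
    have h1 := φ.nabla01_sub_mem ((he j).1 s₀ hs₀) hev ξ
    have h2 := φ.nabla10_sub_mem ((he j).1 s₀ hs₀) hev ξ
    rw [← (𝒱.isBigrading s₀).F_eq] at h1 h2
    rw [(he j).2 s₀ hs₀ ξ, zero_sub, Submodule.neg_mem_iff] at h1
    refine ⟨h1, ?_⟩
    have h3 : 𝒱.nabla10 (e j) s₀ ξ ∈ 𝒱.F s₀ (p - 1) := by
      have h := 𝒱.horizontal p N hN (e j) (he j) (heF j) s₀ hs₀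
      exact Submodule.smul_mem _ _ (Submodule.sub_mem _ (h ξ) (Submodule.smul_mem _ _ (h _)))
    have h4 := Submodule.sub_mem _ h3 ((𝒱.isBigrading s₀).F_antitone (by omega) h2)
    rwa [sub_sub_cancel] at h4
  rw [← hF s₀ hs₀] at hx
  exact key hx

theorem isConnectionPair (ξ : E) :
    IsConnectionPair (conj _) (fun k => (𝒱.W s₀ k).baseChange ℂ) (𝒱.F s₀) (𝒱.bigr s₀)
      (φ.part01 ξ) (φ.part10 ξ) where
  a_sub p q x hx := by
    have h1 := φ.connection_sub_conjOf_mem ξ hx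
    have h2 := φ.connection_sub_conjOf_mem (Complex.I • ξ) hx
    have h3 := Submodule.smul_mem _ (1 / 2 : ℂ)
      (Submodule.add_mem _ h1 (Submodule.smul_mem _ Complex.I h2))
    convert h3 using 1
    simp only [conjOf_apply, part01_apply, part10_apply, map_sub, map_smulₛₗ, Complex.conj_I,
      map_div₀, map_one, map_ofNat]
    module
  b_sub p q x hx := by
    have h1 := φ.connection_sub_conjOf_mem ξ hx
    have h2 := φ.connection_sub_conjOf_mem (Complex.I • ξ) hx
    have h3 := Submodule.smul_mem _ (1 / 2 : ℂ)
      (Submodule.sub_mem _ h1 (Submodule.smul_mem _ Complex.I h2))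
    convert h3 using 1
    simp only [conjOf_apply, part01_apply, part10_apply, map_add, map_smulₛₗ, Complex.conj_I,
      map_div₀, map_one, map_ofNat]
    module
  a_F p x hx := (φ.mem_F_and_mem_F ξ hx).1
  b_F p x hx := (φ.mem_F_and_mem_F ξ hx).2
  a_W k x hx := Submodule.smul_mem _ _ (Submodule.add_mem _ (φ.connection_mem_W ξ hx)
    (Submodule.smul_mem _ _ (φ.connection_mem_W _ hx)))
  b_W k x hx := Submodule.smul_mem _ _ (Submodule.sub_mem _ (φ.connection_mem_W ξ hx)
    (Submodule.smul_mem _ _ (φ.connection_mem_W _ hx)))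

end LocalFrame

end VGPMHS

/-! ### Frames that are constant modulo a complement -/

section Frames

variable {E : Type*} [NormedAddCommGroup E] [NormedSpace ℂ E]
  {S : Type*} [TopologicalSpace S] [ChartedSpace E S]
  {X : Type*} [NormedAddCommGroup X] [NormedSpace ℂ X] [FiniteDimensional ℂ X]

/-- A smooth family of subspaces has a smooth frame that is constant modulo a complement. -/
theorem exists_frame_of_map {h : S → X →L[ℂ] X} {s₀ : S} (hs : SmoothNear E h s₀) (h1 : h s₀ = 1)
    (P : Submodule ℂ X) : ∃ (π : X →L[ℂ] X) (m : ℕ) (b : Fin m → X) (e : Fin m → S → X),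
    (∀ j, SmoothNear E (e j) s₀) ∧ ∀ᶠ s in 𝓝 s₀,
      LinearIndependent ℂ (fun j => e j s) ∧
      Submodule.span ℂ (Set.range fun j => e j s) = P.map (h s).toLinearMap ∧
      (∀ j, π (e j s) = b j) ∧ ∀ x ∈ P.map (h s).toLinearMap, π x = 0 → x = 0 := by
  have := FiniteDimensional.complete ℂ X
  obtain ⟨π, hπP, hπ1, -⟩ := exists_clm_of_disjoint (P := P) (Q := ⊥) disjoint_bot_right
  -- On `P` this is the compression `π h`, and it is invertible near `s₀`. The frame `h g⁻¹ b_j`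
  -- therefore has constant projection `b_j`, and `π` is injective on `h(P)`.
  set g : S → X →L[ℂ] X := fun s => π * h s * π + (1 - π) with hg
  have hgs : SmoothNear E g s₀ :=
    (((SmoothNear.const π).clm_mul hs).clm_mul (SmoothNear.const π)).add (SmoothNear.const (1 - π))
  have hg1 : g s₀ = 1 := by
    ext x
    simp [hg, h1, hπ1 _ (hπP x)]
  have hu := hgs.eventually_isUnit (by rw [hg1]; exact isUnit_one)
  set b := Module.finBasis ℂ P
  have hgP : ∀ s, ∀ y ∈ P, g s y = π (h s y) := fun s y hy => by
    simp [hg, hπ1 y hy]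
  have hgm : ∀ s, IsUnit (g s) → ∀ x ∈ P, Ring.inverse (g s) x ∈ P := fun s hs x hx => by
    set y := Ring.inverse (g s) x with hy
    have e1 : π (h s (π y)) + (y - π y) = x := apply_inverse_apply hs x
    have e2 : y - π y ∈ P := by
      rw [← eq_sub_iff_add_eq'] at e1
      rw [e1]
      exact Submodule.sub_mem _ hx (hπP _)
    have e3 := Submodule.add_mem _ e2 (hπP y)
    rwa [sub_add_cancel] at e3
  refine ⟨π, _, fun j => b j, fun j s => h s (Ring.inverse (g s) (b j)), fun j =>
    hs.clm_apply ((hgs.inverse hu).clm_apply (SmoothNear.const _)), ?_⟩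
  filter_upwards [hu] with s hs
  have hπe : ∀ j, π (h s (Ring.inverse (g s) (b j))) = b j := fun j => by
    rw [← hgP s _ (hgm s hs _ (b j).2), apply_inverse_apply hs]
  refine ⟨?_, le_antisymm ?_ ?_, hπe, ?_⟩
  · refine LinearIndependent.of_comp π.toLinearMap ?_
    have : (π.toLinearMap ∘ fun j => h s (Ring.inverse (g s) (b j))) = fun j => (b j : X) :=
      funext hπe
    rw [this]
    exact b.linearIndependent.map' P.subtype P.ker_subtype
  · rw [Submodule.span_le]
    rintro _ ⟨j, rfl⟩
    exact Submodule.mem_map_of_mem (f := (h s).toLinearMap) (hgm s hs _ (b j).2)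
  · rintro _ ⟨y, hy, rfl⟩
    have hgy : g s y ∈ P := by
      rw [hgP s y hy]
      exact hπP _
    have e1 := congrArg (fun x : P => h s (Ring.inverse (g s) (x : X))) (b.sum_repr ⟨g s y, hgy⟩)
    simp only [inverse_apply_apply hs, Submodule.coe_sum, Submodule.coe_smul, map_sum,
      map_smul] at e1
    rw [ContinuousLinearMap.coe_coe, ← e1]
    exact Submodule.sum_mem _ fun j _ =>
      Submodule.smul_mem _ _ (Submodule.subset_span ⟨j, rfl⟩)
  · rintro _ ⟨y, hy, rfl⟩ hx
    rw [ContinuousLinearMap.coe_coe] at hx ⊢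
    rw [← hgP s y hy] at hx
    rw [← inverse_apply_apply hs y, hx, map_zero, map_zero]

end Frames

/-! ### The decomposition of `∇` and holomorphy of `𝒰^p` -/

namespace VGPMHS

variable {E : Type*} [NormedAddCommGroup E] [NormedSpace ℂ E]
  {S : Type*} [TopologicalSpace S] [ChartedSpace E S] (𝒱 : VGPMHS E S)

theorem isInternal (s : S) : DirectSum.IsInternal (𝒱.bigr s) :=
  (𝒱.isDeligneBigrading s).isInternal

theorem finiteDimensional (s : S) : FiniteDimensional ℂ (𝒱.fiberC s) :=
  (𝒱.chartEquiv s).symm.finiteDimensional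

theorem exists_baseChange_W_eq_bot (s : S) : ∃ k, (𝒱.W s k).baseChange ℂ = ⊥ := by
  obtain ⟨k, hk⟩ := (𝒱.isMHS s).exists_W_bot
  exact ⟨k, by rw [hk, Submodule.baseChange_bot]⟩

/-- A choice of local frame around `s`. -/
def localFrame (s : S) : 𝒱.LocalFrame s := Classical.choice (𝒱.nonempty_localFrame s)

theorem mem_U_of_mem {s : S} {i : ℤ × ℤ} {x : 𝒱.fiberC s} (hx : x ∈ 𝒱.bigr s i) :
    x ∈ 𝒱.U i.1 s := by
  rw [U_eq]
  exact le_sumOver (A := {j | j.1 = i.1}) rfl hx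

theorem eq_zero_of_mem_U {s : S} {p q : ℤ} (hpq : p ≠ q) {x : 𝒱.fiberC s} (hp : x ∈ 𝒱.U p s)
    (hq : x ∈ 𝒱.U q s) : x = 0 := by
  rw [U_eq] at hp hq
  refine Submodule.disjoint_def.1 (sumOver_disjoint (𝒱.isInternal s).submodule_iSupIndep ?_) x hp hq
  rw [Set.disjoint_left]
  exact fun i hi hi' => hpq (Eq.trans (Eq.symm hi) hi')

/-- The decomposition of the Gauss–Manin connection relative to `⨁ 𝒰^p`. -/
def decomposition : 𝒱.Decomposition where
  τ s :=
    { toFun := fun ξ => shift (𝒱.isInternal s) 1 ((𝒱.localFrame s).part01 ξ)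
      map_add' := fun ξ η => by rw [map_add, shift_add]
      map_smul' := fun z ξ => by rw [map_smulₛₗ, shift_smul] }
  θ s :=
    { toFun := fun ξ => shift (𝒱.isInternal s) (-1) ((𝒱.localFrame s).part10 ξ)
      map_add' := fun ξ η => by rw [map_add, shift_add]
      map_smul' := fun z ξ => by rw [map_smul, shift_smul, RingHom.id_apply] }
  τ_mem s ξ p x hx := by
    rw [U_eq] at *
    exact shift_mem _ _ _ hx
  θ_mem s ξ p x hx := by
    rw [U_eq] at *
    exact shift_mem _ _ _ hx
  dbar_mem p N hN σ hσ hσU s hs ξ := by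
    obtain ⟨k, hk⟩ := 𝒱.exists_baseChange_W_eq_bot s
    have hx := hσU s hs
    rw [U_eq] at hx ⊢
    have h1 := (𝒱.localFrame s).nabla01_sub_mem (hσ s hs) (Z := {i | i.1 = p}) (by
      filter_upwards [hN.mem_nhds hs] with s' hs'
      rw [← U_eq]
      exact hσU s' hs') ξ
    have h2 := ((𝒱.localFrame s).isConnectionPair ξ).sub_shift_one_mem (𝒱.isBigrading s) conj_conj
      hk (𝒱.isInternal s) hx
    have h3 := Submodule.add_mem _ h1 h2
    rwa [sub_add_sub_cancel] at h3
  d_mem p N hN σ hσ hσU s hs ξ := by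
    obtain ⟨k, hk⟩ := 𝒱.exists_baseChange_W_eq_bot s
    have hx := hσU s hs
    rw [U_eq] at hx ⊢
    have h1 := (𝒱.localFrame s).nabla10_sub_mem (hσ s hs) (Z := {i | i.1 = p}) (by
      filter_upwards [hN.mem_nhds hs] with s' hs'
      rw [← U_eq]
      exact hσU s' hs') ξ
    have h2 := ((𝒱.localFrame s).isConnectionPair ξ).sub_shift_neg_one_mem (𝒱.isBigrading s)
      conj_conj hk (𝒱.isInternal s) hx
    have h3 := Submodule.add_mem _ h1 h2
    rwa [sub_add_sub_cancel] at h3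

variable {𝒱}

theorem exists_section_mem_U {s₀ : S} {p : ℤ} {v : 𝒱.fiberC s₀} (hv : v ∈ 𝒱.U p s₀) :
    ∃ (N : Set S) (σ : 𝒱.Sec), IsOpen N ∧ s₀ ∈ N ∧ 𝒱.IsSmoothOn E σ N ∧ σ s₀ = v ∧
      ∀ s ∈ N, σ s ∈ 𝒱.U p s := by
  obtain ⟨σ, hσ, hσv, hσZ⟩ := (𝒱.localFrame s₀).exists_section v
  refine ⟨_, σ, (𝒱.localFrame s₀).isOpen_nhd, (𝒱.localFrame s₀).mem_nhd, hσ, hσv, fun s hs => ?_⟩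
  rw [U_eq] at *
  exact hσZ _ hv s hs

/-- Every vector of `𝒰^p` extends to a smooth section of `𝒰^p`. Along it the two `τ` differ by an
element of both `𝒰^p` and `𝒰^{p+1}`, and likewise for `θ` with `𝒰^{p-1}`. -/
theorem Decomposition.unique (D D' : 𝒱.Decomposition) : D = D' := by
  refine Decomposition.ext (funext fun s => LinearMap.ext fun ξ => ?_)
    (funext fun s => LinearMap.ext fun ξ => ?_)
  all_goals
    refine linearMap_ext_of_isInternal (𝒱.isInternal s) fun i x hx => ?_
    have hx' := 𝒱.mem_U_of_mem hx
    obtain ⟨N, σ, hN, hs, hσ, rfl, hσU⟩ := exists_section_mem_U hx'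
    rw [← sub_eq_zero]
  · refine 𝒱.eq_zero_of_mem_U (p := i.1) (q := i.1 + 1) (by omega) ?_
      (Submodule.sub_mem _ (D.τ_mem s ξ _ _ hx') (D'.τ_mem s ξ _ _ hx'))
    have := Submodule.sub_mem _ (D'.dbar_mem i.1 N hN σ hσ hσU s hs ξ)
      (D.dbar_mem i.1 N hN σ hσ hσU s hs ξ)
    rwa [sub_sub_sub_cancel_left] at this
  · refine 𝒱.eq_zero_of_mem_U (p := i.1) (q := i.1 - 1) (by omega) ?_
      (Submodule.sub_mem _ (D.θ_mem s ξ _ _ hx') (D'.θ_mem s ξ _ _ hx'))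
    have := Submodule.sub_mem _ (D'.d_mem i.1 N hN σ hσ hσU s hs ξ)
      (D.d_mem i.1 N hN σ hσ hσU s hs ξ)
    rwa [sub_sub_sub_cancel_left] at this

variable (𝒱)

theorem adWeightZero_conjEnd_θ (s : S) (ξ : E) :
    adWeightZero (𝒱.Y s) (conjEnd (𝒱.decomposition.θ s ξ)) = 𝒱.decomposition.τ s ξ := by
  obtain ⟨k, hk⟩ := 𝒱.exists_baseChange_W_eq_bot s
  have := 𝒱.finiteDimensional s
  have h := ((𝒱.localFrame s).isConnectionPair ξ).adWeightZero_conjOf (𝒱.isBigrading s) conj_conj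
    hk (𝒱.isInternal s)
  rw [VGPMHS.Y, gradingOf_eq_weightEnd (𝒱.isInternal s)]
  exact h

/-- Around each point, `𝒰^p` has a smooth frame whose coordinates in the flat trivialization are
constant modulo a complement of `𝒰^p`. -/
theorem exists_frame (p : ℤ) (s₀ : S) : ∃ N : Set S, IsOpen N ∧ s₀ ∈ N ∧
    ∃ (m : ℕ) (e : Fin m → 𝒱.Sec), (∀ j, 𝒱.IsSmoothOn E (e j) N) ∧
    (∀ s ∈ N, LinearIndependent ℂ (fun j => e j s) ∧
      Submodule.span ℂ (Set.range fun j => e j s) = 𝒱.U p s) ∧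
    ∀ s ∈ N, ∀ j, ∀ ξ : E, 𝒱.nabla01 (e j) s ξ ∈ 𝒱.U p s → 𝒱.nabla01 (e j) s ξ = 0 := by
  set φ := 𝒱.localFrame s₀
  obtain ⟨π, m, b, e, he, hev⟩ := exists_frame_of_map φ.smooth φ.map_self
    ((sumOver (𝒱.bigr s₀) {i | i.1 = p}).map (𝒱.chartC s₀ s₀))
  obtain ⟨N, hN, hNo, hNs⟩ := eventually_nhds_iff.1
    ((hev.and (Filter.eventually_all.2 he)).and (φ.isOpen_nhd.mem_nhds φ.mem_nhd))
  have hd : N ⊆ 𝒱.dom s₀ := fun s hs => φ.nhd_subset (hN s hs).2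
  have hsm : ∀ j, 𝒱.IsSmoothOn E (𝒱.secOf s₀ (e j)) N := fun j =>
    LocalFrame.isSmoothOn_secOf hNo hd fun s hs => (hN s hs).1.2 j
  have hU : ∀ s ∈ N, (𝒱.U p s).map (𝒱.chartC s₀ s) =
      ((sumOver (𝒱.bigr s₀) {i | i.1 = p}).map (𝒱.chartC s₀ s₀)).map (φ.toFun s).toLinearMap :=
    fun s hs => by rw [U_eq, φ.map_eq s (hN s hs).2]
  refine ⟨N, hNo, hNs, m, fun j => 𝒱.secOf s₀ (e j), hsm, fun s hs => ?_, fun s hs j ξ hmem => ?_⟩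
  · obtain ⟨hli, hspan, -⟩ := (hN s hs).1.1
    have hcoord : (𝒱.chartC s₀ s ∘ fun j => 𝒱.secOf s₀ (e j) s) = fun j => e j s :=
      funext fun j => 𝒱.chartC_secOf _ (hd hs)
    refine ⟨LinearIndependent.of_comp (𝒱.chartC s₀ s) (by rwa [hcoord]), ?_⟩
    refine Submodule.map_injective_of_injective (𝒱.bijective_chartC (hd hs)).1 ?_
    rw [hU s hs, ← hspan, Submodule.map_span, ← Set.range_comp, hcoord]
  · obtain ⟨-, -, -, hinj⟩ := (hN s hs).1.1
    -- `π` is constant in flat coordinates and `π (e j)` is constant, so `π` kills every derivative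
    -- of `e j`; on `𝒰^p` it is injective.
    have hπ : ∀ ξ : E, π (𝒱.chartC s₀ s (𝒱.nabla (𝒱.secOf s₀ (e j)) s ξ)) = 0 := fun ξ => by
      rw [𝒱.chartC_nabla (hd hs) (hsm j s hs)]
      have h1 : (fun s' => 𝒱.chartC s₀ s' (𝒱.secOf s₀ (e j) s')) =ᶠ[𝓝 s] e j := by
        filter_upwards [hNo.mem_nhds hs] with s' hs'
        exact 𝒱.chartC_secOf _ (hd hs')
      have h2 : (fun s' => π.restrictScalars ℝ (e j s')) =ᶠ[𝓝 s] fun _ => b j := by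
        filter_upwards [hNo.mem_nhds hs] with s' hs'
        exact (hN s' hs').1.1.2.2.1 j
      have h3 := tderiv_comp (π.restrictScalars ℝ) ((hN s hs).1.2 j) ξ
      rw [tderiv_congr h2, tderiv_const] at h3
      rw [tderiv_congr h1]
      exact h3.symm
    refine (𝒱.bijective_chartC (hd hs)).1 ?_
    rw [map_zero]
    refine hinj _ ?_ ?_
    · rw [← hU s hs]
      exact Submodule.mem_map_of_mem hmem
    · simp only [RationalLocalSystem.nabla01, map_smul, map_add, hπ, smul_zero, add_zero]

theorem isSmoothSubbundle_U (p : ℤ) : 𝒱.IsSmoothSubbundle E (𝒱.U p) := fun s₀ => by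
  obtain ⟨N, hN, hs₀, m, e, he, hspan, -⟩ := 𝒱.exists_frame p s₀
  exact ⟨N, hN, hs₀, m, e, he, hspan⟩

variable {𝒱}

/-- On a holomorphic frame, `τ` equals `-∂̄`, hence lies in `𝒰^p ∩ 𝒰^{p+1} = 0`. Conversely, if `τ`
vanishes then `∇^{0,1}` preserves `𝒰^p`, and the frame of `exists_frame` is already holomorphic, so
no integrability theorem is needed. -/
theorem Decomposition.isHolomorphicSubbundle_U_iff (D : 𝒱.Decomposition) (p : ℤ) :
    𝒱.IsHolomorphicSubbundle E (𝒱.U p) ↔ ∀ s (ξ : E), ∀ x ∈ 𝒱.U p s, D.τ s ξ x = 0 := by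
  constructor
  · intro h s ξ x hx
    obtain ⟨N, hN, hs, m, e, he, hspan⟩ := h s
    have key : Submodule.span ℂ (Set.range fun j => e j s) ≤ LinearMap.ker (D.τ s ξ) := by
      rw [Submodule.span_le]
      rintro _ ⟨j, rfl⟩
      have heU : ∀ s ∈ N, e j s ∈ 𝒱.U p s := fun s hs => by
        rw [← (hspan s hs).2]
        exact Submodule.subset_span ⟨j, rfl⟩
      have h1 := D.dbar_mem p N hN (e j) (he j).1 heU s hs ξ
      rw [(he j).2 s hs ξ, zero_sub, Submodule.neg_mem_iff] at h1
      exact 𝒱.eq_zero_of_mem_U (p := p) (q := p + 1) (by omega) h1 (D.τ_mem s ξ p _ (heU s hs))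
    rw [← (hspan s hs).2] at hx
    exact key hx
  · intro h s₀
    obtain ⟨N, hN, hs₀, m, e, he, hspan, hzero⟩ := 𝒱.exists_frame p s₀
    refine ⟨N, hN, hs₀, m, e, fun j => ⟨he j, fun s hs ξ => hzero s hs j ξ ?_⟩, hspan⟩
    have heU : ∀ s ∈ N, e j s ∈ 𝒱.U p s := fun s hs => by
      rw [← (hspan s hs).2]
      exact Submodule.subset_span ⟨j, rfl⟩
    have h1 := D.dbar_mem p N hN (e j) (he j) heU s hs ξ
    rwa [h s ξ _ (heU s hs), sub_zero] at h1

end VGPMHS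

end MixedHodge

end

theorem lemma5p22 {E : Type*} [NormedAddCommGroup E] [NormedSpace ℂ E] [FiniteDimensional ℂ E]
    {S : Type*} [TopologicalSpace S] [ChartedSpace E S] [IsManifold 𝓘(ℂ, E) ω S]
    (𝒱 : MixedHodge.VGPMHS E S) :
    (∀ s, MixedHodge.IsDeligneBigrading (𝒱.W s) (𝒱.F s) (𝒱.I s)) ∧
    (∀ p, 𝒱.IsSmoothSubbundle E (𝒱.U p)) ∧
    ∃ D : 𝒱.Decomposition, (∀ D' : 𝒱.Decomposition, D' = D) ∧
      (∀ s (ξ : E), D.τ s ξ = MixedHodge.adWeightZero (𝒱.Y s) (MixedHodge.conjEnd (D.θ s ξ))) ∧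
      (∀ p, 𝒱.IsHolomorphicSubbundle E (𝒱.U p) ↔
        ∀ s (ξ : E), ∀ x ∈ 𝒱.U p s,
          MixedHodge.adWeightZero (𝒱.Y s) (MixedHodge.conjEnd (D.θ s ξ)) x = 0) ∧
      (∀ b : ℤ, (∀ p, b < p → ∀ s, 𝒱.U p s = ⊥) → 𝒱.IsHolomorphicSubbundle E (𝒱.U b)) := by
  have hb : ∀ b : ℤ, (∀ p, b < p → ∀ s, 𝒱.U p s = ⊥) → 𝒱.IsHolomorphicSubbundle E (𝒱.U b) := by
    refine fun b hb => (𝒱.decomposition.isHolomorphicSubbundle_U_iff b).2 fun s ξ x hx => ?_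
    have h := 𝒱.decomposition.τ_mem s ξ b x hx
    rwa [hb (b + 1) (by omega) s, Submodule.mem_bot] at h
  refine ⟨𝒱.isDeligneBigrading, 𝒱.isSmoothSubbundle_U, 𝒱.decomposition, fun D' => D'.unique _,
    fun s ξ => (𝒱.adWeightZero_conjEnd_θ s ξ).symm, fun p => ?_, hb⟩
  simp only [𝒱.adWeightZero_conjEnd_θ]
  exact 𝒱.decomposition.isHolomorphicSubbundle_U_iff p
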